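/- Let $N$ be Neretin's spheromorphism group of the rooted dyadic tree: the group of bijections of the boundary of the tree given by symbols $(\alpha_1,\alpha_0,q)$, where $\alpha_0,\alpha_1$ are finite dyadic rooted trees with the same number of leaves and $q$ consists of tree isomorphisms from the infinite dyadic subtrees below the leaves of $\alpha_0$ onto those below the leaves of $\alpha_1$. It acts cellularly on the tower $\widetilde{\mathcal M}_{0,2^\infty}(\mathbb R)=\varinjlim_n\widetilde{\mathcal M}_{0,2^n+1}(\mathbb R)$ of the (tiled by $(2^n)!$ associahedra) two-sheeted covers of the real moduli spaces $\overline{\mathcal M}_{0,2^n+1}(\mathbb R)$, whose strata are planar rooted trees with leaves labelled by the $2^n$ words of length $n$, up to reflections at internal vertices other than the root, and whose bonding maps graft the two sons at every leaf. Let $PJ_{2^\infty}=\varinjlim PJ_{2^n}$ be the fundamental group of the tower, and $\tilde{\mathcal A}_N$ the group of all lifts to its universal cover of the transformations given by elements of $N$, so that $1\to PJ_{2^\infty}\to\tilde{\mathcal A}_N\to N\to1$ is exact. For $m\ge 1$ let $J_m$ be the quasi-braid group, with generators $\alpha_T$ indexed by the intervals $T\subsetneq\{1,\dots,m\}$ with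 $|T|\ge2$ elements, and relations $\alpha_T^2=1$; $\alpha_T\alpha_{T'}=\alpha_{T''}\alpha_T$ if $T'\subset T$ and $T''$ is the mirror image of $T'$ in $T$; $\alpha_T\alpha_{T'}=\alpha_{T'}\alpha_T$ if $T\cap T'=\emptyset$. Let $\ell_m:J_m\to\mathbb Z/2$ be the homomorphism $\alpha_T\mapsto 1+|T|$. A pure quasi-braid $\alpha_{T_1}\cdots\alpha_{T_r}$ in $J_{2^n}$ (one whose image in the symmetric group, where $\alpha_T$ maps to the reversal $\omega_T$ of $T$, is trivial) defines the edge loop $\mathrm{id}\to\omega_{T_1}\to\omega_{T_1}\omega_{T_2}\to\cdots\to\mathrm{id}$ through the chambers of $\widetilde{\mathcal M}_{0,2^n+1}(\mathbb R)$. Then there is exactly one homomorphism $\ell_\infty:PJ_{2^\infty}\to\mathbb Z/2$ whose value on the loop of each pure quasi-braid $a\in J_{2^n}$ is $\ell_{2^n}(a)$, for all $n$. Its kernel is normal in $\tilde{\mathcal A}_N$ and gives a central extension $$1\to\mathbb Z/2\cong PJ_{2^\infty}/\mathrm{Ker}\,\ell_\infty\to\tilde{\mathcal A}_N/\mathrm{Ker}\,\ell_\infty\to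 N\to1 .$$ Let $Eu\in H^2(N,\mathbb F_2)$ be its class. Label the ends of the tree by infinite binary words, and let $\tau_1,\sigma,\alpha,\delta\in N$ be the following elements: $\tau_1$ exchanges $000y$ and $010y$ and fixes all other ends; $\sigma$ exchanges $000y$ with $001y$ and $010y$ with $011y$ and fixes all other ends; $\alpha$ is the automorphism of the rooted tree which changes the letter $x_n$ of $x=x_0x_1x_2\cdots$ exactly when $n\ge2$ and $x_0=\dots=x_{n-1}=0$; $\delta$ maps $00y\mapsto0y$, $01y\mapsto10y$, $1y\mapsto11y$. With $[f,g]=fgf^{-1}g^{-1}$ one has $[\tau_1,\sigma][\alpha,\delta]=1$. Let $\omega$ be the 2-cycle of $N$ attached to this relation, i.e., with $(f_1,g_1)=(\tau_1,\sigma)$ and $(f_2,g_2)=(\alpha,\delta)$, $$\omega=\sum_{i=1}^{2}\Big((f_i,g_i)-(g_i,f_i)-(g_if_i,(g_if_i)^{-1})+(f_ig_i,(g_if_i)^{-1})\Big)+([f_1,g_1],[f_2,g_2])-(1,1)$$ in the inhomogeneous bar complex with integer coefficients. Then $$\langle Eu,[\omega]\rangle=1\in\mathbb F_2,\qquad\text{and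 in particular } [\omega]\neq0 \text{ in } H_2(N)=H_2(N,\mathbb Z).$$ -/

import Mathlib

open CategoryTheory
open scoped commutatorElement

namespace Spheromorphism

/-! ## Neretin's spheromorphism group

Vertices of the (rooted, planar, complete) dyadic tree are finite binary words, `false` being the
left son and `true` the right one.  Ends of the tree are infinite binary words. -/

/-- The boundary of the rooted dyadic tree. -/
abbrev Ends : Type := ℕ → Bool

/-- The end obtained by putting the letter `b` in front of `x`. -/
def cons (b : Bool) (x : Ends) : Ends
  | 0 => b
  | n + 1 => x n

/-- The end obtained by dropping the first letter. -/
def tail (x : Ends) : Ends := fun n => x (n + 1)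

/-- `app w x` is the end `w x` below the vertex `w`. -/
def app : List Bool → Ends → Ends
  | [], x => x
  | b :: w, x => cons b (app w x)

/-- The ball of all ends below the vertex `w`. -/
def ball (w : List Bool) : Set Ends := Set.range (app w)

/-- `q` is induced on ends by an automorphism of the rooted dyadic tree, that is, `q` preserves the
length of common initial segments.  (The subtree below any vertex is identified with the whole
tree, so this is also the notion of an isomorphism between two such subtrees.) -/
def IsTreeIso (q : Equiv.Perm Ends) : Prop :=
  ∀ x y n, (∀ i < n, x i = y i) ↔ (∀ i < n, q x i = q y i)

/-- `g` is given by a symbol `(α₁, α₀, q)`, with `α₀` the full tree of some depth `n` (every symbol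
can be expanded to one of this form): `g` maps the subtree below each leaf `w` of `α₀`, by a tree
isomorphism `q`, onto the subtree below a vertex `v`.  As `g` is bijective, these vertices `v` are
the leaves of a finite dyadic tree `α₁`. -/
def IsSpheromorphism (g : Equiv.Perm Ends) : Prop :=
  ∃ n, ∀ w : List Bool, w.length = n → ∃ (v : List Bool) (q : Equiv.Perm Ends),
    IsTreeIso q ∧ ∀ x, g (app w x) = app v (q x)

@[simp] theorem cons_zero (b : Bool) (x : Ends) : cons b x 0 = b := rfl
@[simp] theorem cons_succ (b : Bool) (x : Ends) (n : ℕ) : cons b x (n + 1) = x n := rfl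
@[simp] theorem tail_cons (b : Bool) (x : Ends) : tail (cons b x) = x := rfl
@[simp] theorem app_nil (x : Ends) : app [] x = x := rfl
@[simp] theorem app_cons (b : Bool) (w : List Bool) (x : Ends) :
    app (b :: w) x = cons b (app w x) := rfl

@[simp] theorem cons_tail (x : Ends) : cons (x 0) (tail x) = x := by
  funext n; cases n <;> rfl

theorem cons_inj {b c : Bool} {x y : Ends} (h : cons b x = cons c y) : b = c ∧ x = y :=
  ⟨congrFun h 0, congrArg tail h⟩

theorem app_append (v w : List Bool) (x : Ends) : app (v ++ w) x = app v (app w x) := by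
  induction v with
  | nil => rfl
  | cons b v ih => simp [ih]

theorem app_injective (w : List Bool) : Function.Injective (app w) := by
  induction w with
  | nil => exact fun _ _ h => h
  | cons b w ih => exact fun x y h => ih (cons_inj h).2

theorem exists_app (n : ℕ) (x : Ends) : ∃ w y, w.length = n ∧ app w y = x := by
  induction n generalizing x with
  | zero => exact ⟨[], x, rfl, rfl⟩
  | succ n ih =>
    obtain ⟨w, y, hw, h⟩ := ih (tail x)
    exact ⟨x 0 :: w, y, by simp [hw], by simp [h]⟩

theorem exists_append {v u : List Bool} {x y : Ends} (h : app v x = app u y)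
    (hl : v.length ≤ u.length) : ∃ t, u = v ++ t := by
  induction v generalizing u with
  | nil => exact ⟨u, rfl⟩
  | cons b v ih =>
    cases u with
    | nil => simp at hl
    | cons c u =>
      obtain ⟨rfl, h'⟩ := cons_inj h
      obtain ⟨t, rfl⟩ := ih h' (by simpa using hl)
      exact ⟨t, rfl⟩

theorem app_agree (w : List Bool) {m : ℕ} {x y : Ends} (h : ∀ i < m, x i = y i) :
    ∀ i < w.length + m, app w x i = app w y i := by
  induction w with
  | nil => simpa using h
  | cons b w ih =>
    intro i hi
    cases i with
    | zero => rfl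
    | succ i => exact ih i (by simp at hi; omega)

theorem isTreeIso_one : IsTreeIso 1 := fun _ _ _ => Iff.rfl

theorem IsTreeIso.mul {p q : Equiv.Perm Ends} (hp : IsTreeIso p) (hq : IsTreeIso q) :
    IsTreeIso (p * q) := fun x y n => (hq x y n).trans (hp _ _ n)

theorem IsTreeIso.inv {q : Equiv.Perm Ends} (hq : IsTreeIso q) : IsTreeIso q⁻¹ := fun x y n => by
  have := hq (q⁻¹ x) (q⁻¹ y) n
  simpa using this.symm

theorem IsTreeIso.head {q : Equiv.Perm Ends} (hq : IsTreeIso q) {x y : Ends} :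
    x 0 = y 0 ↔ q x 0 = q y 0 := by
  simpa using hq x y 1

theorem IsTreeIso.restrict_bit {q : Equiv.Perm Ends} (hq : IsTreeIso q) (b : Bool) :
    ∃ (c : Bool) (p : Equiv.Perm Ends), IsTreeIso p ∧ ∀ x, q (cons b x) = cons c (p x) := by
  set c := q (cons b fun _ => false) 0 with hc
  have h1 : ∀ x, q (cons b x) 0 = c := fun x => hq.head.1 rfl
  have h2 : ∀ x, q⁻¹ (cons c x) 0 = b := fun x =>
    (hq.head (y := cons b fun _ => false)).2 (by simp [hc])
  have h1' : ∀ x, cons c (tail (q (cons b x))) = q (cons b x) := fun x => by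
    rw [← h1 x, cons_tail]
  have h2' : ∀ x, cons b (tail (q⁻¹ (cons c x))) = q⁻¹ (cons c x) := fun x => by
    conv_lhs => rw [← h2 x]
    rw [cons_tail]
  refine ⟨c, ⟨fun x => tail (q (cons b x)), fun x => tail (q⁻¹ (cons c x)), fun x => ?_,
    fun x => ?_⟩, ?_, fun x => (h1' x).symm⟩
  · simp [h1']
  · change tail (q (cons b (tail (q⁻¹ (cons c x))))) = x
    rw [h2']
    simp
  · intro x y n
    have key := hq (cons b x) (cons b y) (n + 1)
    rw [← h1', ← h1' y] at key
    constructor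
    · intro h i hi
      exact key.1 (fun j hj => by cases j with
        | zero => rfl
        | succ j => exact h j (by omega)) (i + 1) (by omega)
    · intro h i hi
      exact key.2 (fun j hj => by cases j with
        | zero => rfl
        | succ j => exact h j (by omega)) (i + 1) (by omega)

theorem IsTreeIso.restrict {q : Equiv.Perm Ends} (hq : IsTreeIso q) (w : List Bool) :
    ∃ (v : List Bool) (p : Equiv.Perm Ends), v.length = w.length ∧ IsTreeIso p ∧
      ∀ x, q (app w x) = app v (p x) := by
  induction w generalizing q with
  | nil => exact ⟨[], q, rfl, hq, fun _ => rfl⟩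
  | cons b w ih =>
    obtain ⟨c, p, hp, h⟩ := hq.restrict_bit b
    obtain ⟨v, p', hv, hp', h'⟩ := ih hp
    exact ⟨c :: v, p', by simp [hv], hp', fun x => by simp [h, h']⟩

/-- A spheromorphism acts by tree isomorphisms below every sufficiently long word. -/
theorem IsSpheromorphism.long {g : Equiv.Perm Ends} (hg : IsSpheromorphism g) :
    ∃ n, ∀ w : List Bool, n ≤ w.length → ∃ (v : List Bool) (q : Equiv.Perm Ends),
      IsTreeIso q ∧ ∀ x, g (app w x) = app v (q x) := by
  obtain ⟨n, hn⟩ := hg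
  refine ⟨n, fun w hw => ?_⟩
  obtain ⟨v, q, hq, h⟩ := hn (w.take n) (by simp [hw])
  obtain ⟨u, p, -, hp, h'⟩ := hq.restrict (w.drop n)
  refine ⟨v ++ u, p, hp, fun x => ?_⟩
  rw [app_append, ← h', ← h, ← app_append, List.take_append_drop]

theorem IsSpheromorphism.mul {g h : Equiv.Perm Ends} (hg : IsSpheromorphism g)
    (hh : IsSpheromorphism h) : IsSpheromorphism (g * h) := by
  obtain ⟨n, hn⟩ := hg.long
  obtain ⟨m, hm⟩ := hh
  refine ⟨m + n, fun w hw => ?_⟩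
  obtain ⟨v, q, hq, e⟩ := hm (w.take m) (by simp [hw])
  obtain ⟨u, p, hu, hp, e'⟩ := hq.restrict (w.drop m)
  obtain ⟨v', q', hq', e''⟩ := hn (v ++ u) (by simp [hu, hw])
  refine ⟨v', q' * p, hq'.mul hp, fun x => ?_⟩
  rw [Equiv.Perm.mul_apply, Equiv.Perm.mul_apply, ← e'', app_append, ← e', ← e, ← app_append,
    List.take_append_drop]

theorem exists_bound (n : ℕ) (f : List Bool → ℕ) : ∃ m, ∀ w : List Bool, w.length = n → f w ≤ m := by
  obtain ⟨m, hm⟩ := ((List.finite_length_eq Bool n).image f).bddAbove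
  exact ⟨m, fun w hw => hm ⟨w, hw, rfl⟩⟩

/-- Every sufficiently small ball lies in the image of a small ball. -/
theorem IsSpheromorphism.cover {g : Equiv.Perm Ends} (hg : IsSpheromorphism g) (k : ℕ) :
    ∃ m, ∀ u : List Bool, m ≤ u.length → ∃ (w : List Bool) (p : Equiv.Perm Ends),
      k ≤ w.length ∧ IsTreeIso p ∧ ∀ x, g (app w (p x)) = app u x := by
  obtain ⟨n, hn⟩ := hg.long
  choose! v q hq h using hn
  obtain ⟨m, hm⟩ := exists_bound (n + k) (fun w => (v w).length)
  refine ⟨m, fun u hu => ?_⟩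
  obtain ⟨w, y, hw, hy⟩ := exists_app (n + k) (g⁻¹ (app u fun _ => false))
  have hnw : n ≤ w.length := by omega
  have e : app (v w) (q w y) = app u fun _ => false := by
    rw [← h w hnw, hy]; simp
  obtain ⟨t, rfl⟩ := exists_append e ((hm w hw).trans hu)
  obtain ⟨t', p, ht', hp, e'⟩ := (hq w hnw).inv.restrict t
  refine ⟨w ++ t', p, by simp; omega, hp, fun x => ?_⟩
  rw [app_append, ← e', h w hnw, app_append]
  simp

theorem IsSpheromorphism.inv {g : Equiv.Perm Ends} (hg : IsSpheromorphism g) :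
    IsSpheromorphism g⁻¹ := by
  obtain ⟨m, hm⟩ := hg.cover 0
  refine ⟨m, fun u hu => ?_⟩
  obtain ⟨w, p, -, hp, h⟩ := hm u hu.ge
  exact ⟨w, p, hp, fun x => by rw [← h]; simp⟩

/-- Neretin's spheromorphism group `N`, as a group of bijections of the boundary. -/
def Neretin : Subgroup (Equiv.Perm Ends) where
  carrier := {g | IsSpheromorphism g}
  one_mem' := ⟨0, fun w _ => ⟨w, 1, isTreeIso_one, fun _ => rfl⟩⟩
  mul_mem' := IsSpheromorphism.mul
  inv_mem' := IsSpheromorphism.inv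

theorem IsSpheromorphism.continuous {g : Equiv.Perm Ends} (hg : IsSpheromorphism g) :
    Continuous g := by
  obtain ⟨n, hn⟩ := hg
  refine continuous_pi fun i => (IsLocallyConstant.iff_exists_open _).2 (fun x => ?_) |>.continuous
  refine ⟨{y | ∀ j < n + (i + 1), y j = x j}, ?_, fun _ _ => rfl, fun y hy => ?_⟩
  · have : {y : Ends | ∀ j < n + (i + 1), y j = x j} =
        Set.pi (Set.Iio (n + (i + 1))) fun j => {x j} := by
      ext y; simp [Set.mem_pi]
    rw [this]
    exact isOpen_set_pi (Set.finite_Iio _) fun _ _ => isOpen_discrete _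
  · obtain ⟨w, x', hw, rfl⟩ := exists_app n x
    obtain ⟨w', y', hw', rfl⟩ := exists_app n y
    have key : ∀ (w w' : List Bool) (x y : Ends) (k : ℕ), w.length = w'.length →
        (∀ j < w.length + k, app w y j = app w' x j) → w = w' ∧ ∀ j < k, y j = x j := by
      intro w
      induction w with
      | nil =>
        intro w' x y k hl h
        obtain rfl : w' = [] := List.length_eq_zero_iff.1 hl.symm
        exact ⟨rfl, by simpa using h⟩
      | cons b w ih =>
        intro w' x y k hl h
        cases w' with
        | nil => simp at hl
        | cons c w' =>
          have h0 := h 0 (by simp)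
          obtain ⟨rfl, h2⟩ := ih w' x y k (by simpa using hl)
            (fun j hj => h (j + 1) (by simp; omega))
          exact ⟨by simpa using h0, h2⟩
    obtain ⟨rfl, hxy⟩ := key w' w x' y' (i + 1) (by omega) (by rw [hw']; exact hy)
    obtain ⟨v, q, hq, e⟩ := hn w' hw
    rw [e, e]
    exact app_agree v ((hq _ _ _).1 hxy) i (by omega)

theorem IsSpheromorphism.image_ball {g : Equiv.Perm Ends} (hg : IsSpheromorphism g) :
    ∃ n, ∀ w : List Bool, n ≤ w.length → ∃ v, g '' ball w = ball v := by
  obtain ⟨n, hn⟩ := hg.long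
  refine ⟨n, fun w hw => ?_⟩
  obtain ⟨v, q, -, e⟩ := hn w hw
  refine ⟨v, ?_⟩
  ext y
  constructor
  · rintro ⟨_, ⟨x, rfl⟩, rfl⟩
    exact ⟨q x, (e x).symm⟩
  · rintro ⟨x, rfl⟩
    exact ⟨app w (q⁻¹ x), ⟨_, rfl⟩, by rw [e]; simp⟩

theorem finite_words (n : ℕ) : {w : List Bool | w.length < n}.Finite :=
  List.finite_length_lt Bool n

/-- Almost every ball is mapped to a ball, and almost every ball is the image of a ball. -/
theorem IsSpheromorphism.almost {g : Equiv.Perm Ends} (hg : IsSpheromorphism g) :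
    (symmDiff ((fun F => g '' F) '' Set.range ball) (Set.range ball)).Finite := by
  have half : ∀ g : Equiv.Perm Ends, IsSpheromorphism g →
      (((fun F => g '' F) '' Set.range ball) \ Set.range ball).Finite := by
    intro g hg
    obtain ⟨n, hn⟩ := hg.image_ball
    refine ((finite_words n).image fun w => g '' ball w).subset ?_
    rintro _ ⟨⟨_, ⟨w, rfl⟩, rfl⟩, hF⟩
    refine ⟨w, ?_, rfl⟩
    by_contra hw
    obtain ⟨v, hv⟩ := hn w (by simpa using hw)
    exact hF ⟨v, hv.symm⟩
  refine (half g hg).union (((half _ hg.inv).image fun F => g '' F).subset ?_)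
  rintro F ⟨hF, hF'⟩
  refine ⟨(g⁻¹ : Equiv.Perm Ends) '' F, ⟨⟨F, hF, rfl⟩, ?_⟩, ?_⟩
  · rintro ⟨w, hw⟩
    refine hF' ⟨ball w, ⟨w, rfl⟩, ?_⟩
    simp only [hw, Set.image_image]
    simp
  · simp [Set.image_image]


/-! ## The elements `τ₁`, `σ`, `α`, `δ` of `N`

Let `a = 00` and `b = 01`, and number the sons of `a` and `b` as
`1 = 000`, `2 = 001`, `3 = 010`, `4 = 011`. -/

/-- Change the `n`-th letter of `x` exactly when `P x n` holds. -/
def flipWhere (P : Ends → ℕ → Prop) [∀ x n, Decidable (P x n)] (x : Ends) : Ends :=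
  fun n => if P x n then !x n else x n

theorem involutive_flipWhere {P : Ends → ℕ → Prop} [∀ x n, Decidable (P x n)]
    (h : ∀ x n, P (flipWhere P x) n ↔ P x n) : Function.Involutive (flipWhere P) := by
  intro x
  funext n
  by_cases hP : P x n
  · have := (h x n).2 hP
    rw [flipWhere, if_pos this, flipWhere, if_pos hP, Bool.not_not]
  · have := (h x n).not.2 hP
    rw [flipWhere, if_neg this, flipWhere, if_neg hP]

/-- `τ₁ = (13)` exchanges `000y` and `010y` and fixes all other ends. -/
def tauOnePerm : Equiv.Perm Ends :=
  (involutive_flipWhere (P := fun x n => n = 1 ∧ x 0 = false ∧ x 2 = false)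
    (by intro x n; simp [flipWhere])).toPerm

/-- `σ = (12)(34)` exchanges `000y` and `001y`, and `010y` and `011y`. -/
def sigmaPerm : Equiv.Perm Ends :=
  (involutive_flipWhere (P := fun x n => n = 2 ∧ x 0 = false)
    (by intro x n; simp [flipWhere])).toPerm

theorem alpha_left_inv (x : Ends) (n : ℕ) :
    (∀ i < n, flipWhere (fun x n => 2 ≤ n ∧ ∀ i < n, x i = false) x i = decide (2 ≤ i)) ↔
      ∀ i < n, x i = false := by
  induction n with
  | zero => simp
  | succ n ih =>
    rw [Nat.forall_lt_succ_right, Nat.forall_lt_succ_right, ih]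
    refine and_congr_right fun h => ?_
    by_cases hn : 2 ≤ n
    · simp [flipWhere, hn]; exact fun i hi => h i hi
    · simp [flipWhere, hn]

/-- `α` is the automorphism of the rooted tree which exchanges the two sons of each of the vertices
`00`, `000`, `0000`, … , the lower exchanges being performed first: the `n`-th letter
(counted from `0`) of `x` is changed exactly when `n ≥ 2` and all previous letters of `x` are `0`. -/
def alphaPerm : Equiv.Perm Ends where
  toFun := flipWhere fun x n => 2 ≤ n ∧ ∀ i < n, x i = false
  invFun := flipWhere fun x n => 2 ≤ n ∧ ∀ i < n, x i = decide (2 ≤ i)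
  left_inv x := by
    funext n
    conv_lhs => rw [flipWhere]
    simp only [alpha_left_inv]
    by_cases h : 2 ≤ n ∧ ∀ i < n, x i = false
    · rw [if_pos h, flipWhere, if_pos h, Bool.not_not]
    · rw [if_neg h, flipWhere, if_neg h]
  right_inv x := by
    have aux : ∀ n, (∀ i < n, flipWhere (fun x n => 2 ≤ n ∧ ∀ i < n, x i = decide (2 ≤ i)) x i =
        false) ↔ ∀ i < n, x i = decide (2 ≤ i) := by
      intro n
      induction n with
      | zero => simp
      | succ n ih =>
        rw [Nat.forall_lt_succ_right, Nat.forall_lt_succ_right, ih]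
        refine and_congr_right fun h => ?_
        by_cases hn : 2 ≤ n
        · simp [flipWhere, hn]; grind
        · simp [flipWhere, hn]
    funext n
    conv_lhs => rw [flipWhere]
    simp only [aux]
    by_cases h : 2 ≤ n ∧ ∀ i < n, x i = decide (2 ≤ i)
    · rw [if_pos h, flipWhere, if_pos h, Bool.not_not]
    · rw [if_neg h, flipWhere, if_neg h]

/-- The translation `δ` : `00y ↦ 0y`, `01y ↦ 10y`, `1y ↦ 11y`. -/
def deltaPerm : Equiv.Perm Ends where
  toFun x := if x 0 then cons true x else if x 1 then cons true (cons false (tail (tail x)))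
    else tail x
  invFun x := if x 0 then (if x 1 then tail x else cons false (cons true (tail (tail x))))
    else cons false x
  left_inv x := by
    rcases h0 : x 0 with _ | _
    · rcases h1 : x 1 with _ | _
      · have : tail x 0 = false := h1
        simp [h0, h1, this]
        conv_rhs => rw [← cons_tail x, h0]
      · simp [h0, h1]
        conv_rhs => rw [← cons_tail x, ← cons_tail (tail x), h0, show tail x 0 = true from h1]
    · simp [h0]
  right_inv x := by
    rcases h0 : x 0 with _ | _
    · simp [h0]
    · rcases h1 : x 1 with _ | _
      · simp [h0, h1]
        conv_rhs => rw [← cons_tail x, ← cons_tail (tail x), h0, show tail x 0 = false from h1]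
      · have : tail x 0 = true := h1
        simp [h0, h1, this]
        conv_rhs => rw [← cons_tail x, h0]

/-- The action of `α` below the vertex `00`. -/
def odo : Ends → Ends := flipWhere fun x n => ∀ i < n, x i = false

theorem cons_false_iff (c : Bool) (y : Ends) (n : ℕ) :
    (∀ i < n + 1, cons c y i = false) ↔ c = false ∧ ∀ i < n, y i = false :=
  ⟨fun h => ⟨h 0 (by omega), fun i hi => h (i + 1) (by omega)⟩, fun h i hi => by
    cases i with
    | zero => exact h.1
    | succ i => exact h.2 i (by omega)⟩

theorem odo_cons (c : Bool) (y : Ends) : odo (cons c y) = cons (!c) (if c then y else odo y) := by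
  funext n
  rcases n with _ | n
  · simp [odo, flipWhere]
  · unfold odo flipWhere
    simp only [cons_false_iff, cons_succ]
    cases c <;> simp

theorem alpha_cons (a b : Bool) (y : Ends) : alphaPerm (cons a (cons b y)) =
    cons a (cons b (if a || b then y else odo y)) := by
  funext n
  change flipWhere (fun x n => 2 ≤ n ∧ ∀ i < n, x i = false) _ n = _
  rcases n with _ | _ | n
  · simp [flipWhere]
  · simp [flipWhere]
  · unfold odo flipWhere
    simp only [cons_false_iff, cons_succ]
    cases a <;> cases b <;> simp

theorem relation_perm :
    ⁅tauOnePerm, sigmaPerm⁆ * ⁅alphaPerm, deltaPerm⁆ = 1 := by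
  have main : tauOnePerm * sigmaPerm * tauOnePerm * sigmaPerm * alphaPerm * deltaPerm =
      deltaPerm * alphaPerm := by
    ext1 z
    simp only [Equiv.Perm.mul_apply]
    obtain ⟨w, y, hw, rfl⟩ := exists_app 2 z
    obtain ⟨a, b, rfl⟩ := List.length_eq_two.1 hw
    have hs : ∀ a b c y, sigmaPerm (cons a (cons b (cons c y))) =
        cons a (cons b (cons (if a then c else !c) y)) := by
      intro a b c y
      funext n
      simp only [sigmaPerm, Function.Involutive.coe_toPerm]
      rcases n with _ | _ | _ | n <;> cases a <;> simp [flipWhere, cons]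
    have ht : ∀ a b c y, tauOnePerm (cons a (cons b (cons c y))) =
        cons a (cons (if a || c then b else !b) (cons c y)) := by
      intro a b c y
      funext n
      simp only [tauOnePerm, Function.Involutive.coe_toPerm]
      rcases n with _ | _ | _ | n <;> cases a <;> cases c <;> simp [flipWhere, cons]
    obtain ⟨c, y, rfl⟩ : ∃ c y', y = cons c y' := ⟨y 0, tail y, (cons_tail y).symm⟩
    have hd : ∀ a b y, deltaPerm (cons a (cons b y)) = if a then cons true (cons true (cons b y))
        else if b then cons true (cons false y) else cons false y := by
      intro a b y
      cases a <;> cases b <;> simp [deltaPerm]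
    simp only [app_cons, app_nil]
    obtain ⟨d, y, rfl⟩ : ∃ c y', y = cons c y' := ⟨y 0, tail y, (cons_tail y).symm⟩
    cases a <;> cases b <;> cases c <;> cases d <;> simp [hs, ht, hd, alpha_cons, odo_cons]
  have h1 : tauOnePerm⁻¹ = tauOnePerm := rfl
  have h2 : sigmaPerm⁻¹ = sigmaPerm := rfl
  rw [commutatorElement_def, commutatorElement_def, h1, h2, ← mul_assoc, ← mul_assoc, ← mul_assoc,
    main]
  group

theorem tauOnePerm_mem : tauOnePerm ∈ Neretin := by
  refine ⟨3, fun w hw => ?_⟩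
  obtain ⟨a, b, c, rfl⟩ := List.length_eq_three.1 hw
  refine ⟨if a = false ∧ c = false then [a, !b, c] else [a, b, c], 1, isTreeIso_one, fun x => ?_⟩
  funext n
  simp only [tauOnePerm, Function.Involutive.coe_toPerm]
  rcases n with _ | _ | _ | n <;> cases a <;> cases c <;> simp [flipWhere, cons]

theorem sigmaPerm_mem : sigmaPerm ∈ Neretin := by
  refine ⟨3, fun w hw => ?_⟩
  obtain ⟨a, b, c, rfl⟩ := List.length_eq_three.1 hw
  refine ⟨if a = false then [a, b, !c] else [a, b, c], 1, isTreeIso_one, fun x => ?_⟩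
  funext n
  simp only [sigmaPerm, Function.Involutive.coe_toPerm]
  rcases n with _ | _ | _ | n <;> cases a <;> simp [flipWhere, cons]

theorem deltaPerm_mem : deltaPerm ∈ Neretin := by
  refine ⟨2, fun w hw => ?_⟩
  obtain ⟨a, b, rfl⟩ := List.length_eq_two.1 hw
  refine ⟨if a then [true, true, b] else if b then [true, false] else [false], 1,
    isTreeIso_one, fun x => ?_⟩
  cases a <;> cases b <;> simp [deltaPerm]

theorem alphaPerm_isTreeIso : IsTreeIso alphaPerm := by
  have aux : ∀ (P : Ends → ℕ → Prop) [∀ x n, Decidable (P x n)],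
      (∀ x y n, (∀ i < n, x i = y i) → (P x n ↔ P y n)) →
      ∀ x y n, (∀ i < n, x i = y i) → ∀ i < n, flipWhere P x i = flipWhere P y i := by
    intro P _ hP x y n h i hi
    simp only [flipWhere, h i hi, hP x y i fun j hj => h j (hj.trans hi)]
  refine fun x y n => ⟨aux (fun x n => 2 ≤ n ∧ ∀ i < n, x i = false) (fun x y n h => ?_) x y n, fun h => ?_⟩
  · exact and_congr_right fun _ => forall₂_congr fun i hi => by rw [h i hi]
  · have := aux (fun x n => 2 ≤ n ∧ ∀ i < n, x i = decide (2 ≤ i)) (fun x y n h =>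
      and_congr_right fun _ => forall₂_congr fun i hi => by rw [h i hi]) _ _ n h
    intro i hi
    have h3 := this i hi
    change alphaPerm.symm (alphaPerm x) i = alphaPerm.symm (alphaPerm y) i at h3
    simpa using h3

theorem alphaPerm_mem : alphaPerm ∈ Neretin :=
  ⟨0, fun w hw => ⟨[], alphaPerm, alphaPerm_isTreeIso, fun x => by
    rw [List.length_eq_zero_iff.1 hw]; rfl⟩⟩

def tauOne : Neretin := ⟨tauOnePerm, tauOnePerm_mem⟩
def sigma : Neretin := ⟨sigmaPerm, sigmaPerm_mem⟩
def alpha : Neretin := ⟨alphaPerm, alphaPerm_mem⟩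
def delta : Neretin := ⟨deltaPerm, deltaPerm_mem⟩

theorem relation : ⁅tauOne, sigma⁆ * ⁅alpha, delta⁆ = 1 := Subtype.ext relation_perm

/-! ## Central extensions, 2-cycles and the pairing between cohomology and homology -/

section Cohomology

variable {G A : Type} [Group G] [AddCommGroup A]

/-- The value of a 2-cochain on a 2-chain. -/
noncomputable def evalChain (c : G × G → A) : (G × G →₀ ℤ) →ₗ[ℤ] A :=
  Finsupp.linearCombination ℤ c

theorem evalChain_boundary (c : groupCohomology.cocycles₂ (Rep.trivial ℤ G A))
    (z : G × G →₀ ℤ) (hz : z ∈ groupHomology.boundaries₂ (Rep.trivial ℤ G ℤ)) :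
    evalChain (A := A) c z = 0 := by
  obtain ⟨y, rfl⟩ := hz
  change (evalChain (A := A) c ∘ₗ (groupHomology.d₃₂ (Rep.trivial ℤ G ℤ)).hom) y = 0
  have : (evalChain (A := A) c ∘ₗ (groupHomology.d₃₂ (Rep.trivial ℤ G ℤ)).hom) = 0 := by
    refine Finsupp.lhom_ext fun g a => ?_
    rw [LinearMap.comp_apply]
    erw [groupHomology.d₃₂_single]
    have h := (groupCohomology.mem_cocycles₂_iff (A := Rep.trivial ℤ G A) c).1 c.2 g.1 g.2.1 g.2.2
    change c.1 (g.1 * g.2.1, g.2.2) + c.1 (g.1, g.2.1) =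
      c.1 (g.2.1, g.2.2) + c.1 (g.1, g.2.1 * g.2.2) at h
    change evalChain c.1 (Finsupp.single (g.2.1, g.2.2) a - Finsupp.single (g.1 * g.2.1, g.2.2) a +
      Finsupp.single (g.1, g.2.1 * g.2.2) a - Finsupp.single (g.1, g.2.1) a) = 0
    simp only [evalChain, map_sub, map_add, Finsupp.linearCombination_single, ← smul_sub,
      ← smul_add]
    rw [sub_add_eq_add_sub, ← h]
    simp
  rw [this]; rfl

theorem evalChain_coboundary (c : G × G → A)
    (hc : c ∈ groupCohomology.coboundaries₂ (Rep.trivial ℤ G A))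
    (z : groupHomology.cycles₂ (Rep.trivial ℤ G ℤ)) :
    evalChain c z.1 = 0 := by
  obtain ⟨y, rfl⟩ := hc
  have key : evalChain (A := A) ((groupCohomology.d₁₂ (Rep.trivial ℤ G A)).hom y) =
      (Finsupp.linearCombination ℤ (y : G → A)) ∘ₗ
        (groupHomology.d₂₁ (Rep.trivial ℤ G ℤ)).hom := by
    refine Finsupp.lhom_ext fun g a => ?_
    rw [LinearMap.comp_apply]
    erw [groupHomology.d₂₁_single]
    change evalChain (fun g : G × G => y g.2 - y (g.1 * g.2) + y g.1) _ =
      Finsupp.linearCombination ℤ (y : G → A) (Finsupp.single g.2 a -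
        Finsupp.single (g.1 * g.2) a + Finsupp.single g.1 a)
    simp only [evalChain, map_sub, map_add, Finsupp.linearCombination_single, ← smul_sub,
      ← smul_add]
  have hz : (groupHomology.d₂₁ (Rep.trivial ℤ G ℤ)).hom z.1 = 0 := z.2
  have := LinearMap.congr_fun key z.1
  rw [LinearMap.comp_apply, hz, map_zero] at this
  exact this

theorem exists_cocycle (e : groupCohomology.H2 (Rep.trivial ℤ G A)) :
    ∃ c, groupCohomology.H2π (Rep.trivial ℤ G A) c = e :=
  groupCohomology.H2_induction_on e fun c => ⟨c, rfl⟩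

theorem exists_cycle (h : groupHomology.H2 (Rep.trivial ℤ G ℤ)) :
    ∃ z, groupHomology.H2π (Rep.trivial ℤ G ℤ) z = h :=
  groupHomology.H2_induction_on h fun z => ⟨z, rfl⟩

/-- The Kronecker pairing of `H²(G, A)` with `H₂(G)` (trivial coefficients), computed by evaluating any
representing cocycle on any representing cycle, see `pairing_mk`. -/
noncomputable def pairing (e : groupCohomology.H2 (Rep.trivial ℤ G A))
    (h : groupHomology.H2 (Rep.trivial ℤ G ℤ)) : A :=
  evalChain (A := A) (exists_cocycle e).choose (exists_cycle h).choose.1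

theorem pairing_mk (c : groupCohomology.cocycles₂ (Rep.trivial ℤ G A))
    (z : groupHomology.cycles₂ (Rep.trivial ℤ G ℤ)) :
    pairing (groupCohomology.H2π _ c) (groupHomology.H2π _ z) = evalChain (A := A) c z.1 := by
  have h1 := (groupCohomology.H2π_eq_iff _ _).1
    (exists_cocycle (groupCohomology.H2π (Rep.trivial ℤ G A) c)).choose_spec
  have h2 := (groupHomology.H2π_eq_iff _ _).1
    (exists_cycle (groupHomology.H2π (Rep.trivial ℤ G ℤ) z)).choose_spec
  have e1 := evalChain_coboundary _ h1 z
  have e2 := evalChain_boundary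
    (exists_cocycle (groupCohomology.H2π (Rep.trivial ℤ G A) c)).choose _ h2
  rw [map_sub, sub_eq_zero] at e2
  unfold pairing
  refine e2.trans ?_
  rw [← sub_eq_zero, ← e1]
  simp only [evalChain, Finsupp.linearCombination_apply, Finsupp.sum, ← Finset.sum_sub_distrib,
    ← smul_sub]
  rfl

theorem relationCycle_mem (f₁ g₁ f₂ g₂ : G) (h : ⁅f₁, g₁⁆ * ⁅f₂, g₂⁆ = 1) :
    (Finsupp.single (f₁, g₁) 1 - Finsupp.single (g₁, f₁) 1
      - Finsupp.single (g₁ * f₁, (g₁ * f₁)⁻¹) 1 + Finsupp.single (f₁ * g₁, (g₁ * f₁)⁻¹) 1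
      + (Finsupp.single (f₂, g₂) 1 - Finsupp.single (g₂, f₂) 1
      - Finsupp.single (g₂ * f₂, (g₂ * f₂)⁻¹) 1 + Finsupp.single (f₂ * g₂, (g₂ * f₂)⁻¹) 1)
      + Finsupp.single (⁅f₁, g₁⁆, ⁅f₂, g₂⁆) 1 - Finsupp.single (1, 1) 1 : G × G →₀ ℤ) ∈
      groupHomology.cycles₂ (Rep.trivial ℤ G ℤ) := by
  have key : ∀ a b : G, (groupHomology.d₂₁ (Rep.trivial ℤ G ℤ)).hom (Finsupp.single (a, b) (1:ℤ))
     = (Finsupp.single b 1 - Finsupp.single (a * b) 1 + Finsupp.single a 1 : G →₀ ℤ) := by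
    intro a b
    have := groupHomology.d₂₁_single (A := Rep.trivial ℤ G ℤ) (a, b) (1 : ℤ)
    exact this
  have e : ∀ a b : G, a * b * (b * a)⁻¹ = ⁅a, b⁆ := fun a b => by
    rw [commutatorElement_def]; group
  have main : ∀ D : (G × G →₀ ℤ) →ₗ[ℤ] (G →₀ ℤ), (∀ a b : G, D (Finsupp.single (a, b) (1 : ℤ)) =
      Finsupp.single b 1 - Finsupp.single (a * b) 1 + Finsupp.single a 1) → D
      (Finsupp.single (f₁, g₁) 1 - Finsupp.single (g₁, f₁) 1
      - Finsupp.single (g₁ * f₁, (g₁ * f₁)⁻¹) 1 + Finsupp.single (f₁ * g₁, (g₁ * f₁)⁻¹) 1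
      + (Finsupp.single (f₂, g₂) 1 - Finsupp.single (g₂, f₂) 1
      - Finsupp.single (g₂ * f₂, (g₂ * f₂)⁻¹) 1 + Finsupp.single (f₂ * g₂, (g₂ * f₂)⁻¹) 1)
      + Finsupp.single (⁅f₁, g₁⁆, ⁅f₂, g₂⁆) 1 - Finsupp.single (1, 1) 1) = 0 := by
    intro D hD
    simp only [map_sub, map_add, hD, e, h, mul_inv_cancel, mul_one]
    abel
  exact main (groupHomology.d₂₁ (Rep.trivial ℤ G ℤ)).hom key

/-- The 2-cycle attached to a relation `[f₁, g₁][f₂, g₂] = 1` in `G`, written in the inhomogeneous bar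
complex.  The degenerate term `- (1, 1)`, which vanishes in the normalized complex, makes it a
cycle in the unnormalized complex. -/
noncomputable def relationCycle (f₁ g₁ f₂ g₂ : G) (h : ⁅f₁, g₁⁆ * ⁅f₂, g₂⁆ = 1) :
    groupHomology.cycles₂ (Rep.trivial ℤ G ℤ) :=
  ⟨_, relationCycle_mem f₁ g₁ f₂ g₂ h⟩

theorem factorSet_exists {E : Type} [Group E] (S : GroupExtension (Multiplicative A) E G)
    (p : G × G) : ∃ a : A, S.inl (Multiplicative.ofAdd a) *
      Function.surjInv S.rightHom_surjective (p.1 * p.2) =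
      Function.surjInv S.rightHom_surjective p.1 * Function.surjInv S.rightHom_surjective p.2 := by
  have : Function.surjInv S.rightHom_surjective p.1 * Function.surjInv S.rightHom_surjective p.2 *
      (Function.surjInv S.rightHom_surjective (p.1 * p.2))⁻¹ ∈ S.inl.range := by
    rw [S.range_inl_eq_ker_rightHom, MonoidHom.mem_ker]
    simp [Function.surjInv_eq]
  obtain ⟨a, ha⟩ := this
  exact ⟨a.toAdd, by rw [ofAdd_toAdd, ha]; group⟩

/-- The factor set of an extension: `s g * s h = c (g, h) * s (g * h)` for a section `s`. -/
noncomputable def factorSet {E : Type} [Group E] (S : GroupExtension (Multiplicative A) E G) :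
    G × G → A := fun p => (factorSet_exists S p).choose

theorem factorSet_mem {E : Type} [Group E] (S : GroupExtension (Multiplicative A) E G)
    (hS : S.inl.range ≤ Subgroup.center E) :
    factorSet S ∈ groupCohomology.cocycles₂ (Rep.trivial ℤ G A) := by
  rw [groupCohomology.mem_cocycles₂_iff]
  intro g h j
  change factorSet S (g * h, j) + factorSet S (g, h) =
    factorSet S (h, j) + factorSet S (g, h * j)
  have spec := fun p => (factorSet_exists S p).choose_spec
  change ∀ p : G × G, S.inl (Multiplicative.ofAdd (factorSet S p)) * _ = _ at spec
  have cen : ∀ (a : Multiplicative A) (e : E), e * S.inl a = S.inl a * e := fun a e =>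
    Subgroup.mem_center_iff.1 (hS ⟨a, rfl⟩) e
  have e1 := spec (g * h, j)
  have e2 := spec (g, h)
  have e3 := spec (h, j)
  have e4 := spec (g, h * j)
  dsimp only at e1 e2 e3 e4
  apply Multiplicative.ofAdd.injective
  apply S.inl_injective
  rw [ofAdd_add, ofAdd_add, map_mul, map_mul]
  apply mul_right_cancel (b := Function.surjInv S.rightHom_surjective (g * h * j))
  generalize Function.surjInv S.rightHom_surjective = s at *
  rw [← cen]
  rw [mul_assoc, e1, ← mul_assoc, e2, mul_assoc g h j, mul_assoc (S.inl _), e4, ← mul_assoc,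
    ← cen, mul_assoc (s g) (S.inl _), e3, mul_assoc]

/-- The class in `H²(G, A)` of a central extension of `G` by `A`. -/
noncomputable def extensionClass {E : Type} [Group E]
    (S : GroupExtension (Multiplicative A) E G) (hS : S.inl.range ≤ Subgroup.center E) :
    groupCohomology.H2 (Rep.trivial ℤ G A) :=
  groupCohomology.H2π _ ⟨factorSet S, factorSet_mem S hS⟩

end Cohomology

/-! ## The tower of real moduli spaces, through its poset of strata

A stratum of the two-sheeted cover of the real moduli space of stable genus zero curves with `2 ^ n`
labelled inputs and one output is a planar rooted tree whose leaves are labelled by the `2 ^ n`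
words of length `n`, two labelled trees defining the same stratum when they differ by
reflections at internal vertices other than the root.  The stabilization map grafts the two sons of
the label at every leaf.  In the direct limit a stratum is therefore an infinite planar tree whose
ends are labelled by `Ends`, which below almost all of its vertices is the dyadic tree itself,
again up to reflections at the vertices other than the root.

Such a tree is described by the family `fam` of the sets `F` of ends lying below its vertices
other than the root (a nested family, unchanged by reflections), and its planar structure by the
left-to-right order of the ends. -/

/-- `r` is the left-to-right order of the ends for some planar structure on the tree with nested
family `fam`: a strict linear order for which the ends below each vertex are consecutive. -/
def IsPlanarOrder (fam : Set (Set Ends)) (r : Ends → Ends → Prop) : Prop :=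
  IsStrictTotalOrder Ends r ∧ ∀ F ∈ fam, ∀ x ∈ F, ∀ y ∈ F, ∀ z, r x z → r z y → z ∈ F

/-- `F` is the vertex (other than the root) at which the ends `x` and `y` branch. -/
def IsMeet (fam : Set (Set Ends)) (x y : Ends) (F : Set Ends) : Prop :=
  F ∈ fam ∧ x ∈ F ∧ y ∈ F ∧ ∀ G ∈ fam, x ∈ G → y ∈ G → F ⊆ G

/-- `r'` is obtained from `r` by inverting the order of the sons at all the vertices in a set `V` of
vertices other than the root.  (Reflecting the whole subtree below a vertex `v` amounts to taking
for `V` the vertex `v` and all its descendants; conversely, inverting the sons at `v` is the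
product of the reflections at `v` and at its sons.) -/
def IsReflectionOf (fam : Set (Set Ends)) (r r' : Ends → Ends → Prop) : Prop :=
  ∃ V ⊆ fam, ∀ x y, r' x y ↔
    ((∃ F ∈ V, IsMeet fam x y F) ∧ r y x) ∨ ((¬ ∃ F ∈ V, IsMeet fam x y F) ∧ r x y)

/-- A stratum of the tower: a nested family of proper subsets, almost all of whose members
are balls and which contains almost all balls, together with the class of a planar order under
reflections at the vertices other than the root. -/
@[ext]
structure Stratum where
  fam : Set (Set Ends)
  orders : Set (Ends → Ends → Prop)
  proper : ∀ F ∈ fam, IsClopen F ∧ F.Nonempty ∧ F ≠ Set.univ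
  nested : ∀ F ∈ fam, ∀ G ∈ fam, F ⊆ G ∨ G ⊆ F ∨ Disjoint F G
  cofinite : (symmDiff fam (Set.range ball)).Finite
  planar : ∃ r, IsPlanarOrder fam r ∧ orders = {r' | IsReflectionOf fam r r'}

/-- `s ≤ t` when `s` lies in the closure of `t`: both are represented with the same planar order, and
the tree of `t` is obtained from the tree of `s` by contracting edges. -/
instance : PartialOrder Stratum where
  le s t := t.fam ⊆ s.fam ∧ t.orders ⊆ s.orders
  le_refl s := ⟨subset_rfl, subset_rfl⟩
  le_trans s t u h h' := ⟨h'.1.trans h.1, h'.2.trans h.2⟩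
  le_antisymm s t h h' := Stratum.ext (h'.1.antisymm h.1) (h'.2.antisymm h.2)

/-- The image of a family of sets of ends under `g`. -/
def imageFam (g : Equiv.Perm Ends) (fam : Set (Set Ends)) : Set (Set Ends) :=
  (fun F => g '' F) '' fam

/-- The image of an order under `g`. -/
def imageOrder (g : Equiv.Perm Ends) (r : Ends → Ends → Prop) : Ends → Ends → Prop :=
  fun x y => r (g⁻¹ x) (g⁻¹ y)

theorem imageOrder_one (r : Ends → Ends → Prop) : imageOrder 1 r = r := rfl

theorem imageOrder_mul (g h : Equiv.Perm Ends) (r : Ends → Ends → Prop) :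
    imageOrder (g * h) r = imageOrder g (imageOrder h r) := by
  funext x y
  simp [imageOrder, mul_inv_rev]

theorem mem_image_perm (g : Equiv.Perm Ends) (F : Set Ends) (x : Ends) :
    x ∈ g '' F ↔ g⁻¹ x ∈ F := by
  constructor
  · rintro ⟨y, hy, rfl⟩
    simpa using hy
  · exact fun h => ⟨_, h, by simp⟩

theorem isMeet_image {fam : Set (Set Ends)} (g : Equiv.Perm Ends) (x y : Ends) (F : Set Ends) :
    IsMeet (imageFam g fam) x y (g '' F) ↔ IsMeet fam (g⁻¹ x) (g⁻¹ y) F := by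
  have hinj : Function.Injective fun F : Set Ends => g '' F := g.injective.image_injective
  unfold IsMeet imageFam
  rw [hinj.mem_set_image, mem_image_perm, mem_image_perm, Set.forall_mem_image]
  simp only [mem_image_perm, Set.image_subset_image_iff g.injective]

theorem isReflectionOf_image {fam : Set (Set Ends)} {r r' : Ends → Ends → Prop}
    (g : Equiv.Perm Ends) (h : IsReflectionOf fam r r') :
    IsReflectionOf (imageFam g fam) (imageOrder g r) (imageOrder g r') := by
  obtain ⟨V, hV, h⟩ := h
  refine ⟨imageFam g V, Set.image_mono hV, fun x y => ?_⟩
  have : (∃ F ∈ imageFam g V, IsMeet (imageFam g fam) x y F) ↔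
      ∃ F ∈ V, IsMeet fam (g⁻¹ x) (g⁻¹ y) F := by
    constructor
    · rintro ⟨_, ⟨F, hF, rfl⟩, hm⟩
      exact ⟨F, hF, (isMeet_image g x y F).1 hm⟩
    · rintro ⟨F, hF, hm⟩
      exact ⟨_, ⟨F, hF, rfl⟩, (isMeet_image g x y F).2 hm⟩
  rw [this]
  exact h _ _

theorem imageFam_one (fam : Set (Set Ends)) : imageFam 1 fam = fam := by
  simp [imageFam]

theorem imageFam_mul (g h : Equiv.Perm Ends) (fam : Set (Set Ends)) :
    imageFam (g * h) fam = imageFam g (imageFam h fam) := by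
  simp [imageFam, Set.image_image]

theorem image_orders {fam : Set (Set Ends)} {r : Ends → Ends → Prop} (g : Equiv.Perm Ends) :
    imageOrder g '' {r' | IsReflectionOf fam r r'} =
      {r' | IsReflectionOf (imageFam g fam) (imageOrder g r) r'} := by
  ext r'
  constructor
  · rintro ⟨r', hr', rfl⟩
    exact isReflectionOf_image g hr'
  · intro h
    have := isReflectionOf_image g⁻¹ h
    rw [← imageOrder_mul, ← imageFam_mul, inv_mul_cancel, imageOrder_one, imageFam_one] at this
    exact ⟨_, this, by rw [← imageOrder_mul, mul_inv_cancel, imageOrder_one]⟩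

theorem isPlanarOrder_image {fam : Set (Set Ends)} {r : Ends → Ends → Prop}
    (g : Equiv.Perm Ends) (h : IsPlanarOrder fam r) :
    IsPlanarOrder (imageFam g fam) (imageOrder g r) := by
  obtain ⟨h1, h2⟩ := h
  refine ⟨{ trichotomous := ?_, irrefl := ?_, trans := ?_ }, ?_⟩
  · intro x y hxy hyx
    exact g⁻¹.injective (h1.trichotomous _ _ hxy hyx)
  · exact fun x => h1.irrefl _
  · exact fun x y z => h1.trans _ _ _
  · rintro _ ⟨F, hF, rfl⟩ x hx y hy z hxz hzy
    rw [mem_image_perm] at hx hy ⊢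
    exact h2 F hF _ hx _ hy _ hxz hzy

theorem imageFam_almost {g : Equiv.Perm Ends} (hg : IsSpheromorphism g) {fam : Set (Set Ends)}
    (h : (symmDiff fam (Set.range ball)).Finite) :
    (symmDiff (imageFam g fam) (Set.range ball)).Finite := by
  have hinj : Function.Injective fun F : Set Ends => g '' F := g.injective.image_injective
  refine ((h.image fun F => g '' F).union hg.almost).subset ?_
  rw [Set.image_symmDiff hinj]
  exact symmDiff_triangle _ _ _

theorem isClopen_image {g : Equiv.Perm Ends} (hg : IsSpheromorphism g) {F : Set Ends}
    (hF : IsClopen F) : IsClopen (g '' F) := by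
  have : g '' F = (g⁻¹ : Equiv.Perm Ends) ⁻¹' F := by
    ext x; exact mem_image_perm g F x
  rw [this]
  exact hF.preimage hg.inv.continuous

/-- The action of `N` on the strata of the tower, by relabelling the ends. -/
instance : SMul Neretin Stratum where
  smul g s :=
    { fam := imageFam g s.fam
      orders := imageOrder g '' s.orders
      proper := by
        rintro _ ⟨F, hF, rfl⟩
        obtain ⟨h1, h2, h3⟩ := s.proper F hF
        exact ⟨isClopen_image g.2 h1, h2.image _, fun h => h3 <| by
          rw [← Set.image_univ_of_surjective (g : Equiv.Perm Ends).surjective] at h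
          exact (g : Equiv.Perm Ends).injective.image_injective h⟩
      nested := by
        rintro _ ⟨F, hF, rfl⟩ _ ⟨G, hG, rfl⟩
        simpa only [Set.image_subset_image_iff (g : Equiv.Perm Ends).injective,
          Set.disjoint_image_iff (g : Equiv.Perm Ends).injective] using s.nested F hF G hG
      cofinite := imageFam_almost g.2 s.cofinite
      planar := by
        obtain ⟨r, hr, h⟩ := s.planar
        exact ⟨imageOrder g r, isPlanarOrder_image _ hr, by rw [h, image_orders]⟩ }

instance : MulAction Neretin Stratum where
  one_smul s := Stratum.ext (imageFam_one _) (by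
    change imageOrder 1 '' s.orders = _
    rw [show imageOrder 1 = id from rfl, Set.image_id])
  mul_smul g h s := Stratum.ext (imageFam_mul _ _ _) (by
    change imageOrder (g * h : Equiv.Perm Ends) '' _ = imageOrder g '' (imageOrder h '' _)
    rw [Set.image_image]
    exact Set.image_congr fun r _ => imageOrder_mul _ _ _)

/-- The left-to-right order of the ends of the dyadic tree. -/
def lexOrder (x y : Ends) : Prop := ∃ n, (∀ i < n, x i = y i) ∧ x n = false ∧ y n = true

theorem ball_subset_or {v w : List Bool} (h : v.length ≤ w.length) :
    ball w ⊆ ball v ∨ Disjoint (ball v) (ball w) := by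
  by_cases hd : Disjoint (ball v) (ball w)
  · exact Or.inr hd
  · left
    obtain ⟨_, ⟨x, rfl⟩, ⟨y, hy⟩⟩ := Set.not_disjoint_iff.1 hd
    obtain ⟨t, rfl⟩ := exists_append hy.symm h
    rintro _ ⟨z, rfl⟩
    exact ⟨app t z, (app_append _ _ _).symm⟩

theorem isClopen_ball (w : List Bool) : IsClopen (ball w) := by
  induction w with
  | nil =>
    convert isClopen_univ
    exact Set.eq_univ_of_forall fun x => ⟨x, rfl⟩
  | cons b w ih =>
    have : ball (b :: w) = (fun x : Ends => x 0) ⁻¹' {b} ∩ tail ⁻¹' ball w := by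
      ext x
      constructor
      · rintro ⟨y, rfl⟩
        exact ⟨rfl, y, rfl⟩
      · rintro ⟨h, y, hy⟩
        exact ⟨y, by rw [app_cons, hy, ← show x 0 = b from h, cons_tail]⟩
    rw [this]
    exact ((isClopen_discrete _).preimage (continuous_apply 0)).inter
      (ih.preimage (continuous_pi fun n => continuous_apply (n + 1)))

theorem isPlanarOrder_lex : IsPlanarOrder {F | ∃ w : List Bool, w ≠ [] ∧ F = ball w} lexOrder := by
  refine ⟨{ trichotomous := ?_, irrefl := ?_, trans := ?_ }, ?_⟩
  · intro x y hxy hyx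
    by_contra hne
    have hex : ∃ n, x n ≠ y n := Function.ne_iff.1 hne
    classical
    have h1 := Nat.find_spec hex
    have h2 : ∀ i < Nat.find hex, x i = y i := fun i hi => not_not.1 (Nat.find_min hex hi)
    rcases hx : x (Nat.find hex) with _ | _
    · exact hxy ⟨_, h2, hx, by rw [hx] at h1; simpa using h1.symm⟩
    · exact hyx ⟨_, fun i hi => (h2 i hi).symm, by rw [hx] at h1; simpa using h1.symm, hx⟩
  · rintro x ⟨n, -, h, h'⟩
    simp [h] at h'
  · rintro x y z ⟨n, h1, h2, h3⟩ ⟨m, h4, h5, h6⟩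
    rcases lt_trichotomy n m with h | rfl | h
    · exact ⟨n, fun i hi => (h1 i hi).trans (h4 i (hi.trans h)), h2, (h4 n h) ▸ h3⟩
    · simp [h3] at h5
    · exact ⟨m, fun i hi => (h1 i (hi.trans h)).trans (h4 i hi), (h1 m h).trans h5, h6⟩
  · rintro _ ⟨w, -, rfl⟩
    induction w with
    | nil => exact fun _ _ _ _ z _ _ => ⟨z, rfl⟩
    | cons b w ih =>
      rintro _ ⟨x, rfl⟩ _ ⟨y, rfl⟩ z ⟨n, h1, h2, h3⟩ ⟨m, h4, h5, h6⟩
      have hz : z 0 = b := by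
        rcases n with _ | n
        · rcases m with _ | m
          · simp [h3] at h5
          · simpa using h4 0 (by omega)
        · simpa using (h1 0 (by omega)).symm
      have hn : n ≠ 0 := by
        rintro rfl
        rw [app_cons, cons_zero] at h2
        simp [hz, h2] at h3
      have hm : m ≠ 0 := by
        rintro rfl
        rw [app_cons, cons_zero] at h6
        simp [hz, h6] at h5
      obtain ⟨n, rfl⟩ := Nat.exists_eq_succ_of_ne_zero hn
      obtain ⟨m, rfl⟩ := Nat.exists_eq_succ_of_ne_zero hm
      obtain ⟨t, ht⟩ := ih _ ⟨x, rfl⟩ _ ⟨y, rfl⟩ (tail z)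
        ⟨n, fun i hi => h1 (i + 1) (by omega), h2, h3⟩
        ⟨m, fun i hi => h4 (i + 1) (by omega), h5, h6⟩
      exact ⟨t, by rw [app_cons, ht, ← hz, cons_tail]⟩

/-- The base point of the tower: the planar dyadic tree itself. -/
def baseStratum : Stratum where
  fam := {F | ∃ w : List Bool, w ≠ [] ∧ F = ball w}
  orders := {r | IsReflectionOf {F | ∃ w : List Bool, w ≠ [] ∧ F = ball w} lexOrder r}
  proper := by
    rintro _ ⟨w, hw, rfl⟩
    refine ⟨isClopen_ball w, Set.range_nonempty _, fun h => ?_⟩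
    obtain ⟨b, w, rfl⟩ := List.exists_cons_of_ne_nil hw
    have : (fun _ => !b) ∈ ball (b :: w) := h ▸ Set.mem_univ _
    obtain ⟨x, hx⟩ := this
    simpa using congrFun hx 0
  nested := by
    rintro _ ⟨v, -, rfl⟩ _ ⟨w, -, rfl⟩
    rcases le_total v.length w.length with h | h
    · rcases ball_subset_or h with h | h
      · exact Or.inr (Or.inl h)
      · exact Or.inr (Or.inr h)
    · rcases ball_subset_or h with h | h
      · exact Or.inl h
      · exact Or.inr (Or.inr h.symm)
  cofinite := by
    refine (Set.finite_singleton (ball [])).subset ?_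
    rintro F (⟨⟨w, -, rfl⟩, h⟩ | ⟨⟨w, rfl⟩, h⟩)
    · exact absurd ⟨w, rfl⟩ h
    · rw [Set.mem_singleton_iff]
      by_contra hne
      exact h ⟨w, fun hw => hne (by rw [hw]), rfl⟩
  planar := ⟨lexOrder, isPlanarOrder_lex, rfl⟩

/-! ## The universal cover and the group of lifted transformations

The fundamental groupoid of the geometric realization of a poset is the free groupoid on the poset
seen as a category. -/

/-- A stratum of the universal cover of the tower: a stratum together with a homotopy class of paths
from the base point to it. -/
@[ext]
structure Cover where
  base : Stratum
  path : FreeGroupoid.mk baseStratum ⟶ FreeGroupoid.mk base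

/-- The face relation in the universal cover: the lift of the face relation of the tower. -/
instance : PartialOrder Cover where
  le u v := ∃ h : u.base ≤ v.base, u.path ≫ FreeGroupoid.homMk (homOfLE h) = v.path
  le_refl u := ⟨le_rfl, by
    have h : FreeGroupoid.homMk (homOfLE (le_refl u.base)) = 𝟙 (FreeGroupoid.mk u.base) :=
      (FreeGroupoid.of Stratum).map_id u.base
    rw [h, Category.comp_id]⟩
  le_trans u v w := by
    rintro ⟨h, e⟩ ⟨h', e'⟩
    refine ⟨h.trans h', ?_⟩
    rw [← e', ← e, Category.assoc, ← Functor.map_comp]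
    rfl
  le_antisymm u v := by
    obtain ⟨s, p⟩ := u
    obtain ⟨t, q⟩ := v
    rintro ⟨h, e⟩ ⟨h', -⟩
    obtain rfl : s = t := le_antisymm h h'
    congr 1
    refine Eq.trans ?_ e
    change p = p ≫ FreeGroupoid.homMk (homOfLE (le_refl s))
    have h : FreeGroupoid.homMk (homOfLE (le_refl s)) = 𝟙 (FreeGroupoid.mk s) :=
      (FreeGroupoid.of Stratum).map_id s
    rw [h, Category.comp_id]

/-- The group of lifts of the transformations of the tower defined by the elements of `N`:
pairs of an element `g` of `N` and a cellular automorphism of the universal cover (an automorphism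
of its poset of strata) which covers the action of `g` on the tower. -/
def LiftGroup : Subgroup (Neretin × (Cover ≃o Cover)) where
  carrier := {p | ∀ u, (p.2 u).base = p.1 • u.base}
  one_mem' u := (one_smul _ _).symm
  mul_mem' {p q} hp hq u := by
    change (p.2 (q.2 u)).base = (p.1 * q.1) • u.base
    rw [hp, hq, mul_smul]
  inv_mem' {p} hp u := by
    change (p.2⁻¹ u).base = p.1⁻¹ • u.base
    rw [eq_inv_smul_iff, ← hp]
    simp

/-- The projection of the group of lifts to `N`.  Its kernel `proj.ker` is the group of deck
transformations of the universal cover, that is, the fundamental group of the tower: the infinite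
pure quasi-braid group. -/
def proj : LiftGroup →* Neretin := (MonoidHom.fst _ _).comp LiftGroup.subtype

/-! ## Quasi-braid groups and the stable length -/

/-- A set `T = {σ_i, …, σ_(j-1)}` of Coxeter generators of the symmetric group on `m` letters, non-empty,
proper and with connected graph, given by the interval `[lo, hi] = [i, j]` of the letters
(numbered from `0` to `m - 1`) which it permutes. -/
structure QInterval (m : ℕ) where
  lo : ℕ
  hi : ℕ
  lo_lt_hi : lo < hi
  hi_lt : hi < m
  proper : ¬ (lo = 0 ∧ hi + 1 = m)

/-- The number of letters of the interval. -/
def QInterval.size {m : ℕ} (T : QInterval m) : ℕ := T.hi + 1 - T.lo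

/-- The relations between the generators `α_T`: `α_T ^ 2 = 1`; `α_T α_T' = α_T'' α_T` if `T' ⊆ T`
and `T''` is the mirror image of `T'` in `T`; `α_T α_T' = α_T' α_T` if `T` and `T'` are disjoint
and not adjacent, i.e. if the corresponding intervals of letters are disjoint. -/
inductive QRel (m : ℕ) : FreeGroup (QInterval m) → Prop
  | sq (T : QInterval m) : QRel m (FreeGroup.of T * FreeGroup.of T)
  | conj (T T' T'' : QInterval m) (h : T.lo ≤ T'.lo) (h' : T'.hi ≤ T.hi)
      (h₁ : T''.lo + T'.hi = T.lo + T.hi) (h₂ : T''.hi + T'.lo = T.lo + T.hi) :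
      QRel m (FreeGroup.of T * FreeGroup.of T' * (FreeGroup.of T'' * FreeGroup.of T)⁻¹)
  | comm (T T' : QInterval m) (h : T.hi < T'.lo) :
      QRel m (FreeGroup.of T * FreeGroup.of T' * (FreeGroup.of T' * FreeGroup.of T)⁻¹)

/-- The quasi-braid group on `m` letters. -/
abbrev QuasiBraid (m : ℕ) : Type := PresentedGroup {x | QRel m x}

/-- The generator `α_T`. -/
def quasiGen {m : ℕ} (T : QInterval m) : QuasiBraid m := PresentedGroup.of T

/-- The length modulo `2`, the homomorphism with `α_T ↦ 1 + |T|`, where `|T|` is the number of letters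
of the interval. -/
def quasiLength (m : ℕ) : QuasiBraid m →* Multiplicative (ZMod 2) :=
  PresentedGroup.toGroup (f := fun T : QInterval m => Multiplicative.ofAdd (1 + T.size : ZMod 2)) <| by
    have two : ∀ z : Multiplicative (ZMod 2), z * z = 1 := by decide
    intro x hx
    cases hx with
    | sq T => simp [two]
    | conj T T' T'' h h' h₁ h₂ =>
      have : T''.size = T'.size := by
        have := T'.lo_lt_hi
        unfold QInterval.size; omega
      simp only [map_mul, map_inv, FreeGroup.lift_apply_of, this]
      rw [mul_comm (Multiplicative.ofAdd _), mul_inv_cancel]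
    | comm T T' h =>
      simp only [map_mul, map_inv, FreeGroup.lift_apply_of]
      rw [mul_comm (Multiplicative.ofAdd _), mul_inv_cancel]

/-- The involution `ω_T` : it inverts the order of the letters of the interval. -/
def reversal {m : ℕ} (T : QInterval m) : Equiv.Perm (Fin m) :=
  Function.Involutive.toPerm
    (fun k => if h : T.lo ≤ k ∧ k ≤ T.hi then ⟨T.lo + T.hi - k, by have := T.hi_lt; omega⟩ else k)
    (by
      intro k
      by_cases h : T.lo ≤ (k : ℕ) ∧ (k : ℕ) ≤ T.hi
      · have : T.lo ≤ T.lo + T.hi - k ∧ T.lo + T.hi - k ≤ T.hi := by omega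
        ext
        simp only [h, and_self, dite_true, this]
        omega
      · simp [h])

/-- `s` is the (maximal) cell `a_σ(1) < a_σ(2) < …` of the space of curves with `2 ^ n` inputs, labelled by
the words of length `n`: its tree has one internal vertex with `2 ^ n` leaves, each of them
replaced by the dyadic tree below its label. -/
def IsChamber {n : ℕ} (σ : Fin (2 ^ n) ≃ List.Vector Bool n) (s : Stratum) : Prop :=
  s.fam = {F | ∃ w : List Bool, n ≤ w.length ∧ F = ball w} ∧
    ∀ r ∈ s.orders, ∀ i j, i < j → ∀ x ∈ ball (σ i).1, ∀ y ∈ ball (σ j).1, r x y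

/-- The tree of `s` is that of a wall of the cell indexed by `σ`: its only internal vertex apart from
the root has as descendants the leaves at the positions belonging to `T`. -/
def IsWall {n : ℕ} (σ : Fin (2 ^ n) ≃ List.Vector Bool n) (T : QInterval (2 ^ n))
    (s : Stratum) : Prop :=
  s.fam = {F | ∃ w : List Bool, n ≤ w.length ∧ F = ball w} ∪
    {⋃ k : {k : Fin (2 ^ n) // T.lo ≤ k ∧ k ≤ T.hi}, ball (σ k).1}

/-- `Gallery u₀ σ₀ u σ a` : in the universal cover, the chamber `u` (above the chamber indexed by `σ`)
is reached from the chamber `u₀` (above the chamber indexed by `σ₀`) by the edge path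
`σ₀ → σ₀ ω_T₁ → σ₀ ω_T₁ ω_T₂ → … → σ₀ ω_T₁ … ω_Tᵣ = σ` crossing one wall at each step, and
`a = α_T₁ α_T₂ … α_Tᵣ` in the quasi-braid group. -/
inductive Gallery {n : ℕ} (u₀ : Cover) (σ₀ : Fin (2 ^ n) ≃ List.Vector Bool n) :
    Cover → (Fin (2 ^ n) ≃ List.Vector Bool n) → QuasiBraid (2 ^ n) → Prop
  | nil (h : IsChamber σ₀ u₀.base) : Gallery u₀ σ₀ u₀ σ₀ 1
  | step {u u' w : Cover} {σ : Fin (2 ^ n) ≃ List.Vector Bool n} {a : QuasiBraid (2 ^ n)}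
      (T : QInterval (2 ^ n)) (hg : Gallery u₀ σ₀ u σ a) (hw : IsWall σ T w.base)
      (hu : w ≤ u) (hu' : w ≤ u') (h : IsChamber ((reversal T).trans σ) u'.base) :
      Gallery u₀ σ₀ u' ((reversal T).trans σ) (a * quasiGen T)

/-- `ℓ` is the stable length on the fundamental group of the tower: on the deck transformation which is
given by the edge loop of a pure quasi-braid `a` on `2 ^ n` letters, its value is the length
of `a`. -/
def IsStableLength (ℓ : proj.ker →* Multiplicative (ZMod 2)) : Prop :=
  ∀ (n : ℕ) (u u' : Cover) (σ σ' : Fin (2 ^ n) ≃ List.Vector Bool n) (a : QuasiBraid (2 ^ n)),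
    Gallery u σ u' σ' a → ∀ p : proj.ker, p.1.1.2 u = u' → ℓ p = quasiLength (2 ^ n) a

/-- The kernel of `ℓ`, as a subgroup of the group of lifts. -/
def lengthKernel (ℓ : proj.ker →* Multiplicative (ZMod 2)) : Subgroup LiftGroup :=
  ℓ.ker.map proj.ker.subtype

/-- `S` is the central extension `1 → ℤ/2 → (group of lifts)/Ker ℓ → N → 1` induced by the extension
`1 → π₁(tower) → (group of lifts) → N → 1`, where `π₁(tower)/Ker ℓ` is identified with `ℤ/2` by `ℓ`. -/
def IsEulerExtension (ℓ : proj.ker →* Multiplicative (ZMod 2)) [(lengthKernel ℓ).Normal]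
    (S : GroupExtension (Multiplicative (ZMod 2)) (LiftGroup ⧸ lengthKernel ℓ) Neretin) : Prop :=
  (∀ p : proj.ker, S.inl (ℓ p) = QuotientGroup.mk p.1) ∧
    ∀ f : LiftGroup, S.rightHom (QuotientGroup.mk f) = proj f

/-- The class in `H₂(N)` of the 2-cycle attached to the relation `[τ₁, σ][α, δ] = 1`. -/
noncomputable def omegaClass : groupHomology.H2 (Rep.trivial ℤ Neretin ℤ) :=
  groupHomology.H2π _ (relationCycle tauOne sigma alpha delta relation)

end Spheromorphism

open Spheromorphism

/-! Two planar orders of one stratum differ by inversions at vertices other than the root. List a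
finite set of ends by one of them and count, modulo 2, the neighbouring pairs inverted by the other.
The vertices at which neighbours branch form a multiset which, at least modulo 2, depends only on
the finite set and not on the planar order (`gapSum_eq`). Hence these counts add up along a chain of
orders (`des_add`).

Every stratum has a normal order, in which left sons precede right sons wherever a ball and both its
sons are vertices. Choosing one for each stratum and sampling one end in each ball of depth `n`,
with `n` going to infinity along an ultrafilter, gives a 1-cocycle on the poset of strata
(`cocycle`). Between the two chambers on the sides of the wall of an interval `T` it takes the value
|T| - 1 (`des_reversal`, `cocycle_wall`), so its integral along paths (`potential`) computes the
length of edge loops. This proves existence of the stable length. For uniqueness, every deck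
transformation comes from an edge loop of chambers (`exists_gallery_of_ker`), because chambers above
a common stratum are joined by reflections at its finitely many vertices that are not deep balls
(`exists_gallery_above`).

The cocycle is invariant under `N` up to the coboundary of `defect` (`cocycle_smul`). A lift `f`
therefore changes the potential by the defect plus a constant `liftShift f` (`potential_lift`). On
deck transformations this constant is the stable length. It is additive as soon as one factor is a
deck transformation, hence invariant under conjugation, which gives normality of the kernel and
centrality of the extension. Lifts of all elements of `N` exist because the tower is connected
(`exists_cover`, `proj_surjective`).

In general `liftShift` fails to be additive on a product of lifts of `g` and `g'` by the difference
of one count taken over the sample and over its image under `g'` (`eventually_liftShift_mul`). This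
vanishes if `g'` permutes the balls of every large depth, as τ₁, σ and α do, so only δ can
contribute. The relation says that [τ₁, σ]α = β with β = δαδ⁻¹, and β exchanges the sons of all
vertices 0ᵏ with k ≥ 1. The sample of depth `n` branches at n - 1 of these vertices and its image
under δ at n - 2, because δ shortens the leftmost branch by one. The difference is 1 (`des_delta`),
so the lifted relation is a deck transformation of stable length 1 (`liftShift_relation`). The
pairing of the extension class with the cycle of the relation is exactly this obstruction
(`evalChain_factorSet_relationCycle`). -/

namespace Spheromorphism

/-! ## Balls and initial segments -/

/-- The initial segment of length `n` of an end. -/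
def pre (n : ℕ) (x : Ends) : List Bool := (List.range n).map x

@[simp] theorem length_pre (n : ℕ) (x : Ends) : (pre n x).length = n := by simp [pre]

theorem pre_eq_iff {n : ℕ} {x y : Ends} : pre n x = pre n y ↔ ∀ i < n, x i = y i := by
  simp [pre]

theorem pre_succ (n : ℕ) (x : Ends) : pre (n + 1) x = pre n x ++ [x n] := by
  simp [pre, List.range_succ]

theorem pre_succ' (n : ℕ) (x : Ends) : pre (n + 1) x = x 0 :: pre n (tail x) := by
  simp only [pre, List.range_succ_eq_map, List.map_cons, List.map_map]; rfl

theorem pre_app (w : List Bool) (x : Ends) : pre w.length (app w x) = w := by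
  induction w with
  | nil => rfl
  | cons b w ih => rw [List.length_cons, pre_succ']; simp [ih]

theorem mem_ball_iff {w : List Bool} {x : Ends} : x ∈ ball w ↔ pre w.length x = w := by
  constructor
  · rintro ⟨y, rfl⟩; exact pre_app w y
  · intro h
    obtain ⟨v, y, hv, rfl⟩ := exists_app w.length x
    rw [← hv, pre_app] at h
    exact ⟨y, by rw [h]⟩

theorem mem_ball_pre (n : ℕ) (x : Ends) : x ∈ ball (pre n x) := by
  simp [mem_ball_iff]

theorem mem_ball_pre_iff {n : ℕ} {x y : Ends} : x ∈ ball (pre n y) ↔ ∀ i < n, x i = y i := by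
  rw [mem_ball_iff, length_pre, pre_eq_iff]

theorem agree_of_mem_ball {w : List Bool} {x y : Ends} (hx : x ∈ ball w) (hy : y ∈ ball w) :
    ∀ i < w.length, x i = y i := by
  rw [mem_ball_iff] at hx hy
  rw [← pre_eq_iff, hx, hy]

theorem ball_nonempty (w : List Bool) : (ball w).Nonempty := Set.range_nonempty _

theorem ball_append_subset (v w : List Bool) : ball (v ++ w) ⊆ ball v := by
  rintro _ ⟨x, rfl⟩; exact ⟨app w x, (app_append v w x).symm⟩

theorem ball_snoc_union (w : List Bool) : ball (w ++ [false]) ∪ ball (w ++ [true]) = ball w := by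
  apply Set.Subset.antisymm
  · exact Set.union_subset (ball_append_subset _ _) (ball_append_subset _ _)
  · rintro _ ⟨x, rfl⟩
    rcases h : x 0 with _ | _
    · exact Or.inl ⟨tail x, by rw [app_append]; simp [← h]⟩
    · exact Or.inr ⟨tail x, by rw [app_append]; simp [← h]⟩

theorem ball_snoc_disjoint (w : List Bool) :
    Disjoint (ball (w ++ [false])) (ball (w ++ [true])) := by
  rw [Set.disjoint_left]
  intro x h h'
  rw [mem_ball_iff] at h h'
  simp only [List.length_append, List.length_singleton] at h h'
  simpa using h.symm.trans h'

/-- The subset `w ++ [b]` splitting of two distinct points in a ball. -/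
theorem exists_split {x y : Ends} (h : x ≠ y) : ∃ n, pre n x = pre n y ∧ x n ≠ y n := by
  classical
  have hex : ∃ n, x n ≠ y n := Function.ne_iff.1 h
  exact ⟨Nat.find hex, pre_eq_iff.2 fun i hi => not_not.1 (Nat.find_min hex hi), Nat.find_spec hex⟩

theorem mem_snoc_pre (n : ℕ) (x : Ends) : x ∈ ball (pre n x ++ [x n]) := by
  rw [← pre_succ]; exact mem_ball_pre _ _

theorem ball_subset_length {v w : List Bool} (h : ball v ⊆ ball w) : w.length ≤ v.length := by
  by_contra hlt
  rw [not_le] at hlt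
  -- The two ends of `ball v` with constant tails differ at the position `v.length`, so they cannot
  -- share a longer initial segment.
  have key : ∀ b : Bool, pre w.length (app v fun _ => b) = w := fun b =>
    mem_ball_iff.1 (h ⟨_, rfl⟩)
  have h0 := (pre_eq_iff.1 ((key false).trans (key true).symm)) v.length hlt
  have h1 : ∀ b : Bool, app v (fun _ => b) v.length = b := by
    intro b
    clear key h h0 hlt
    induction v with
    | nil => rfl
    | cons c v ih => simpa using ih
  rw [h1, h1] at h0
  exact Bool.noConfusion h0

theorem ball_injective : Function.Injective ball := by
  intro v w h
  have h1 := ball_subset_length h.le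
  have h2 := ball_subset_length h.ge
  obtain ⟨x, hx⟩ := ball_nonempty v
  have hx' : x ∈ ball w := h ▸ hx
  rw [mem_ball_iff] at hx hx'
  rw [← hx, ← hx', le_antisymm h1 h2]

/-- The balls of depth at least `n`. -/
def deep (n : ℕ) : Set (Set Ends) := {F | ∃ w : List Bool, n ≤ w.length ∧ F = ball w}

theorem deep_mono {m n : ℕ} (h : m ≤ n) : deep n ⊆ deep m := by
  rintro _ ⟨w, hw, rfl⟩; exact ⟨w, h.trans hw, rfl⟩

theorem ball_mem_deep {n : ℕ} {w : List Bool} (h : n ≤ w.length) : ball w ∈ deep n := ⟨w, h, rfl⟩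

/-- Only finitely many balls fail to be vertices. All arguments about large depth start from the
depth found here. -/
theorem Stratum.exists_deep (s : Stratum) : ∃ n, deep n ⊆ s.fam := by
  have hf : {w : List Bool | ball w ∉ s.fam}.Finite :=
    Set.Finite.of_finite_image (f := ball) (s.cofinite.subset (by
      rintro _ ⟨w, hw, rfl⟩
      exact Or.inr ⟨⟨w, rfl⟩, hw⟩)) ball_injective.injOn
  obtain ⟨m, hm⟩ := (hf.image List.length).bddAbove
  refine ⟨m + 1, ?_⟩
  rintro _ ⟨w, hw, rfl⟩
  by_contra h
  have := hm ⟨w, h, rfl⟩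
  omega

/-! ## Twists of planar orders -/

/-- The vertices which lie above both `x` and `y`. -/
def common (fam : Set (Set Ends)) (x y : Ends) : Set (Set Ends) := {F | F ∈ fam ∧ x ∈ F ∧ y ∈ F}

theorem common_comm (fam : Set (Set Ends)) (x y : Ends) : common fam x y = common fam y x := by
  ext F; simp only [common, Set.mem_ofPred_eq]; tauto

theorem common_inter {fam fam' : Set (Set Ends)} (h : fam' ⊆ fam) (x y : Ends) :
    common fam' x y = common fam x y ∩ fam' := by
  ext F; simp only [common, Set.mem_ofPred_eq, Set.mem_inter_iff]
  constructor
  · exact fun hF => ⟨⟨h hF.1, hF.2⟩, hF.1⟩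
  · exact fun hF => ⟨hF.2, hF.1.2⟩

/-- The sets of the family are pairwise nested or disjoint. -/
def Nested (fam : Set (Set Ends)) : Prop :=
  ∀ F ∈ fam, ∀ G ∈ fam, F ⊆ G ∨ G ⊆ F ∨ Disjoint F G

theorem Nested.chain {fam : Set (Set Ends)} (h : Nested fam) {F G : Set Ends} (hF : F ∈ fam)
    (hG : G ∈ fam) {x : Ends} (hx : x ∈ F) (hx' : x ∈ G) : F ⊆ G ∨ G ⊆ F := by
  rcases h F hF G hG with h | h | h
  · exact Or.inl h
  · exact Or.inr h
  · exact absurd hx' (Set.disjoint_left.1 h hx)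

/-- If a vertex separates `z` from `x` and `y`, then `x` and `y` branch off `z` at the same place. -/
theorem common_eq_of_not_mem {fam : Set (Set Ends)} (h : Nested fam) {F : Set Ends} (hF : F ∈ fam)
    {x y z : Ends} (hx : x ∈ F) (hy : y ∈ F) (hz : z ∉ F) : common fam x z = common fam y z := by
  ext G
  constructor
  · rintro ⟨hG, h1, h2⟩
    rcases h.chain hF hG hx h1 with h' | h'
    · exact ⟨hG, h' hy, h2⟩
    · exact absurd (h' h2) hz
  · rintro ⟨hG, h1, h2⟩
    rcases h.chain hF hG hy h1 with h' | h'
    · exact ⟨hG, h' hx, h2⟩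
    · exact absurd (h' h2) hz

/-- `r'` is obtained from `r` by inverting the pairs of ends `x`, `y` for which the set of vertices above
both of them satisfies `e`. -/
def TwistBy (fam : Set (Set Ends)) (e : Set (Set Ends) → Prop) (r r' : Ends → Ends → Prop) : Prop :=
  ∀ x y, r' x y ↔ (e (common fam x y) ∧ r y x) ∨ (¬ e (common fam x y) ∧ r x y)

theorem TwistBy.symm {fam : Set (Set Ends)} {e : Set (Set Ends) → Prop} {r r' : Ends → Ends → Prop}
    (h : TwistBy fam e r r') : TwistBy fam e r' r := by
  intro x y
  have h1 := h x y
  have h2 := h y x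
  rw [common_comm fam y x] at h2
  tauto

theorem TwistBy.trans {fam : Set (Set Ends)} {e e' : Set (Set Ends) → Prop}
    {r r' r'' : Ends → Ends → Prop} (h : TwistBy fam e r r') (h' : TwistBy fam e' r' r'') :
    TwistBy fam (fun A => ¬ (e A ↔ e' A)) r r'' := by
  intro x y
  have h1 := h x y
  have h2 := h y x
  rw [common_comm fam y x] at h2
  have h3 := h' x y
  by_cases c1 : e (common fam x y) <;> by_cases c2 : e' (common fam x y) <;> simp_all

/-- Contracting edges forgets part of the set of vertices above a pair, so a condition for the
contracted tree is also one for the finer tree. -/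
theorem TwistBy.mono {fam fam' : Set (Set Ends)} (hf : fam' ⊆ fam) {e : Set (Set Ends) → Prop}
    {r r' : Ends → Ends → Prop} (h : TwistBy fam' e r r') :
    TwistBy fam (fun A => e (A ∩ fam')) r r' := by
  intro x y
  have := h x y
  rwa [common_inter hf] at this

/-- A condition on the set of vertices above a pair replaces the set of reflected vertices: it
composes and refines without any appeal to a smallest common vertex. The clause `¬ e ∅` says that
pairs branching at the root are never inverted. -/
theorem IsReflectionOf.twistBy {fam : Set (Set Ends)} {r r' : Ends → Ends → Prop}
    (h : IsReflectionOf fam r r') : ∃ e, ¬ e ∅ ∧ TwistBy fam e r r' := by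
  obtain ⟨V, hV, h⟩ := h
  refine ⟨fun A => ∃ F ∈ V, F ∈ A ∧ ∀ G ∈ A, F ⊆ G, by simp, fun x y => ?_⟩
  have : (∃ F ∈ V, IsMeet fam x y F) ↔
      (∃ F ∈ V, F ∈ common fam x y ∧ ∀ G ∈ common fam x y, F ⊆ G) := by
    refine exists_congr fun F => and_congr_right fun _ => ?_
    simp only [IsMeet, common, Set.mem_ofPred_eq, and_imp]
    tauto
  rw [h, this]

theorem IsPlanarOrder.not_symm {fam : Set (Set Ends)} {r : Ends → Ends → Prop}
    (h : IsPlanarOrder fam r) {x y : Ends} (hxy : r x y) : ¬ r y x := fun hyx =>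
  h.1.irrefl x (h.1.trans _ _ _ hxy hyx)

theorem IsPlanarOrder.not_iff {fam : Set (Set Ends)} {r : Ends → Ends → Prop}
    (h : IsPlanarOrder fam r) {x y : Ends} (hxy : x ≠ y) : ¬ r x y ↔ r y x :=
  ⟨fun h' => by_contra fun h'' => hxy (h.1.trichotomous _ _ h' h''), fun h' => h.not_symm h'⟩

theorem IsPlanarOrder.ne {fam : Set (Set Ends)} {r : Ends → Ends → Prop}
    (h : IsPlanarOrder fam r) {x y : Ends} (hxy : r x y) : x ≠ y := by
  rintro rfl; exact h.1.irrefl _ hxy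

/-- All the points of a vertex are on the same side of a point outside it. -/
theorem IsPlanarOrder.side {fam : Set (Set Ends)} {r : Ends → Ends → Prop}
    (h : IsPlanarOrder fam r) {F : Set Ends} (hF : F ∈ fam) {x y z : Ends} (hx : x ∈ F)
    (hy : y ∈ F) (hz : z ∉ F) (hr : r x z) : r y z := by
  by_contra hn
  rw [h.not_iff (by rintro rfl; exact hz hy)] at hn
  exact hz (h.2 F hF x hx y hy z hr hn)

theorem IsPlanarOrder.side' {fam : Set (Set Ends)} {r : Ends → Ends → Prop}
    (h : IsPlanarOrder fam r) {F : Set Ends} (hF : F ∈ fam) {x y z : Ends} (hx : x ∈ F)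
    (hy : y ∈ F) (hz : z ∉ F) (hr : r z x) : r z y := by
  by_contra hn
  rw [h.not_iff (by rintro rfl; exact hz hy)] at hn
  exact hz (h.2 F hF y hy x hx z hn hr)

/-- Between three points, in some order, the outer two branch where one of the neighbouring pairs
does. -/
theorem IsPlanarOrder.common_or {fam : Set (Set Ends)} {r : Ends → Ends → Prop} (hn : Nested fam)
    (h : IsPlanarOrder fam r) {x y z : Ends} (hxy : r x y) (hyz : r y z) :
    (common fam x z = common fam x y ∧ common fam x y ⊆ common fam y z) ∨
      (common fam x z = common fam y z ∧ common fam y z ⊆ common fam x y) := by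
  -- Convexity puts the middle end into every vertex above the outer two.
  have hmid : ∀ F, F ∈ common fam x z → y ∈ F := fun F hF => h.2 F hF.1 x hF.2.1 z hF.2.2 y hxy hyz
  by_cases hs : common fam x y ⊆ common fam y z
  · refine Or.inl ⟨Set.Subset.antisymm (fun F hF => ⟨hF.1, hF.2.1, hmid F hF⟩) fun F hF => ?_, hs⟩
    exact ⟨hF.1, hF.2.1, (hs hF).2.2⟩
  · obtain ⟨F, hF, hF'⟩ := Set.not_subset.1 hs
    have hz : z ∉ F := fun hz => hF' ⟨hF.1, hF.2.2, hz⟩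
    have key : common fam x z = common fam y z := common_eq_of_not_mem hn hF.1 hF.2.1 hF.2.2 hz
    refine Or.inr ⟨key, fun G hG => ?_⟩
    rw [← key] at hG
    exact ⟨hG.1, hG.2.1, hmid G hG⟩

/-- The delicate point is transitivity. By `common_or` the outer pair of three ends has the same
branch set as one of the neighbouring pairs, so the two are inverted together and no cycle arises.
Convexity survives because all ends of a vertex branch off an outside end at the same place. -/
theorem IsPlanarOrder.twist {fam : Set (Set Ends)} {e : Set (Set Ends) → Prop}
    {r r' : Ends → Ends → Prop} (hn : Nested fam) (h : IsPlanarOrder fam r)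
    (ht : TwistBy fam e r r') : IsPlanarOrder fam r' := by
  refine ⟨{ trichotomous := ?_, irrefl := ?_, trans := ?_ }, ?_⟩
  · intro x y hxy hyx
    by_contra hne
    have h1 := h.not_iff hne
    have h2 := ht x y
    have h3 := ht y x
    rw [common_comm fam y x] at h3
    tauto
  · intro x hx
    have h1 := h.1.irrefl x
    have := ht x x
    tauto
  · intro x y z hxy hyz
    have hxz : x ≠ z := by
      rintro rfl
      have h2 := ht x y
      have h3 := ht y x
      rw [common_comm fam y x] at h3
      have h4 := @IsPlanarOrder.not_symm fam r h x y
      tauto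
    have hxy' := (ht x y).1 hxy
    have hyz' := (ht y z).1 hyz
    have nxz := h.not_iff hxz
    rw [ht x z]
    have tr := h.1.trans
    have c1 := common_comm fam x y
    have c2 := common_comm fam y z
    have c3 := common_comm fam x z
    have key := @IsPlanarOrder.common_or fam r hn h
    rcases hxy' with ⟨e1, h1⟩ | ⟨e1, h1⟩ <;> rcases hyz' with ⟨e2, h2⟩ | ⟨e2, h2⟩
    · rcases key h2 h1 with ⟨k, -⟩ | ⟨k, -⟩
      · exact Or.inl ⟨by rwa [c3, k, ← c2], tr _ _ _ h2 h1⟩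
      · exact Or.inl ⟨by rwa [c3, k, ← c1], tr _ _ _ h2 h1⟩
    · by_cases hr : r x z
      · rcases key h1 hr with ⟨k, -⟩ | ⟨k, -⟩
        · exact absurd (k ▸ c1 ▸ e1) e2
        · exact Or.inr ⟨by rwa [← k], hr⟩
      · rw [nxz] at hr
        rcases key h2 hr with ⟨k, -⟩ | ⟨k, -⟩
        · exact absurd (k ▸ c1 ▸ e1) e2
        · exact Or.inl ⟨by rwa [c3, ← k, ← c1], hr⟩
    · by_cases hr : r x z
      · rcases key hr h2 with ⟨k, -⟩ | ⟨k, -⟩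
        · exact Or.inr ⟨by rwa [← k], hr⟩
        · exact absurd (k ▸ c2 ▸ e2) e1
      · rw [nxz] at hr
        rcases key hr h1 with ⟨k, -⟩ | ⟨k, -⟩
        · exact Or.inl ⟨by rwa [c3, ← k, ← c2], hr⟩
        · exact absurd (k ▸ c2 ▸ e2) e1
    · rcases key h1 h2 with ⟨k, -⟩ | ⟨k, -⟩
      · exact Or.inr ⟨by rwa [k], tr _ _ _ h1 h2⟩
      · exact Or.inr ⟨by rwa [k], tr _ _ _ h1 h2⟩
  · intro F hF x hx y hy z hxz hzy
    by_contra hz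
    have k := common_eq_of_not_mem hn hF hx hy hz
    have h1 := (ht x z).1 hxz
    have h2 := (ht z y).1 hzy
    rw [common_comm fam z y, ← k] at h2
    rcases h1 with ⟨e1, h1⟩ | ⟨e1, h1⟩ <;> rcases h2 with ⟨e2, h2⟩ | ⟨e2, h2⟩
    · exact hz (h.2 F hF y hy x hx z h2 h1)
    · exact e2 e1
    · exact e1 e2
    · exact hz (h.2 F hF x hx y hy z h1 h2)

/-! ## The orders of a stratum -/

/-- Balls containing both ends have bounded depth, and only finitely many vertices are not balls.
The vertices above a pair thus form a finite chain, which has a smallest member. -/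
theorem Stratum.finite_common (s : Stratum) {x y : Ends} (h : x ≠ y) :
    (common s.fam x y).Finite := by
  obtain ⟨n, hn⟩ := Function.ne_iff.1 h
  refine (s.cofinite.union ((finite_words (n + 1)).image ball)).subset ?_
  rintro F ⟨hF, hx, hy⟩
  by_cases hb : F ∈ Set.range ball
  · obtain ⟨w, rfl⟩ := hb
    refine Or.inr ⟨w, ?_, rfl⟩
    by_contra hw
    exact hn (agree_of_mem_ball hx hy n (by simpa using hw))
  · exact Or.inl (Or.inl ⟨hF, hb⟩)

theorem Stratum.exists_meet (s : Stratum) {x y : Ends} (h : x ≠ y)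
    (hne : (common s.fam x y).Nonempty) :
    ∃ F, F ∈ common s.fam x y ∧ ∀ G ∈ common s.fam x y, F ⊆ G := by
  obtain ⟨F, hF⟩ := (s.finite_common h).exists_minimal hne
  refine ⟨F, hF.1, fun G hG => ?_⟩
  rcases Nested.chain s.nested hF.1.1 hG.1 hF.1.2.1 hG.2.1 with h' | h'
  · exact h'
  · exact hF.2 hG h'

theorem common_eq_of_meet {fam : Set (Set Ends)} {x y : Ends} {F : Set Ends}
    (h : F ∈ common fam x y) (h' : ∀ G ∈ common fam x y, F ⊆ G) :
    common fam x y = {G | G ∈ fam ∧ F ⊆ G} := by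
  ext G
  exact ⟨fun hG => ⟨hG.1, h' G hG⟩, fun hG => ⟨hG.1, hG.2 h.2.1, hG.2 h.2.2⟩⟩

/-- The converse of `IsReflectionOf.twistBy`: the reflected vertices are those for which the chain
of vertices containing them satisfies `e`. -/
theorem Stratum.isReflectionOf (s : Stratum) {r r' : Ends → Ends → Prop}
    {e : Set (Set Ends) → Prop} (hr : ∀ x, ¬ r x x) (he : ¬ e ∅) (h : TwistBy s.fam e r r') :
    IsReflectionOf s.fam r r' := by
  refine ⟨{F | F ∈ s.fam ∧ e {G | G ∈ s.fam ∧ F ⊆ G}}, fun F hF => hF.1, fun x y => ?_⟩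
  by_cases hxy : x = y
  · subst hxy
    have := h x x
    have := hr x
    tauto
  have : (∃ F ∈ {F | F ∈ s.fam ∧ e {G | G ∈ s.fam ∧ F ⊆ G}}, IsMeet s.fam x y F) ↔
      e (common s.fam x y) := by
    constructor
    · rintro ⟨F, ⟨hF, hF'⟩, h1, h2, h3, h4⟩
      rwa [common_eq_of_meet (F := F) ⟨h1, h2, h3⟩ fun G hG => h4 G hG.1 hG.2.1 hG.2.2]
    · intro hc
      have hne : (common s.fam x y).Nonempty := by
        rw [Set.nonempty_iff_ne_empty]; intro h0; rw [h0] at hc; exact he hc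
      obtain ⟨F, hF, hF'⟩ := s.exists_meet hxy hne
      refine ⟨F, ⟨hF.1, ?_⟩, hF.1, hF.2.1, hF.2.2, fun G h1 h2 h3 => hF' G ⟨h1, h2, h3⟩⟩
      rwa [← common_eq_of_meet hF hF']
  rw [this]
  exact h x y

theorem Stratum.isPlanarOrder (s : Stratum) {r : Ends → Ends → Prop} (h : r ∈ s.orders) :
    IsPlanarOrder s.fam r := by
  obtain ⟨r₀, h₀, ho⟩ := s.planar
  rw [ho] at h
  obtain ⟨e, -, he⟩ := IsReflectionOf.twistBy h
  exact h₀.twist s.nested he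

/-- Twists can be inverted and composed, so any order of the stratum may serve as the reference
order in place of the one given by `planar`. -/
theorem Stratum.mem_orders (s : Stratum) {r r' : Ends → Ends → Prop} (h : r ∈ s.orders) :
    r' ∈ s.orders ↔ ∃ e, ¬ e ∅ ∧ TwistBy s.fam e r r' := by
  obtain ⟨r₀, h₀, ho⟩ := s.planar
  rw [ho] at h ⊢
  obtain ⟨e, e0, he⟩ := IsReflectionOf.twistBy h
  constructor
  · intro h'
    obtain ⟨e', e0', he'⟩ := IsReflectionOf.twistBy h'
    exact ⟨_, by tauto, he.symm.trans he'⟩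
  · rintro ⟨e', e0', he'⟩
    exact s.isReflectionOf (fun x => h₀.1.irrefl x) (by tauto) (he.trans he')

theorem Stratum.orders_nonempty (s : Stratum) : s.orders.Nonempty := by
  obtain ⟨r₀, h₀, ho⟩ := s.planar
  rw [ho]
  refine ⟨r₀, s.isReflectionOf (e := fun _ => False) (fun x => h₀.1.irrefl x) id fun x y => ?_⟩
  simp

/-- The stratum with a given family and a given planar order. -/
def Stratum.ofOrder (fam : Set (Set Ends)) (r : Ends → Ends → Prop)
    (proper : ∀ F ∈ fam, IsClopen F ∧ F.Nonempty ∧ F ≠ Set.univ) (nested : Nested fam)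
    (cofinite : (symmDiff fam (Set.range ball)).Finite) (hr : IsPlanarOrder fam r) : Stratum where
  fam := fam
  orders := {r' | IsReflectionOf fam r r'}
  proper := proper
  nested := nested
  cofinite := cofinite
  planar := ⟨r, hr, rfl⟩

theorem Stratum.mem_orders_ofOrder {fam : Set (Set Ends)} {r : Ends → Ends → Prop}
    (proper : ∀ F ∈ fam, IsClopen F ∧ F.Nonempty ∧ F ≠ Set.univ) (nested : Nested fam)
    (cofinite : (symmDiff fam (Set.range ball)).Finite) (hr : IsPlanarOrder fam r) :
    r ∈ (Stratum.ofOrder fam r proper nested cofinite hr).orders :=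
  (Stratum.ofOrder fam r proper nested cofinite hr).isReflectionOf (e := fun _ => False)
    (fun x => hr.1.irrefl x) id fun x y => by simp

/-- A stratum lies in the closure of another one if its tree is finer and they share an order. -/
theorem Stratum.le_of_mem {s t : Stratum} (h : t.fam ⊆ s.fam) {r : Ends → Ends → Prop}
    (hs : r ∈ s.orders) (ht : r ∈ t.orders) : s ≤ t := by
  refine ⟨h, fun r' hr' => ?_⟩
  obtain ⟨e, e0, he⟩ := (t.mem_orders ht).1 hr'
  exact (s.mem_orders hs).2 ⟨_, by simpa using e0, he.mono h⟩

/-- Two strata with the same tree and a common order are equal. -/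
theorem Stratum.eq_of_mem {s t : Stratum} (h : s.fam = t.fam) {r : Ends → Ends → Prop}
    (hs : r ∈ s.orders) (ht : r ∈ t.orders) : s = t :=
  le_antisymm (Stratum.le_of_mem h.ge hs ht) (Stratum.le_of_mem h.le ht hs)

/-! ## Descents -/

section Descents

open scoped Classical

/-- The sum of `e` over the pairs of neighbours in a list. -/
def gapSum {ι : Type} (e : ι → ι → ZMod 2) : List ι → ZMod 2
  | [] => 0
  | [_] => 0
  | a :: b :: l => e a b + gapSum e (b :: l)

@[simp] theorem gapSum_nil {ι : Type} (e : ι → ι → ZMod 2) : gapSum e [] = 0 := rfl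
@[simp] theorem gapSum_singleton {ι : Type} (e : ι → ι → ZMod 2) (a : ι) : gapSum e [a] = 0 := rfl
@[simp] theorem gapSum_cons_cons {ι : Type} (e : ι → ι → ZMod 2) (a b : ι) (l : List ι) :
    gapSum e (a :: b :: l) = e a b + gapSum e (b :: l) := rfl

theorem gapSum_append {ι : Type} (e : ι → ι → ZMod 2) (l m : List ι) (a : ι) :
    gapSum e (l ++ a :: m) = gapSum e (l ++ [a]) + gapSum e (a :: m) := by
  induction l with
  | nil => simp
  | cons b l ih =>
    cases l with
    | nil => simp
    | cons c l =>
      simp only [List.cons_append, gapSum_cons_cons] at ih ⊢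
      rw [ih, add_assoc]

theorem gapSum_congr {ι : Type} {e e' : ι → ι → ZMod 2} {r : ι → ι → Prop} {l : List ι}
    (hl : l.Pairwise r) (h : ∀ x ∈ l, ∀ y ∈ l, r x y → e x y = e' x y) :
    gapSum e l = gapSum e' l := by
  induction l with
  | nil => rfl
  | cons a l ih =>
    cases l with
    | nil => rfl
    | cons b l =>
      rw [gapSum_cons_cons, gapSum_cons_cons, ih hl.of_cons
        fun x hx y hy => h x (List.mem_cons_of_mem _ hx) y (List.mem_cons_of_mem _ hy),
        h a (by simp) b (by simp) (List.rel_of_pairwise_cons hl (by simp))]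

theorem gapSum_add {ι : Type} (e e' : ι → ι → ZMod 2) (l : List ι) :
    gapSum (fun x y => e x y + e' x y) l = gapSum e l + gapSum e' l := by
  induction l with
  | nil => simp
  | cons a l ih =>
    cases l with
    | nil => simp
    | cons b l => simp only [gapSum_cons_cons, ih]; ring

theorem gapSum_map {ι κ : Type} (e : κ → κ → ZMod 2) (f : ι → κ) (l : List ι) :
    gapSum e (l.map f) = gapSum (fun x y => e (f x) (f y)) l := by
  induction l with
  | nil => simp
  | cons a l ih =>
    cases l with
    | nil => simp
    | cons b l => simpa using ih

/-- `y` is a point of `P` which branches off `x` as late as possible. -/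
def IsNearest (fam : Set (Set Ends)) (x : Ends) (P : Set Ends) (y : Ends) : Prop :=
  y ∈ P ∧ ∀ z ∈ P, common fam x z ⊆ common fam x y

theorem Nested.exists_nearest {fam : Set (Set Ends)} (hn : Nested fam) (x : Ends) (P : Finset Ends)
    (hP : P.Nonempty) : ∃ y, IsNearest fam x P y := by
  obtain ⟨y, hy, hm⟩ := P.exists_maximalFor (common fam x) hP
  refine ⟨y, hy, fun z hz => ?_⟩
  by_contra hs
  obtain ⟨F, hF, hF'⟩ := Set.not_subset.1 hs
  obtain ⟨G, hG, hG'⟩ := Set.not_subset.1 fun h => hs (hm hz h)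
  rcases hn.chain hF.1 hG.1 hF.2.1 hG.2.1 with h | h
  · exact hG' ⟨hG.1, hG.2.1, h hF.2.2⟩
  · exact hF' ⟨hF.1, hF.2.1, h hG.2.2⟩

/-- When `x` falls between `a` and `b`, the old gap `(a, b)` has the branch set of one of the new
gaps `(a, x)` and `(x, b)`, by `common_or`. The other new gap is the latest branching of `x` with
the list, hence that with `y`. The added term therefore does not depend on the order. -/
theorem gapSum_insert {fam : Set (Set Ends)} (hn : Nested fam) {r : Ends → Ends → Prop}
    (hr : IsPlanarOrder fam r) (φ : Set (Set Ends) → ZMod 2) {l m : List Ends} {x y : Ends}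
    (hl : (l ++ x :: m).Pairwise r) (hy : IsNearest fam x {z | z ∈ l ++ m} y) :
    gapSum (fun a b => φ (common fam a b)) (l ++ x :: m) =
      gapSum (fun a b => φ (common fam a b)) (l ++ m) + φ (common fam x y) := by
  have hy1 : y ∈ l ∨ y ∈ m := by simpa using hy.1
  rw [List.pairwise_append, List.pairwise_cons] at hl
  obtain ⟨hll, ⟨hxm, hmm⟩, hlm⟩ := hl
  -- If a nearest end lies to the right of `x`, then by convexity the right neighbour of `x` is
  -- nearest as well; `left` is the mirror image.
  have right : ∀ b m', m = b :: m' → y ∈ m → common fam x b = common fam x y := by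
    rintro b m' rfl hym
    refine Set.Subset.antisymm (hy.2 b (by simp)) fun F hF => ⟨hF.1, hF.2.1, ?_⟩
    rcases List.mem_cons.1 hym with rfl | h
    · exact hF.2.2
    · exact hr.2 F hF.1 x hF.2.1 y hF.2.2 b (hxm b (by simp)) (List.rel_of_pairwise_cons hmm h)
  have left : ∀ a l', l = l' ++ [a] → y ∈ l → common fam a x = common fam x y := by
    rintro a l' rfl hyl
    rw [common_comm]
    refine Set.Subset.antisymm (hy.2 a (by simp)) fun F hF => ⟨hF.1, hF.2.1, ?_⟩
    rcases List.mem_append.1 hyl with h | h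
    · exact hr.2 F hF.1 y hF.2.2 x hF.2.1 a ((List.pairwise_append.1 hll).2.2 y h a (by simp))
        (hlm a (by simp) x (by simp))
    · rw [List.mem_singleton] at h
      exact h ▸ hF.2.2
  rcases List.eq_nil_or_concat l with rfl | ⟨l', a, rfl⟩
  · cases m with
    | nil => simp at hy1
    | cons b m =>
      rw [List.nil_append, List.nil_append, gapSum_cons_cons,
        right b m rfl (by simpa using hy1), add_comm]
  · rw [List.concat_eq_append] at *
    cases m with
    | nil =>
      rw [List.append_nil, List.append_assoc, List.singleton_append, gapSum_append,
        gapSum_cons_cons, gapSum_singleton, add_zero, left a l' rfl (by simpa using hy1)]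
    | cons b m =>
      have e1 : gapSum (fun a b => φ (common fam a b)) (l' ++ [a] ++ x :: b :: m) =
          gapSum (fun a b => φ (common fam a b)) (l' ++ [a]) + (φ (common fam a x) +
          (φ (common fam x b) + gapSum (fun a b => φ (common fam a b)) (b :: m))) := by
        rw [List.append_assoc, List.singleton_append, gapSum_append, gapSum_cons_cons,
          gapSum_cons_cons]
      have e2 : gapSum (fun a b => φ (common fam a b)) (l' ++ [a] ++ b :: m) =
          gapSum (fun a b => φ (common fam a b)) (l' ++ [a]) + (φ (common fam a b) +
          gapSum (fun a b => φ (common fam a b)) (b :: m)) := by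
        rw [List.append_assoc, List.singleton_append, gapSum_append, gapSum_cons_cons]
      rw [e1, e2]
      have hax := hlm a (by simp) x (by simp)
      have hxb := hxm b (by simp)
      rcases hr.common_or hn hax hxb with ⟨k, hs⟩ | ⟨k, hs⟩
      · have : common fam x b = common fam x y := by
          rcases hy1 with h | h
          · exact Set.Subset.antisymm (hy.2 b (by simp)) (left a l' rfl h ▸ hs)
          · exact right b m rfl h
        rw [k, this]; ring
      · have : common fam a x = common fam x y := by
          rcases hy1 with h | h
          · exact left a l' rfl h
          · exact Set.Subset.antisymm (common_comm fam a x ▸ hy.2 a (by simp))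
              (right b m rfl h ▸ hs)
        rw [k, this]; ring

/-- The sum over the gaps of a function of the branch vertex does not depend on the planar order. -/
theorem gapSum_eq {fam : Set (Set Ends)} (hn : Nested fam) {r r' : Ends → Ends → Prop}
    (hr : IsPlanarOrder fam r) (hr' : IsPlanarOrder fam r') (φ : Set (Set Ends) → ZMod 2)
    {l l' : List Ends} (hl : l.Pairwise r) (hl' : l'.Pairwise r') (h : ∀ x, x ∈ l ↔ x ∈ l') :
    gapSum (fun a b => φ (common fam a b)) l = gapSum (fun a b => φ (common fam a b)) l' := by
  have nodup : ∀ {r : Ends → Ends → Prop}, IsPlanarOrder fam r → ∀ {l : List Ends}, l.Pairwise r →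
      l.Nodup := fun hr _ hl => hl.imp fun h => hr.ne h
  induction l generalizing l' with
  | nil =>
    obtain rfl : l' = [] := List.eq_nil_iff_forall_not_mem.2 fun x hx => by simpa using (h x).2 hx
    rfl
  | cons x m ih =>
    obtain ⟨a, b, rfl⟩ := List.append_of_mem ((h x).1 (by simp))
    have h1 := nodup hr hl
    have h2 := nodup hr' hl'
    have hab : ∀ z, z ∈ m ↔ z ∈ a ++ b := by
      intro z
      have := h z
      by_cases hz : z = x
      · subst hz
        rw [List.nodup_cons] at h1
        rw [List.nodup_middle, List.nodup_cons] at h2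
        tauto
      · simpa [hz] using this
    have hsub : (a ++ b).Pairwise r' := hl'.sublist (by simp)
    rcases m.eq_nil_or_concat with rfl | hm
    · have : a ++ b = [] := List.eq_nil_iff_forall_not_mem.2 fun x hx => by
        simpa using (hab x).2 hx
      rw [List.append_eq_nil_iff] at this
      rw [this.1, this.2]; rfl
    -- Being nearest refers to the set of ends only, so removing `x` costs both lists the same term.
    · obtain ⟨y, hy⟩ := hn.exists_nearest x m.toFinset (by
        obtain ⟨l', c, rfl⟩ := hm
        exact ⟨c, by simp⟩)
      have s1 : IsNearest fam x {z | z ∈ [] ++ m} y := by simpa using hy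
      have s2 : IsNearest fam x {z | z ∈ a ++ b} y := by
        convert s1 using 1
        ext z; simpa using (hab z).symm
      have := gapSum_insert hn hr φ (l := []) hl s1
      rw [List.nil_append] at this
      rw [this, gapSum_insert hn hr' φ hl' s2, List.nil_append, ih hl.of_cons hsub hab]

/-! ### Sorted samples and the count of inverted neighbours. -/

theorem exists_pairwise_list {ι : Type*} (r : ι → ι → Prop) [IsStrictTotalOrder ι r]
    (P : Finset ι) : ∃ l : List ι, l.Pairwise r ∧ ∀ x, x ∈ l ↔ x ∈ P := by
  let := linearOrderOfSTO r
  exact ⟨P.sort, P.sortedLT_sort.pairwise, fun x => P.mem_sort _⟩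

theorem IsPlanarOrder.exists_sorted {fam : Set (Set Ends)} {r : Ends → Ends → Prop}
    (hr : IsPlanarOrder fam r) (P : Finset Ends) :
    ∃ l : List Ends, l.Pairwise r ∧ ∀ x, x ∈ l ↔ x ∈ P := by
  have := hr.1
  exact exists_pairwise_list r P

/-- The list of the elements of `P` in the order `r`. -/
noncomputable def sorted (P : Finset Ends) (r : Ends → Ends → Prop) : List Ends :=
  if h : ∃ l : List Ends, l.Pairwise r ∧ ∀ x, x ∈ l ↔ x ∈ P then h.choose else []

theorem IsPlanarOrder.sorted_spec {fam : Set (Set Ends)} {r : Ends → Ends → Prop}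
    (hr : IsPlanarOrder fam r) (P : Finset Ends) :
    (sorted P r).Pairwise r ∧ ∀ x, x ∈ sorted P r ↔ x ∈ P := by
  rw [sorted, dif_pos (hr.exists_sorted P)]
  exact (hr.exists_sorted P).choose_spec

/-- The number modulo 2 of the pairs of neighbours of `P` in the order `r` which are inverted in
the order `r'`. -/
noncomputable def des (P : Finset Ends) (r r' : Ends → Ends → Prop) : ZMod 2 :=
  gapSum (fun x y => if r' y x then 1 else 0) (sorted P r)

/-- Whether a gap is inverted depends on its branch set alone, so by `gapSum_eq` the count can be
made along any planar order `r''`. -/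
theorem des_eq {fam : Set (Set Ends)} (hn : Nested fam) {e : Set (Set Ends) → Prop}
    {r r' r'' : Ends → Ends → Prop} (hr : IsPlanarOrder fam r) (h : TwistBy fam e r r')
    (hr'' : IsPlanarOrder fam r'') {P : Finset Ends} {l : List Ends} (hl : l.Pairwise r'')
    (hP : ∀ x, x ∈ l ↔ x ∈ P) :
    des P r r' = gapSum (fun a b => if e (common fam a b) then 1 else 0) l := by
  obtain ⟨h1, h2⟩ := hr.sorted_spec P
  rw [← gapSum_eq hn hr hr'' (fun A => if e A then 1 else 0) h1 hl fun x => (h2 x).trans (hP x).symm]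
  refine gapSum_congr h1 fun x _ y _ hxy => ?_
  have := h y x
  rw [common_comm fam y x] at this
  have h3 := hr.not_symm hxy
  simp [this, hxy, h3]

theorem des_eq_gapSum {fam : Set (Set Ends)} (hn : Nested fam) {e : Set (Set Ends) → Prop}
    {r r' : Ends → Ends → Prop} (hr : IsPlanarOrder fam r) (h : TwistBy fam e r r')
    {P : Finset Ends} {l : List Ends} (hl : l.Pairwise r) (hP : ∀ x, x ∈ l ↔ x ∈ P) :
    des P r r' = gapSum (fun x y => if r' y x then 1 else 0) l := by
  rw [des_eq hn hr h hr hl hP]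
  refine gapSum_congr hl fun x _ y _ hxy => ?_
  have := h y x
  rw [common_comm fam y x] at this
  have h3 := hr.not_symm hxy
  simp [this, hxy, h3]

/-- All three counts are moved to the same list. There the gaps inverted by the composite are the
symmetric difference of those inverted by the two twists. -/
theorem des_add {fam : Set (Set Ends)} (hn : Nested fam) {e e' : Set (Set Ends) → Prop}
    {r r' r'' : Ends → Ends → Prop} (hr : IsPlanarOrder fam r) (h : TwistBy fam e r r')
    (h' : TwistBy fam e' r' r'') (P : Finset Ends) :
    des P r r' + des P r' r'' = des P r r'' := by
  obtain ⟨h1, h2⟩ := hr.sorted_spec P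
  rw [des_eq hn hr h hr h1 h2, des_eq hn (hr.twist hn h) h' hr h1 h2,
    des_eq hn hr (h.trans h') hr h1 h2, ← gapSum_add]
  congr 1
  funext a b
  by_cases c1 : e (common fam a b) <;> by_cases c2 : e' (common fam a b) <;> simp [c1, c2]
  decide

theorem des_insert {fam : Set (Set Ends)} (hn : Nested fam) {e : Set (Set Ends) → Prop}
    {r r' : Ends → Ends → Prop} (hr : IsPlanarOrder fam r) (h : TwistBy fam e r r')
    {P : Finset Ends} {x y : Ends} (hx : x ∉ P) (hy : IsNearest fam x P y) :
    des (insert x P) r r' = des P r r' + if (r x y ↔ r' x y) then 0 else 1 := by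
  obtain ⟨h1, h2⟩ := hr.sorted_spec (insert x P)
  obtain ⟨l, m, hlm⟩ := List.append_of_mem ((h2 x).2 (by simp))
  rw [hlm] at h1 h2
  have h0 : (l ++ x :: m).Nodup := h1.imp fun h => hr.ne h
  rw [List.nodup_middle, List.nodup_cons] at h0
  have h3 : ∀ z, z ∈ l ++ m ↔ z ∈ P := by
    intro z
    have := h2 z
    by_cases hz : z = x
    · subst hz; tauto
    · simpa [hz] using this
  have h4 : (l ++ m).Pairwise r := h1.sublist (by simp)
  rw [des_eq hn hr h hr h1 h2, des_eq hn hr h hr h4 h3,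
    gapSum_insert hn hr (fun A => if e A then 1 else 0) h1 (y := y) (by
      convert hy using 1; ext z; exact h3 z)]
  congr 1
  have hxy : x ≠ y := by rintro rfl; exact hx hy.1
  have k1 := h x y
  have k2 := hr.not_iff hxy
  have k3 : e (common fam x y) ↔ ¬ (r x y ↔ r' x y) := by tauto
  simp only [k3, ite_not]

/-- The vertex `F` contains `x` and a sampled end, hence also a nearest one, so the additional gap
lies inside `F` and is not inverted. -/
theorem des_insert_of_agree {fam : Set (Set Ends)} (hn : Nested fam) {e : Set (Set Ends) → Prop}
    {r r' : Ends → Ends → Prop} (hr : IsPlanarOrder fam r) (h : TwistBy fam e r r')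
    {P : Finset Ends} {x : Ends}
    (hx : ∃ F ∈ fam, x ∈ F ∧ (∃ y ∈ P, y ∈ F) ∧ ∀ a ∈ F, ∀ b ∈ F, r a b ↔ r' a b) :
    des (insert x P) r r' = des P r r' := by
  by_cases hxP : x ∈ P
  · rw [Finset.insert_eq_of_mem hxP]
  obtain ⟨F, hF, hxF, ⟨z, hzP, hzF⟩, hag⟩ := hx
  obtain ⟨y, hy⟩ := hn.exists_nearest x P ⟨z, hzP⟩
  rw [des_insert hn hr h hxP hy, if_pos, add_zero]
  exact hag x hxF y (hy.2 z hzP ⟨hF, hxF, hzF⟩).2.2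

theorem des_union_of_agree {fam : Set (Set Ends)} (hn : Nested fam) {e : Set (Set Ends) → Prop}
    {r r' : Ends → Ends → Prop} (hr : IsPlanarOrder fam r) (h : TwistBy fam e r r')
    {P Q : Finset Ends}
    (hQ : ∀ x ∈ Q, ∃ F ∈ fam, x ∈ F ∧ (∃ y ∈ P, y ∈ F) ∧ ∀ a ∈ F, ∀ b ∈ F, r a b ↔ r' a b) :
    des (Q ∪ P) r r' = des P r r' := by
  induction Q using Finset.induction_on with
  | empty => rw [Finset.empty_union]
  | insert x Q hxQ ih =>
    rw [Finset.insert_union, ← ih fun z hz => hQ z (Finset.mem_insert_of_mem hz)]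
    refine des_insert_of_agree hn hr h ?_
    obtain ⟨F, h1, h2, ⟨y, h3, h4⟩, h5⟩ := hQ x (Finset.mem_insert_self _ _)
    exact ⟨F, h1, h2, ⟨y, Finset.mem_union_right _ h3, h4⟩, h5⟩

/-- The map `f` only has to respect both orders on the sample; the two families need not correspond.
This covers both the action of `N` and the truncation of ends. -/
theorem des_image {fam fam' : Set (Set Ends)} {e : Set (Set Ends) → Prop}
    {r r' r₁ r₁' : Ends → Ends → Prop} (hn : Nested fam') (hr : IsPlanarOrder fam r)
    (hr₁ : IsPlanarOrder fam' r₁) (h : TwistBy fam' e r₁ r₁') {P : Finset Ends} {f : Ends → Ends}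
    (h1 : ∀ x ∈ P, ∀ y ∈ P, r x y → r₁ (f x) (f y))
    (h2 : ∀ x ∈ P, ∀ y ∈ P, r x y → (r' y x ↔ r₁' (f y) (f x))) :
    des (P.image f) r₁ r₁' = des P r r' := by
  obtain ⟨h3, h4⟩ := hr.sorted_spec P
  have h5 : ((sorted P r).map f).Pairwise r₁ := by
    rw [List.pairwise_map]
    refine h3.imp_of_mem fun ha hb hab => h1 _ ((h4 _).1 ha) _ ((h4 _).1 hb) hab
  rw [des_eq hn hr₁ h hr₁ h5 (by simp [h4]), gapSum_map, des]
  refine gapSum_congr h3 fun x hx y hy hxy => ?_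
  have hx' := (h4 x).1 hx
  have hy' := (h4 y).1 hy
  have k1 := h1 x hx' y hy' hxy
  have k2 := h2 x hx' y hy' hxy
  have k3 := h (f y) (f x)
  have k4 := hr₁.not_symm k1
  rw [common_comm] at k3
  have : e (common fam' (f x) (f y)) ↔ r' y x := by tauto
  simp only [this]

end Descents

/-! ## Descents between two orders of the same stratum -/

namespace Stratum

open scoped Classical

theorem des_add (s : Stratum) {r r' r'' : Ends → Ends → Prop} (h : r ∈ s.orders)
    (h' : r' ∈ s.orders) (h'' : r'' ∈ s.orders) (P : Finset Ends) :
    des P r r' + des P r' r'' = des P r r'' := by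
  obtain ⟨e, -, he⟩ := (s.mem_orders h).1 h'
  obtain ⟨e', -, he'⟩ := (s.mem_orders h').1 h''
  exact Spheromorphism.des_add s.nested (s.isPlanarOrder h) he he' P

theorem des_union_of_agree (s : Stratum) {r r' : Ends → Ends → Prop} (h : r ∈ s.orders)
    (h' : r' ∈ s.orders) {P Q : Finset Ends}
    (hQ : ∀ x ∈ Q, ∃ F ∈ s.fam, x ∈ F ∧ (∃ y ∈ P, y ∈ F) ∧ ∀ a ∈ F, ∀ b ∈ F, r a b ↔ r' a b) :
    des (Q ∪ P) r r' = des P r r' := by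
  obtain ⟨e, -, he⟩ := (s.mem_orders h).1 h'
  exact Spheromorphism.des_union_of_agree s.nested (s.isPlanarOrder h) he hQ

/-- Both counts equal the count over the union. A sample only has to meet each of the vertices
within which the two orders agree. -/
theorem des_eq_of_agree (s : Stratum) {r r' : Ends → Ends → Prop} (h : r ∈ s.orders)
    (h' : r' ∈ s.orders) {P Q : Finset Ends}
    (hc : ∀ x, ∃ F ∈ s.fam, x ∈ F ∧ (∃ y ∈ P, y ∈ F) ∧ (∃ y ∈ Q, y ∈ F) ∧
      ∀ a ∈ F, ∀ b ∈ F, r a b ↔ r' a b) :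
    des P r r' = des Q r r' := by
  rw [← s.des_union_of_agree h h' (P := P) (Q := Q) fun x _ => ?_,
    ← s.des_union_of_agree h h' (P := Q) (Q := P) fun x _ => ?_, Finset.union_comm]
  · obtain ⟨F, h1, h2, h3, h4, h5⟩ := hc x
    exact ⟨F, h1, h2, h4, h5⟩
  · obtain ⟨F, h1, h2, h3, h4, h5⟩ := hc x
    exact ⟨F, h1, h2, h3, h5⟩

end Stratum

/-! ## Finite sets of ends -/

/-- The end which agrees with `x` before `n` and is zero from `n` on. -/
def trunc (n : ℕ) (x : Ends) : Ends := fun i => if i < n then x i else false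

theorem trunc_apply {n i : ℕ} (x : Ends) (h : i < n) : trunc n x i = x i := if_pos h

theorem pre_trunc {m n : ℕ} (h : m ≤ n) (x : Ends) : pre m (trunc n x) = pre m x :=
  pre_eq_iff.2 fun _ hi => trunc_apply x (hi.trans_le h)

theorem finite_points (n : ℕ) : {x : Ends | ∀ i, n ≤ i → x i = false}.Finite := by
  refine Set.Finite.of_finite_image (f := pre n) ((List.finite_length_eq Bool n).subset ?_) ?_
  · rintro _ ⟨x, -, rfl⟩; simp
  · intro x hx y hy h
    funext i
    rcases lt_or_ge i n with hi | hi
    · exact pre_eq_iff.1 h i hi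
    · rw [hx i hi, hy i hi]

/-- The ends which vanish from `n` on: one in each ball of depth `n`. -/
noncomputable def points (n : ℕ) : Finset Ends := (finite_points n).toFinset

theorem mem_points {n : ℕ} {x : Ends} : x ∈ points n ↔ ∀ i, n ≤ i → x i = false := by
  simp [points]

theorem trunc_mem_points (n : ℕ) (x : Ends) : trunc n x ∈ points n :=
  mem_points.2 fun _ hi => if_neg hi.not_gt

theorem trunc_of_mem_points {n : ℕ} {x : Ends} (h : x ∈ points n) : trunc n x = x := by
  funext i
  unfold trunc
  split_ifs with hi
  · rfl
  · exact (mem_points.1 h i (not_lt.1 hi)).symm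

theorem exists_ball_subset {U : Set Ends} (hU : IsOpen U) {x : Ends} (hx : x ∈ U) :
    ∃ n, ball (pre n x) ⊆ U := by
  obtain ⟨n, hn⟩ : ∃ n, PiNat.cylinder x n ⊆ U := by
    have := (PiNat.isTopologicalBasis_cylinders fun _ : ℕ => Bool).exists_subset_of_mem_open hx hU
    obtain ⟨_, ⟨y, n, rfl⟩, h1, h2⟩ := this
    exact ⟨n, by rwa [PiNat.mem_cylinder_iff_eq.1 h1]⟩
  exact ⟨n, fun y hy => hn fun i hi => mem_ball_pre_iff.1 hy i hi⟩

theorem exists_points_mem {U : Set Ends} (hU : IsOpen U) (hne : U.Nonempty) :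
    ∃ m, ∀ n, m ≤ n → ∃ y ∈ points n, y ∈ U := by
  obtain ⟨x, hx⟩ := hne
  obtain ⟨m, hm⟩ := exists_ball_subset hU hx
  exact ⟨m, fun n hn => ⟨trunc n x, trunc_mem_points n x, hm (by
    rw [mem_ball_iff, length_pre, pre_trunc hn])⟩⟩

theorem exists_points_mem_ball {w : List Bool} {n : ℕ} (h : w.length ≤ n) :
    ∃ y ∈ points n, y ∈ ball w := by
  obtain ⟨x, hx⟩ := ball_nonempty w
  rw [mem_ball_iff] at hx
  exact ⟨trunc n x, trunc_mem_points n x, by rw [mem_ball_iff, pre_trunc h, hx]⟩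

/-! ## Normal orders -/

theorem lex_of_split {x y : Ends} {n : ℕ} (h : pre n x = pre n y) (hx : x n = false)
    (hy : y n = true) : lexOrder x y := ⟨n, pre_eq_iff.1 h, hx, hy⟩

/-- An order is normal if the left son of a ball precedes the right one whenever the ball and its two
sons are vertices. -/
def IsNormal (s : Stratum) (r : Ends → Ends → Prop) : Prop :=
  r ∈ s.orders ∧ ∀ w, ball w ∈ s.fam → ball (w ++ [false]) ∈ s.fam → ball (w ++ [true]) ∈ s.fam →
    ∀ x ∈ ball (w ++ [false]), ∀ y ∈ ball (w ++ [true]), r x y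

/-- A vertex meeting both sons contains each of them by nestedness, hence also their union. -/
theorem common_of_sons {fam : Set (Set Ends)} (hn : Nested fam) {w : List Bool}
    (hw : ball w ∈ fam) (h0 : ball (w ++ [false]) ∈ fam) (h1 : ball (w ++ [true]) ∈ fam)
    {x y : Ends} (hx : x ∈ ball (w ++ [false])) (hy : y ∈ ball (w ++ [true])) :
    common fam x y = {G | G ∈ fam ∧ ball w ⊆ G} := by
  refine common_eq_of_meet ⟨hw, ball_append_subset _ _ hx, ball_append_subset _ _ hy⟩ ?_
  rintro G ⟨hG, hxG, hyG⟩
  have hd := ball_snoc_disjoint w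
  rw [← ball_snoc_union]
  refine Set.union_subset ?_ ?_
  · rcases hn.chain h0 hG hx hxG with h | h
    · exact h
    · exact absurd hy (Set.disjoint_left.1 hd (h hyG))
  · rcases hn.chain h1 hG hy hyG with h | h
    · exact h
    · exact absurd (h hxG) (Set.disjoint_left.1 hd hx)

/-- Starting from any order, invert exactly those balls whose sons stand in the wrong order. By
convexity one wrong pair across the sons makes all such pairs wrong. -/
theorem Stratum.exists_normal (s : Stratum) : ∃ r, IsNormal s r := by
  obtain ⟨r, hr⟩ := s.orders_nonempty
  have hp := s.isPlanarOrder hr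
  let e : Set (Set Ends) → Prop := fun A => ∃ w, ball w ∈ s.fam ∧ ball (w ++ [false]) ∈ s.fam ∧
    ball (w ++ [true]) ∈ s.fam ∧ A = {G | G ∈ s.fam ∧ ball w ⊆ G} ∧
    ∃ x ∈ ball (w ++ [false]), ∃ y ∈ ball (w ++ [true]), r y x
  let r' : Ends → Ends → Prop := fun x y =>
    (e (common s.fam x y) ∧ r y x) ∨ (¬ e (common s.fam x y) ∧ r x y)
  have ht : TwistBy s.fam e r r' := fun x y => Iff.rfl
  have he : ¬ e ∅ := by
    rintro ⟨w, hw, -, -, h, -⟩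
    have : ball w ∈ (∅ : Set (Set Ends)) := h ▸ ⟨hw, subset_rfl⟩
    exact this
  refine ⟨r', (s.mem_orders hr).2 ⟨e, he, ht⟩, fun w hw h0 h1 x hx y hy => ?_⟩
  have hc := common_of_sons s.nested hw h0 h1 hx hy
  have hd := ball_snoc_disjoint w
  by_cases hxy : r x y
  · refine Or.inr ⟨?_, hxy⟩
    rintro ⟨w', hw', h0', h1', h, x', hx', y', hy', hyx⟩
    rw [hc] at h
    have e1 : ball w ⊆ ball w' := by
      have : ball w' ∈ {G | G ∈ s.fam ∧ ball w ⊆ G} := h ▸ ⟨hw', subset_rfl⟩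
      exact this.2
    have e2 : ball w' ⊆ ball w := by
      have : ball w ∈ {G | G ∈ s.fam ∧ ball w' ⊆ G} := h ▸ ⟨hw, subset_rfl⟩
      exact this.2
    -- The set of vertices above a pair determines its smallest member, and so the word.
    obtain rfl := ball_injective (e1.antisymm e2)
    have k1 := hp.side h0 hx hx' (Set.disjoint_right.1 hd hy) hxy
    have k2 := hp.side' h1 hy hy' (Set.disjoint_left.1 hd hx') k1
    exact hp.not_symm k2 hyx
  · have hne : x ≠ y := by rintro rfl; exact Set.disjoint_left.1 hd hx hy
    have hyx := (hp.not_iff hne).1 hxy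
    exact Or.inl ⟨⟨w, hw, h0, h1, hc, x, hx, y, hy, hyx⟩, hyx⟩

/-- A chosen normal order of a stratum. -/
noncomputable def Stratum.order (s : Stratum) : Ends → Ends → Prop := s.exists_normal.choose

theorem Stratum.isNormal_order (s : Stratum) : IsNormal s s.order := s.exists_normal.choose_spec

theorem Stratum.order_mem (s : Stratum) : s.order ∈ s.orders := s.isNormal_order.1

theorem snoc_mem_deep {n : ℕ} {w : List Bool} (h : n ≤ w.length) (b : Bool) :
    ball (w ++ [b]) ∈ deep n := ball_mem_deep (by simp; omega)

/-- A normal order is the lexicographic order on the balls all of whose sub-balls are vertices. -/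
theorem IsNormal.iff_lex {s : Stratum} {r : Ends → Ends → Prop} (h : IsNormal s r) {n : ℕ}
    (hn : deep n ⊆ s.fam) {x y : Ends} (hxy : ∀ i < n, x i = y i) :
    r x y ↔ lexOrder x y := by
  have hp := s.isPlanarOrder h.1
  by_cases hne : x = y
  · subst hne
    exact iff_of_false (hp.1.irrefl x) (isPlanarOrder_lex.1.irrefl x)
  have key : ∀ x y : Ends, (∀ i < n, x i = y i) → ∀ m, pre m x = pre m y → x m = false →
      y m = true → r x y := by
    intro x y hxy m hm hx hy
    have hnm : n ≤ m := by
      by_contra hlt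
      have := hxy m (not_le.1 hlt)
      rw [hx, hy] at this
      exact Bool.noConfusion this
    have hl : n ≤ (pre m x).length := by simpa using hnm
    refine h.2 (pre m x) (hn (ball_mem_deep hl)) (hn (snoc_mem_deep hl _))
      (hn (snoc_mem_deep hl _)) x ?_ y ?_
    · rw [← hx]; exact mem_snoc_pre m x
    · rw [hm, ← hy]; exact mem_snoc_pre m y
  obtain ⟨m, hm, hd⟩ := exists_split hne
  rcases hx : x m with _ | _
  · have hy : y m = true := by rw [hx] at hd; simpa using hd.symm
    exact iff_of_true (key x y hxy m hm hx hy) (lex_of_split hm hx hy)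
  · have hy : y m = false := by rw [hx] at hd; simpa using hd.symm
    exact iff_of_false (hp.not_symm (key y x (fun i hi => (hxy i hi).symm) m hm.symm hy hx))
      (isPlanarOrder_lex.not_symm (lex_of_split hm.symm hy hx))

/-! ## The cocycle of the tower -/

/-- The limit of a sequence along a fixed ultrafilter. -/
noncomputable def ulim (f : ℕ → ZMod 2) : ZMod 2 :=
  open scoped Classical in if ∀ᶠ n in (Filter.hyperfilter ℕ : Filter ℕ), f n = 1 then 1 else 0

/-- Finitely many such limits are attained at one common `n`, so identities between counts pass to
the limit. An ordinary limit need not exist: an element of `N` may exchange sons at infinitely many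
vertices, and then the counts in `defect` need not stabilise. -/
theorem eventually_eq_ulim (f : ℕ → ZMod 2) :
    ∀ᶠ n in (Filter.hyperfilter ℕ : Filter ℕ), f n = ulim f := by
  unfold ulim
  split_ifs with h
  · exact h
  · rw [← Ultrafilter.eventually_not] at h
    filter_upwards [h] with n hn
    revert hn
    generalize f n = z
    revert z
    decide

theorem eventually_ge (m : ℕ) : ∀ᶠ n in (Filter.hyperfilter ℕ : Filter ℕ), m ≤ n :=
  Nat.hyperfilter_le_atTop (Filter.eventually_ge_atTop m)

theorem zmod_add_self (z : ZMod 2) : z + z = 0 := CharTwo.add_self_eq_zero z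

/-- The cocycle of the tower which defines the stable length. -/
noncomputable def cocycle (s t : Stratum) : ZMod 2 :=
  ulim fun n => des (points n) s.order t.order

/-- The orders of `t` and `u` are also orders of the finest stratum `s`, where the counts add up. -/
theorem cocycle_add {s t u : Stratum} (h : s ≤ t) (h' : t ≤ u) :
    cocycle s t + cocycle t u = cocycle s u := by
  obtain ⟨n, e1, e2, e3⟩ := ((eventually_eq_ulim _).and ((eventually_eq_ulim _).and
    (eventually_eq_ulim _))).exists (f := (Filter.hyperfilter ℕ : Filter ℕ))
  rw [cocycle, cocycle, cocycle, ← e1, ← e2, ← e3]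
  exact s.des_add s.order_mem (h.2 t.order_mem) (h.2 (h'.2 u.order_mem)) _

theorem des_self (s : Stratum) {r : Ends → Ends → Prop} (h : r ∈ s.orders) (P : Finset Ends) :
    des P r r = 0 := by
  have := s.des_add h h h P
  rwa [add_eq_left] at this

theorem cocycle_self (s : Stratum) : cocycle s s = 0 := by
  have := cocycle_add (le_refl s) (le_refl s)
  rwa [add_eq_left] at this

theorem des_swap (s : Stratum) {r r' : Ends → Ends → Prop} (h : r ∈ s.orders) (h' : r' ∈ s.orders)
    (P : Finset Ends) : des P r r' = des P r' r := by
  have := s.des_add h h' h P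
  rw [des_self s h] at this
  rw [← add_zero (des P r r'), ← zmod_add_self (des P r' r), ← add_assoc, this, zero_add]

/-! ## The action of spheromorphisms -/

theorem imageOrder_apply (g : Equiv.Perm Ends) (r : Ends → Ends → Prop) (x y : Ends) :
    imageOrder g⁻¹ r x y ↔ r (g x) (g y) := by
  simp [imageOrder]

theorem mem_orders_smul {g : Neretin} {s : Stratum} {r : Ends → Ends → Prop} :
    r ∈ (g • s).orders ↔ imageOrder (g : Equiv.Perm Ends)⁻¹ r ∈ s.orders := by
  change r ∈ imageOrder (g : Equiv.Perm Ends) '' s.orders ↔ _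
  constructor
  · rintro ⟨r, hr, rfl⟩
    rwa [← imageOrder_mul, inv_mul_cancel, imageOrder_one]
  · exact fun h => ⟨_, h, by rw [← imageOrder_mul, mul_inv_cancel, imageOrder_one]⟩

theorem smul_le_smul_stratum (g : Neretin) {s t : Stratum} (h : s ≤ t) : g • s ≤ g • t :=
  ⟨Set.image_mono h.1, Set.image_mono h.2⟩

section

open scoped Classical

theorem des_imageOrder (g : Neretin) (s : Stratum) {r r' : Ends → Ends → Prop}
    (h : r ∈ (g • s).orders) (h' : r' ∈ (g • s).orders) (P : Finset Ends) :
    des P (imageOrder (g : Equiv.Perm Ends)⁻¹ r) (imageOrder (g : Equiv.Perm Ends)⁻¹ r') =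
      des (P.image (g : Equiv.Perm Ends)) r r' := by
  obtain ⟨e, -, he⟩ := ((g • s).mem_orders h).1 h'
  refine (des_image (g • s).nested (s.isPlanarOrder (mem_orders_smul.1 h))
    ((g • s).isPlanarOrder h) he (fun x _ y _ hxy => ?_) fun x _ y _ _ => ?_).symm
  · rwa [imageOrder_apply] at hxy
  · rw [imageOrder_apply]

/-- Below some depth `N` both chosen orders are lexicographic, so one end in each ball of depth `N`
suffices. By continuity of `g` the image of a fine sample meets all these balls. -/
theorem eventually_des_image (g : Neretin) {s t : Stratum} (h : s ≤ t) :
    ∀ᶠ n in (Filter.hyperfilter ℕ : Filter ℕ),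
      des ((points n).image (g : Equiv.Perm Ends)) s.order t.order =
        des (points n) s.order t.order := by
  obtain ⟨N, hN⟩ := t.exists_deep
  have hN' := hN.trans h.1
  have key : ∀ w : List Bool, ∃ m, ∀ n, m ≤ n → ∃ y ∈ points n,
      (g : Equiv.Perm Ends) y ∈ ball w := by
    intro w
    refine exists_points_mem (U := (g : Equiv.Perm Ends) ⁻¹' ball w)
      ((isClopen_ball w).isOpen.preimage (IsSpheromorphism.continuous g.2)) ?_
    obtain ⟨x, hx⟩ := ball_nonempty w
    exact ⟨(g : Equiv.Perm Ends)⁻¹ x, by simpa using hx⟩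
  choose f hf using key
  obtain ⟨m, hm⟩ := exists_bound N f
  filter_upwards [eventually_ge m, eventually_ge N] with n hn hn'
  refine s.des_eq_of_agree s.order_mem (h.2 t.order_mem) fun x => ?_
  refine ⟨ball (pre N x), hN' (ball_mem_deep (by simp)), mem_ball_pre _ _, ?_, ?_, ?_⟩
  · obtain ⟨y, hy, hy'⟩ := hf (pre N x) n ((hm _ (by simp)).trans hn)
    exact ⟨_, Finset.mem_image_of_mem _ hy, hy'⟩
  · exact exists_points_mem_ball (by simpa using hn')
  · intro a ha b hb
    have hab : ∀ i < N, a i = b i := by simpa using agree_of_mem_ball ha hb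
    rw [s.isNormal_order.iff_lex hN' hab, t.isNormal_order.iff_lex hN hab]

end

/-- The cochain which measures how far the cocycle is from being invariant. -/
noncomputable def defect (g : Neretin) (s : Stratum) : ZMod 2 :=
  ulim fun n => des (points n) s.order (imageOrder (g : Equiv.Perm Ends)⁻¹ (g • s).order)

theorem smul_order_mem (g : Neretin) (s : Stratum) :
    imageOrder (g : Equiv.Perm Ends)⁻¹ (g • s).order ∈ s.orders :=
  mem_orders_smul.1 (g • s).order_mem

/-- Pulled back by `g`, the chosen orders of `g • s` and `g • t` become orders of `s`. Compare the
two ways from the chosen order of `s` to the pulled back order of `g • t`, through the chosen order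
of `t` or through the pulled back order of `g • s`. -/
theorem cocycle_smul (g : Neretin) {s t : Stratum} (h : s ≤ t) :
    cocycle (g • s) (g • t) = cocycle s t + defect g s + defect g t := by
  have hg := smul_le_smul_stratum g h
  obtain ⟨n, e0, e1, e2, e3, e4⟩ := ((eventually_des_image g hg).and
    ((eventually_eq_ulim _).and ((eventually_eq_ulim _).and
    ((eventually_eq_ulim _).and (eventually_eq_ulim _))))).exists
    (f := (Filter.hyperfilter ℕ : Filter ℕ))
  rw [cocycle, cocycle, defect, defect, ← e1, ← e2, ← e3, ← e4]
  rw [← e0, ← des_imageOrder g s (g • s).order_mem (hg.2 (g • t).order_mem)]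
  have k1 := s.des_add s.order_mem (smul_order_mem g s) (h.2 (smul_order_mem g t)) (points n)
  have k2 := s.des_add s.order_mem (h.2 t.order_mem) (h.2 (smul_order_mem g t)) (points n)
  rw [← k2] at k1
  have k3 := zmod_add_self (des (points n) s.order (imageOrder (g : Equiv.Perm Ends)⁻¹ (g • s).order))
  linear_combination k1 - k3

theorem defect_one (s : Stratum) : defect 1 s = 0 := by
  obtain ⟨n, e⟩ := (eventually_eq_ulim _).exists (f := (Filter.hyperfilter ℕ : Filter ℕ))
  rw [defect, ← e, one_smul]
  exact des_self s s.order_mem _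

/-! ## Paths in the fundamental groupoid -/

/-- Induction for the morphisms of the free groupoid on a category. -/
theorem freeGroupoid_induction {C : Type} [Category.{0} C]
    (Q : ∀ X Y : C, (FreeGroupoid.mk X ⟶ FreeGroupoid.mk Y) → Prop)
    (id : ∀ X, Q X X (𝟙 _))
    (comp : ∀ X Y Z f (g : Y ⟶ Z), Q X Y f → Q X Z (f ≫ FreeGroupoid.homMk g))
    (comp_inv : ∀ X Y Z f (g : Z ⟶ Y), Q X Y f → Q X Z (f ≫ Groupoid.inv (FreeGroupoid.homMk g)))
    {X Y : C} (f : FreeGroupoid.mk X ⟶ FreeGroupoid.mk Y) : Q X Y f := by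
  -- A morphism is the class, under two successive quotients, of a zigzag of arrows and formal
  -- inverses.
  have aux : ∀ {Y : C} (p : Quiver.Path (V := Quiver.Symmetrify C) X Y),
      Q X Y (Quot.mk _ (Quot.mk _ p)) := by
    clear f
    intro Y p
    induction p with
    | nil => exact id X
    | cons p e ih =>
      rcases e with e | e
      · exact comp _ _ _ _ e ih
      · exact comp_inv _ _ _ _ e ih
  clear id comp comp_inv
  obtain ⟨⟨p⟩⟩ := f
  exact aux p

/-- The stratum of the universal cover above `t` which has `u` in its closure. -/
def Cover.up (u : Cover) (t : Stratum) (h : u.base ≤ t) : Cover :=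
  ⟨t, u.path ≫ FreeGroupoid.homMk (homOfLE h)⟩

theorem Cover.le_up (u : Cover) (t : Stratum) (h : u.base ≤ t) : u ≤ u.up t h := ⟨h, rfl⟩

theorem Cover.eq_up {u v : Cover} (h : u ≤ v) : v = u.up v.base h.1 := by
  obtain ⟨t, q⟩ := v
  obtain ⟨h1, h2⟩ := h
  exact Cover.ext rfl (heq_of_eq h2.symm)

/-- Face relations lift uniquely to the universal cover. -/
theorem Cover.eq_of_base {u v w : Cover} (h : u ≤ v) (h' : u ≤ w) (hb : v.base = w.base) :
    v = w := by
  obtain ⟨t, q⟩ := v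
  obtain ⟨t', q'⟩ := w
  obtain rfl : t = t' := hb
  rw [Cover.eq_up h, Cover.eq_up h']

/-- The stratum of the universal cover above `t` in the closure of `u`. -/
def Cover.down (u : Cover) (t : Stratum) (h : t ≤ u.base) : Cover :=
  ⟨t, u.path ≫ Groupoid.inv (FreeGroupoid.homMk (homOfLE h))⟩

theorem Cover.down_le (u : Cover) (t : Stratum) (h : t ≤ u.base) : u.down t h ≤ u :=
  ⟨h, by simp [Cover.down]⟩

/-- The base point of the universal cover. -/
def Cover.root : Cover := ⟨baseStratum, 𝟙 _⟩

/-- The universal cover is connected by chains of faces. -/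
theorem Cover.induction {Q : Cover → Prop} (h0 : Q Cover.root) (up : ∀ u v, u ≤ v → Q u → Q v)
    (down : ∀ u v, v ≤ u → Q u → Q v) (u : Cover) : Q u := by
  obtain ⟨t, p⟩ := u
  refine freeGroupoid_induction (C := Stratum)
    (fun X Y f => ∀ q : FreeGroupoid.mk baseStratum ⟶ FreeGroupoid.mk X, Q ⟨X, q⟩ → Q ⟨Y, q ≫ f⟩)
    ?_ ?_ ?_ p (𝟙 _) h0 |> fun h => by simpa using h
  · intro X q hq; simpa using hq
  · intro X Y Z f g ih q hq
    have := up _ _ (Cover.le_up _ Z (leOfHom g)) (ih q hq)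
    simp only [Cover.up, Category.assoc] at this
    exact this
  · intro X Y Z f g ih q hq
    have := down _ _ (Cover.down_le _ Z (leOfHom g)) (ih q hq)
    simp only [Cover.down, Category.assoc] at this
    exact this

theorem Cover.const {X : Type} {f : Cover → X} (h : ∀ u v, u ≤ v → f u = f v) (u v : Cover) :
    f u = f v := by
  have key : ∀ u, f u = f Cover.root := fun u =>
    Cover.induction (Q := fun u => f u = f Cover.root) rfl
      (fun u v huv hu => (h u v huv).symm.trans hu) (fun u v hvu hu => (h v u hvu).trans hu) u
  rw [key u, key v]

/-! ## The potential of the cocycle -/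

/-- The functor defined by the cocycle. -/
noncomputable def cocycleFunctor : Stratum ⥤ SingleObj (Multiplicative (ZMod 2)) where
  obj _ := SingleObj.star _
  map {s t} _ := Multiplicative.ofAdd (cocycle s t)
  map_id s := by rw [cocycle_self]; rfl
  map_comp {s t u} f g := by
    rw [SingleObj.comp_as_mul, ← cocycle_add (leOfHom f) (leOfHom g), ofAdd_add, mul_comm]

/-- The value of the cocycle on a path from the base point. -/
noncomputable def potential (u : Cover) : ZMod 2 :=
  Multiplicative.toAdd (α := ZMod 2) ((FreeGroupoid.lift cocycleFunctor).map u.path)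

theorem potential_of_le {u v : Cover} (h : u ≤ v) :
    potential v = potential u + cocycle u.base v.base := by
  obtain ⟨h1, h2⟩ := h
  rw [potential, potential, ← h2, Functor.map_comp, FreeGroupoid.lift_map_homMk,
    SingleObj.comp_as_mul]
  exact add_comm _ _

/-! ### The change of the potential under lifts, and the stable length. -/

theorem LiftGroup.base_eq (f : LiftGroup) (u : Cover) : (f.1.2 u).base = proj f • u.base := f.2 u

/-- The difference of potentials produced by a lift, up to the defect. -/
noncomputable def liftShift (f : LiftGroup) : ZMod 2 :=
  potential (f.1.2 Cover.root) + potential Cover.root + defect (proj f) Cover.root.base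

/-- By `cocycle_smul` the combination of potentials and defect is unchanged along face relations,
hence constant on the connected universal cover. -/
theorem potential_lift (f : LiftGroup) (u : Cover) :
    potential (f.1.2 u) = potential u + defect (proj f) u.base + liftShift f := by
  have key := Cover.const
    (f := fun u => potential (f.1.2 u) + potential u + defect (proj f) u.base) (fun u v h => by
      rw [potential_of_le h, potential_of_le (f.1.2.monotone h), LiftGroup.base_eq f, LiftGroup.base_eq f,
        cocycle_smul _ h.1]
      linear_combination -zmod_add_self (cocycle u.base v.base) -
        zmod_add_self (defect (proj f) v.base)) u Cover.root
  rw [liftShift, ← key]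
  linear_combination -zmod_add_self (potential u) - zmod_add_self (defect (proj f) u.base)

theorem liftShift_mul (f f' : LiftGroup) (s : Stratum) (hs : ∃ u : Cover, u.base = s) :
    liftShift (f * f') = liftShift f + liftShift f' +
      (defect (proj f) (proj f' • s) + defect (proj f') s + defect (proj (f * f')) s) := by
  obtain ⟨u, rfl⟩ := hs
  have h1 := potential_lift (f * f') u
  have h2 : (f * f').1.2 u = f.1.2 (f'.1.2 u) := rfl
  rw [h2, potential_lift, potential_lift f', LiftGroup.base_eq f'] at h1
  linear_combination -h1 - zmod_add_self (defect (proj (f * f')) u.base)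

/-- The stable length on the fundamental group of the tower. -/
noncomputable def stableLength : proj.ker →* Multiplicative (ZMod 2) where
  toFun p := Multiplicative.ofAdd (liftShift p.1)
  map_one' := by
    change Multiplicative.ofAdd (liftShift 1) = 1
    have := potential_lift 1 Cover.root
    rw [map_one, defect_one, add_zero] at this
    rw [left_eq_add.1 this]
    rfl
  map_mul' p q := by
    change Multiplicative.ofAdd (liftShift (p.1 * q.1)) = _
    rw [liftShift_mul _ _ _ ⟨Cover.root, rfl⟩, map_mul, p.2, q.2, mul_one, defect_one, defect_one,
      add_zero, add_zero, add_zero, ofAdd_add]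

theorem stableLength_apply (p : proj.ker) (u : Cover) :
    stableLength p = Multiplicative.ofAdd (potential (p.1.1.2 u) + potential u) := by
  have := potential_lift p.1 u
  rw [p.2, defect_one, add_zero] at this
  change Multiplicative.ofAdd (liftShift p.1) = _
  rw [this]
  congr 1
  linear_combination -zmod_add_self (potential u)

theorem liftShift_ker_mul (p f : LiftGroup) (hp : proj p = 1) :
    liftShift (p * f) = liftShift p + liftShift f := by
  rw [liftShift_mul _ _ _ ⟨Cover.root, rfl⟩, map_mul, hp, one_mul, defect_one, zero_add,
    zmod_add_self, add_zero]

theorem liftShift_mul_ker (p f : LiftGroup) (hp : proj p = 1) :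
    liftShift (f * p) = liftShift f + liftShift p := by
  rw [liftShift_mul _ _ _ ⟨Cover.root, rfl⟩, map_mul, hp, mul_one, defect_one, one_smul, add_zero,
    zmod_add_self, add_zero]

/-- The stable length is invariant under conjugation by lifts. -/
theorem liftShift_conj (p f : LiftGroup) (hp : proj p = 1) :
    liftShift (f * p * f⁻¹) = liftShift p := by
  have h1 : proj (f * p * f⁻¹) = 1 := by simp [hp]
  have h2 := liftShift_ker_mul (f * p * f⁻¹) f h1
  rw [inv_mul_cancel_right, liftShift_mul_ker p f hp] at h2
  linear_combination -h2

theorem mem_lengthKernel {f : LiftGroup} :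
    f ∈ lengthKernel stableLength ↔ proj f = 1 ∧ liftShift f = 0 := by
  constructor
  · rintro ⟨p, hp, rfl⟩
    exact ⟨p.2, hp⟩
  · rintro ⟨h1, h2⟩
    exact ⟨⟨f, h1⟩, h2, rfl⟩

theorem lengthKernel_normal : (lengthKernel stableLength).Normal where
  conj_mem p hp f := by
    rw [mem_lengthKernel] at hp ⊢
    exact ⟨by simp [hp.1], by rw [liftShift_conj p f hp.1, hp.2]⟩

theorem trunc_congr {n : ℕ} {x y : Ends} (h : pre n x = pre n y) : trunc n x = trunc n y := by
  funext i
  unfold trunc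
  split_ifs with hi
  · exact pre_eq_iff.1 h i hi
  · rfl

/-! ## Lifts of level preserving elements -/

section

open scoped Classical

/-- Expressed by counts, the three defects telescope through the order of `u.base` pulled back from
the chosen order of its image under `f'`. What remains compares the same two orders on that image
twice: over the sample and over its translate. The point `u` is left free so that this image can be
made the base stratum. -/
theorem eventually_liftShift_mul (f f' : LiftGroup) (u : Cover) :
    ∀ᶠ n in (Filter.hyperfilter ℕ : Filter ℕ), liftShift (f * f') = liftShift f + liftShift f' +
      (des (points n) (proj f' • u.base).order (imageOrder (proj f : Equiv.Perm Ends)⁻¹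
          (proj (f * f') • u.base).order) +
        des ((points n).image (proj f' : Equiv.Perm Ends)) (proj f' • u.base).order
          (imageOrder (proj f : Equiv.Perm Ends)⁻¹ (proj (f * f') • u.base).order)) := by
  have hm : proj (f * f') • u.base = proj f • proj f' • u.base := by rw [map_mul, mul_smul]
  have h := smul_order_mem (proj f) (proj f' • u.base)
  rw [← hm] at h
  filter_upwards [eventually_eq_ulim fun n => des (points n) (proj f' • u.base).order
      (imageOrder (proj f : Equiv.Perm Ends)⁻¹ (proj f • proj f' • u.base).order),
    eventually_eq_ulim fun n => des (points n) u.base.order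
      (imageOrder (proj f' : Equiv.Perm Ends)⁻¹ (proj f' • u.base).order),
    eventually_eq_ulim fun n => des (points n) u.base.order
      (imageOrder (proj (f * f') : Equiv.Perm Ends)⁻¹ (proj (f * f') • u.base).order)]
      with n e1 e2 e3
  rw [liftShift_mul f f' u.base ⟨u, rfl⟩]
  congr 1
  rw [defect, defect, defect, ← e1, ← e2, ← e3, add_assoc, hm]
  congr 1
  rw [hm] at h
  rw [← des_imageOrder (proj f') u.base (proj f' • u.base).order_mem h]
  have hi : imageOrder (proj (f * f') : Equiv.Perm Ends)⁻¹ (proj f • proj f' • u.base).order =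
      imageOrder (proj f' : Equiv.Perm Ends)⁻¹ (imageOrder (proj f : Equiv.Perm Ends)⁻¹
        (proj f • proj f' • u.base).order) := by
    rw [← imageOrder_mul, ← mul_inv_rev, map_mul]; rfl
  rw [hi, ← u.base.des_add u.base.order_mem (mem_orders_smul.1 (proj f' • u.base).order_mem)
    (mem_orders_smul.1 h) (points n), ← add_assoc, zmod_add_self, zero_add]

/-- `g` induces a permutation of the vertices of the tree at every sufficiently large depth. -/
def IsLevel (g : Equiv.Perm Ends) : Prop :=
  ∃ N, ∀ n, N ≤ n → ∀ x y, pre n x = pre n y ↔ pre n (g x) = pre n (g y)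

theorem IsLevel.inv {g : Equiv.Perm Ends} (hg : IsLevel g) : IsLevel g⁻¹ := by
  obtain ⟨N, hN⟩ := hg
  refine ⟨N, fun n hn x y => ?_⟩
  have := hN n hn (g⁻¹ x) (g⁻¹ y)
  simpa using this.symm

theorem IsTreeIso.isLevel {g : Equiv.Perm Ends} (hg : IsTreeIso g) : IsLevel g :=
  ⟨0, fun n _ x y => by rw [pre_eq_iff, pre_eq_iff]; exact hg x y n⟩

/-- Each ball of depth `n` is a vertex, so ends of two different balls compare in the same way as
any representatives of these balls. -/
theorem IsPlanarOrder.trunc {fam : Set (Set Ends)} {r : Ends → Ends → Prop}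
    (h : IsPlanarOrder fam r) {n : ℕ} (hn : deep n ⊆ fam) {x y : Ends} (hne : pre n x ≠ pre n y) :
    r x y ↔ r (trunc n x) (trunc n y) := by
  have key : ∀ z, ball (pre n z) ∈ fam := fun z => hn (ball_mem_deep (by simp))
  have mem : ∀ z, Spheromorphism.trunc n z ∈ ball (pre n z) := fun z => by
    rw [mem_ball_iff, length_pre, pre_trunc le_rfl]
  have k1 : y ∉ ball (pre n x) := by rw [mem_ball_iff, length_pre]; exact hne.symm
  have k2 : Spheromorphism.trunc n x ∉ ball (pre n y) := by
    rw [mem_ball_iff, length_pre, pre_trunc le_rfl]; exact hne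
  constructor
  · intro hr
    exact h.side' (key y) (mem_ball_pre n y) (mem y) k2
      (h.side (key x) (mem_ball_pre n x) (mem x) k1 hr)
  · intro hr
    exact h.side (key x) (mem x) (mem_ball_pre n x) k1
      (h.side' (key y) (mem y) (mem_ball_pre n y) k2 hr)

/-- The translated sample still has exactly one end in each ball of depth `n`, and truncation brings
it back to the original sample without changing any comparison. -/
theorem IsLevel.eventually_des {g : Equiv.Perm Ends} (hg : IsLevel g) (s : Stratum)
    {r r' : Ends → Ends → Prop} (h : r ∈ s.orders) (h' : r' ∈ s.orders) :
    ∀ᶠ n in (Filter.hyperfilter ℕ : Filter ℕ),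
      des ((points n).image g) r r' = des (points n) r r' := by
  obtain ⟨N, hN⟩ := hg
  obtain ⟨M, hM⟩ := s.exists_deep
  filter_upwards [eventually_ge N, eventually_ge M] with n hn hn'
  have hd := (deep_mono hn').trans hM
  obtain ⟨e, -, he⟩ := (s.mem_orders h).1 h'
  have himg : ((points n).image g).image (trunc n) = points n := by
    ext p
    constructor
    · intro hp
      obtain ⟨q, -, rfl⟩ := Finset.mem_image.1 hp
      exact trunc_mem_points n q
    · intro hp
      refine Finset.mem_image.2 ⟨g (trunc n (g⁻¹ p)), Finset.mem_image_of_mem _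
        (trunc_mem_points n _), ?_⟩
      have : pre n (g (trunc n (g⁻¹ p))) = pre n p := by
        have := (hN n hn _ _).1 (pre_trunc le_rfl (g⁻¹ p))
        simpa using this
      rw [trunc_congr this, trunc_of_mem_points hp]
  have hne : ∀ x ∈ (points n).image g, ∀ y ∈ (points n).image g, x ≠ y → pre n x ≠ pre n y := by
    intro x hx y hy hxy hp
    obtain ⟨a, ha, rfl⟩ := Finset.mem_image.1 hx
    obtain ⟨b, hb, rfl⟩ := Finset.mem_image.1 hy
    have := (hN n hn a b).2 hp
    refine hxy (congrArg g ?_)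
    rw [← trunc_of_mem_points ha, ← trunc_of_mem_points hb, trunc_congr this]
  have hp := s.isPlanarOrder h
  have hp' := s.isPlanarOrder h'
  have := des_image (P := (points n).image g) (f := trunc n) s.nested hp hp he
    (fun x hx y hy hxy => (hp.trunc hd (hne x hx y hy (hp.ne hxy))).1 hxy)
    (fun x hx y hy hxy => hp'.trunc hd (hne y hy x hx (hp.ne hxy).symm))
  rw [← this, himg]

theorem liftShift_mul_of_level (f f' : LiftGroup) (h : IsLevel (proj f' : Equiv.Perm Ends)) :
    liftShift (f * f') = liftShift f + liftShift f' := by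
  have hm : proj (f * f') • Cover.root.base = proj f • proj f' • Cover.root.base := by
    rw [map_mul, mul_smul]
  have h1 := smul_order_mem (proj f) (proj f' • Cover.root.base)
  rw [← hm] at h1
  obtain ⟨n, e1, e2⟩ := ((eventually_liftShift_mul f f' Cover.root).and
    (h.eventually_des _ (proj f' • Cover.root.base).order_mem h1)).exists
  rw [e1, e2, zmod_add_self, add_zero]

end

/-! ## Tree automorphisms fix the base point -/

theorem lex_iff_of_split {x y : Ends} {m : ℕ} (h : pre m x = pre m y) (hd : x m ≠ y m) :
    lexOrder x y ↔ x m = false := by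
  rcases hx : x m with _ | _
  · exact iff_of_true (lex_of_split h hx (by rw [hx] at hd; simpa using hd.symm)) rfl
  · have hy : y m = false := by rw [hx] at hd; simpa using hd.symm
    exact iff_of_false (isPlanarOrder_lex.not_symm (lex_of_split h.symm hy hx)) (by simp)

theorem lex_mem_base : lexOrder ∈ baseStratum.orders :=
  baseStratum.isReflectionOf (e := fun _ => False) (fun x => isPlanarOrder_lex.1.irrefl x) id
    fun x y => by simp

theorem deep_one_subset_base : deep 1 ⊆ baseStratum.fam := by
  rintro _ ⟨w, hw, rfl⟩
  exact ⟨w, by rintro rfl; simp at hw, rfl⟩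

theorem common_base_eq_empty {x y : Ends} (h : x 0 ≠ y 0) : common baseStratum.fam x y = ∅ := by
  rw [Set.eq_empty_iff_forall_notMem]
  rintro F ⟨⟨w, hw, rfl⟩, hx, hy⟩
  exact h (agree_of_mem_ball hx hy 0 (List.length_pos_iff.2 hw))

theorem order_base : baseStratum.order = lexOrder := by
  funext x y
  rw [eq_iff_iff]
  by_cases h : x 0 = y 0
  · exact baseStratum.isNormal_order.iff_lex deep_one_subset_base (fun i hi => by
      obtain rfl : i = 0 := by omega
      exact h)
  · obtain ⟨e, e0, he⟩ := (baseStratum.mem_orders lex_mem_base).1 baseStratum.order_mem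
    have := he x y
    rw [common_base_eq_empty h] at this
    tauto

/-- In the base stratum two ends branch at the ball of their longest common initial segment. The
case `m = 0` is separate because the root is not in the family. -/
theorem common_base_subset {x y x' y' : Ends} {m m' : ℕ} (h : pre m x = pre m y)
    (hd' : x' m' ≠ y' m')
    (hc : common baseStratum.fam x y ⊆ common baseStratum.fam x' y') :
    m ≤ m' ∧ pre m x' = pre m x := by
  rcases Nat.eq_zero_or_pos m with rfl | hm
  · exact ⟨Nat.zero_le _, rfl⟩
  have h1 : ball (pre m x) ∈ common baseStratum.fam x y :=
    ⟨deep_one_subset_base (ball_mem_deep (by simp; omega)), mem_ball_pre m x,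
      by rw [h]; exact mem_ball_pre m y⟩
  obtain ⟨-, h2, h3⟩ := hc h1
  refine ⟨?_, by simpa [mem_ball_iff] using h2⟩
  by_contra hlt
  exact hd' (agree_of_mem_ball h2 h3 m' (by simpa using hlt))

/-- Whether a tree automorphism exchanges the two sons of a vertex depends on the vertex only, so
the pulled back order is a twist. The hypothesis `h0` keeps the root out. -/
theorem IsTreeIso.twist_lex {q : Equiv.Perm Ends} (hq : IsTreeIso q) (h0 : ∀ x, q x 0 = x 0) :
    imageOrder q⁻¹ lexOrder ∈ baseStratum.orders := by
  rw [baseStratum.mem_orders lex_mem_base]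
  have hlevel : ∀ {x y : Ends} {n : ℕ}, pre n x = pre n y ↔ pre n (q x) = pre n (q y) := by
    intro x y n
    rw [pre_eq_iff, pre_eq_iff]
    exact hq x y n
  have hsplit : ∀ {x y : Ends} {m : ℕ}, pre m x = pre m y → x m ≠ y m → q x m ≠ q y m := by
    intro x y m h hd he
    have : pre (m + 1) (q x) = pre (m + 1) (q y) := by rw [pre_succ, pre_succ, hlevel.1 h, he]
    exact hd (pre_eq_iff.1 (hlevel.2 this) m (by omega))
  have key : ∀ x y x' y', common baseStratum.fam x y = common baseStratum.fam x' y' →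
      lexOrder x y → lexOrder x' y' → lexOrder (q y) (q x) → lexOrder (q y') (q x') := by
    rintro x y x' y' hc ⟨m, h1, h2, h3⟩ ⟨m', h1', h2', h3'⟩ hl
    rw [← pre_eq_iff] at h1 h1'
    have hd : x m ≠ y m := by rw [h2, h3]; simp
    have hd' : x' m' ≠ y' m' := by rw [h2', h3']; simp
    obtain ⟨k1, k2⟩ := common_base_subset h1 hd' hc.le
    obtain ⟨k3, k4⟩ := common_base_subset h1' hd hc.ge
    obtain rfl : m = m' := le_antisymm k1 k3
    have ey : pre (m + 1) y' = pre (m + 1) y := by rw [pre_succ, pre_succ, ← h1', ← h1, k2, h3, h3']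
    rw [lex_iff_of_split (hlevel.1 h1.symm) (hsplit h1.symm hd.symm)] at hl
    rw [lex_iff_of_split (hlevel.1 h1'.symm) (hsplit h1'.symm hd'.symm), ← hl]
    exact pre_eq_iff.1 (hlevel.1 ey) m (by omega)
  have hempty : ∀ x y, common baseStratum.fam x y = ∅ → lexOrder x y → ¬ lexOrder (q y) (q x) := by
    rintro x y hc ⟨m, h1, h2, h3⟩
    rw [← pre_eq_iff] at h1
    have hm : m = 0 := by
      by_contra hm
      have : ball (pre m x) ∈ common baseStratum.fam x y :=
        ⟨deep_one_subset_base (ball_mem_deep (by simp; omega)), mem_ball_pre m x,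
          by rw [h1]; exact mem_ball_pre m y⟩
      rw [hc] at this
      exact this
    subst hm
    exact isPlanarOrder_lex.not_symm (lex_of_split rfl ((h0 x).trans h2) ((h0 y).trans h3))
  refine ⟨fun A => ∃ x y, common baseStratum.fam x y = A ∧ lexOrder x y ∧ lexOrder (q y) (q x),
    ?_, fun x y => ?_⟩
  · rintro ⟨x, y, h, h', h''⟩
    exact hempty x y h h' h''
  · rw [imageOrder_apply]
    by_cases hxy : x = y
    · subst hxy
      simp [isPlanarOrder_lex.1.irrefl x, isPlanarOrder_lex.1.irrefl (q x)]
    have n1 := isPlanarOrder_lex.not_iff hxy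
    have n2 := isPlanarOrder_lex.not_iff (q.injective.ne hxy)
    by_cases hl : lexOrder x y
    · have e1 : (∃ a b, common baseStratum.fam a b = common baseStratum.fam x y ∧ lexOrder a b ∧
          lexOrder (q b) (q a)) ↔ lexOrder (q y) (q x) :=
        ⟨fun ⟨a, b, h, h', h''⟩ => key a b x y h h' hl h'', fun h => ⟨x, y, rfl, hl, h⟩⟩
      beta_reduce
      rw [e1]
      tauto
    · have hl' := n1.1 hl
      have e1 : (∃ a b, common baseStratum.fam a b = common baseStratum.fam x y ∧ lexOrder a b ∧
          lexOrder (q b) (q a)) ↔ lexOrder (q x) (q y) :=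
        ⟨fun ⟨a, b, h, h', h''⟩ => key a b y x (h.trans (common_comm _ _ _)) h' hl' h'',
          fun h => ⟨y, x, common_comm _ _ _, hl', h⟩⟩
      beta_reduce
      rw [e1]
      tauto

theorem IsTreeIso.image_ball {q : Equiv.Perm Ends} (hq : IsTreeIso q) (w : List Bool) :
    ∃ v : List Bool, v.length = w.length ∧ q '' ball w = ball v := by
  obtain ⟨v, p, hv, -, h⟩ := hq.restrict w
  refine ⟨v, hv, ?_⟩
  ext y
  constructor
  · rintro ⟨_, ⟨x, rfl⟩, rfl⟩
    exact ⟨p x, (h x).symm⟩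
  · rintro ⟨x, rfl⟩
    exact ⟨app w (p⁻¹ x), ⟨_, rfl⟩, by rw [h]; simp⟩

theorem IsTreeIso.smul_base {g : Neretin} (hg : IsTreeIso g) (h0 : ∀ x, (g : Equiv.Perm Ends) x 0 = x 0) :
    g • baseStratum = baseStratum := by
  have hsub : ∀ q : Equiv.Perm Ends, IsTreeIso q → imageFam q baseStratum.fam ⊆ baseStratum.fam := by
    rintro q hq _ ⟨_, ⟨w, hw, rfl⟩, rfl⟩
    obtain ⟨v, hv, h⟩ := hq.image_ball w
    exact ⟨v, by rintro rfl; exact hw (List.length_eq_zero_iff.1 hv.symm), h⟩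
  have hfam : (g • baseStratum).fam = baseStratum.fam := by
    refine Set.Subset.antisymm (hsub _ hg) ?_
    have h1 := Set.image_mono (f := fun F => (g : Equiv.Perm Ends) '' F) (hsub _ hg.inv)
    change imageFam (g : Equiv.Perm Ends) (imageFam (g : Equiv.Perm Ends)⁻¹ _) ⊆ _ at h1
    rwa [← imageFam_mul, mul_inv_cancel, imageFam_one] at h1
  exact Stratum.eq_of_mem hfam (mem_orders_smul.2 (hg.twist_lex h0)) lex_mem_base

/-! ## The conjugate of `α` by `δ` -/

theorem flipWhere_isTreeIso {P : Ends → ℕ → Prop} [∀ x n, Decidable (P x n)]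
    (hP : ∀ x y n, (∀ i < n, x i = y i) → (P x n ↔ P y n)) {q : Equiv.Perm Ends}
    (hq : ∀ x, q x = flipWhere P x) : IsTreeIso q := by
  intro x y n
  rw [hq, hq]
  constructor
  · intro h i hi
    have := hP x y i fun j hj => h j (hj.trans hi)
    simp only [flipWhere, h i hi, this]
  · intro h
    induction n with
    | zero => intro i hi; omega
    | succ n ih =>
      have h1 := ih fun i hi => h i (by omega)
      intro i hi
      rcases Nat.lt_succ_iff_lt_or_eq.1 hi with hi | rfl
      · exact h1 i hi
      · have h2 := h i hi
        have h3 := hP x y i h1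
        simp only [flipWhere, h3] at h2
        split_ifs at h2 <;> simpa using h2

/-- The element `δ α δ⁻¹`. -/
def beta : Neretin := delta * alpha * delta⁻¹

theorem delta_cons (a b : Bool) (y : Ends) : deltaPerm (cons a (cons b y)) =
    if a then cons true (cons true (cons b y))
    else if b then cons true (cons false y) else cons false y := by
  cases a <;> cases b <;> simp [deltaPerm]

/-- Since δ carries the subtree below `00` onto the one below `0`, conjugation moves the exchange at
0ᵏ, k ≥ 2, to the vertex 0ᵏ⁻¹. -/
theorem beta_apply (x : Ends) : (beta : Equiv.Perm Ends) x =
    flipWhere (fun x n => 1 ≤ n ∧ ∀ i < n, x i = false) x := by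
  have key : ∀ z, deltaPerm (alphaPerm z) =
      flipWhere (fun x n => 1 ≤ n ∧ ∀ i < n, x i = false) (deltaPerm z) := by
    intro z
    have fix : ∀ y : Ends, flipWhere (fun x n => 1 ≤ n ∧ ∀ i < n, x i = false) (cons true y) =
        cons true y := by
      intro y
      funext n
      rw [flipWhere, if_neg]
      rintro ⟨hn, h⟩
      simpa using h 0 (by omega)
    obtain ⟨a, z, rfl⟩ : ∃ a z', z = cons a z' := ⟨z 0, tail z, (cons_tail z).symm⟩
    obtain ⟨b, z, rfl⟩ : ∃ a z', z = cons a z' := ⟨z 0, tail z, (cons_tail z).symm⟩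
    rw [alpha_cons, delta_cons, delta_cons]
    cases a
    · cases b
      · funext n
        simp only [Bool.or_self, Bool.false_eq_true, if_false]
        rcases n with _ | n
        · simp [flipWhere]
        · unfold odo flipWhere
          simp only [cons_false_iff, cons_succ]
          simp
      · simp [fix]
    · simp [fix]
  have h := key (deltaPerm⁻¹ x)
  rw [show deltaPerm (deltaPerm⁻¹ x) = x by simp] at h
  exact h

theorem beta_isTreeIso : IsTreeIso (beta : Equiv.Perm Ends) :=
  flipWhere_isTreeIso (P := fun x n => 1 ≤ n ∧ ∀ i < n, x i = false) (fun _ _ _ h =>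
    and_congr_right fun _ => forall₂_congr fun i hi => by rw [h i hi]) beta_apply

theorem beta_zero (x : Ends) : (beta : Equiv.Perm Ends) x 0 = x 0 := by
  rw [beta_apply]; simp [flipWhere]

theorem beta_apply_of_true {x : Ends} {i m : ℕ} (hx : x i = true) (hi : i < m) :
    (beta : Equiv.Perm Ends) x m = x m := by
  rw [beta_apply, flipWhere, if_neg]
  rintro ⟨-, h⟩
  rw [h i hi] at hx
  exact Bool.noConfusion hx

/-- The order of the ends inverted by `β`. -/
def betaOrder : Ends → Ends → Prop := imageOrder (beta : Equiv.Perm Ends)⁻¹ lexOrder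

theorem betaOrder_mem : betaOrder ∈ baseStratum.orders := beta_isTreeIso.twist_lex beta_zero

theorem betaOrder_iff (x y : Ends) :
    betaOrder x y ↔ lexOrder ((beta : Equiv.Perm Ends) x) ((beta : Equiv.Perm Ends) y) :=
  imageOrder_apply _ _ _ _

/-- The end `0 ⋯ 0 1 0 0 0 ⋯` with a `1` at the position `j`. -/
def spike (j : ℕ) : Ends := fun i => decide (i = j)

theorem exists_spike {x : Ends} (h : x ≠ fun _ => false) :
    ∃ j, x j = true ∧ x ∈ ball (pre (j + 1) (spike j)) := by
  classical
  have hex : ∃ n, x n = true := by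
    by_contra hn
    exact h (funext fun n => by simpa using not_exists.1 hn n)
  refine ⟨Nat.find hex, Nat.find_spec hex, ?_⟩
  rw [mem_ball_pre_iff]
  intro i hi
  rcases Nat.lt_succ_iff_lt_or_eq.1 hi with hi | rfl
  · have := Nat.find_min hex hi
    simp only [spike, hi.ne, decide_false]
    simpa using this
  · simpa [spike] using Nat.find_spec hex

/-- `β` does not invert pairs of ends which branch after a letter `1`. -/
theorem betaOrder_agree (j : ℕ) {a b : Ends} (ha : a ∈ ball (pre (j + 1) (spike j)))
    (hb : b ∈ ball (pre (j + 1) (spike j))) : lexOrder a b ↔ betaOrder a b := by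
  rw [betaOrder_iff]
  by_cases hab : a = b
  · subst hab
    exact iff_of_false (isPlanarOrder_lex.1.irrefl _) (isPlanarOrder_lex.1.irrefl _)
  obtain ⟨m, hm, hd⟩ := exists_split hab
  rw [mem_ball_pre_iff] at ha hb
  have haj : a j = true := by rw [ha j (by omega)]; simp [spike]
  have hbj : b j = true := by rw [hb j (by omega)]; simp [spike]
  have hjm : j < m := by
    by_contra hlt
    exact hd ((ha m (by omega)).trans (hb m (by omega)).symm)
  have e1 := beta_apply_of_true haj hjm
  have e2 := beta_apply_of_true hbj hjm
  have e3 : pre m ((beta : Equiv.Perm Ends) a) = pre m ((beta : Equiv.Perm Ends) b) :=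
    pre_eq_iff.2 ((beta_isTreeIso a b m).1 (pre_eq_iff.1 hm))
  rw [lex_iff_of_split hm hd, lex_iff_of_split e3 (by rw [e1, e2]; exact hd), e1]

/-! ### The inversions of β seen by the sample and by its translate under δ. -/

theorem delta_of_head_true {x : Ends} (h : x 0 = true) : deltaPerm x 0 = true := by
  simp [deltaPerm, h]

theorem delta_eq_tail {x : Ends} (h : x 0 = false) (h' : x 1 = false) : deltaPerm x = tail x := by
  simp [deltaPerm, h, h']

theorem eq_tail_of_delta {x : Ends} (h : deltaPerm x 0 = false) : deltaPerm x = tail x := by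
  rcases h0 : x 0 with _ | _
  · rcases h1 : x 1 with _ | _
    · exact delta_eq_tail h0 h1
    · simp [deltaPerm, h0, h1] at h
  · simp [delta_of_head_true h0] at h

theorem spike_mem_points {j n : ℕ} (h : j < n) : spike j ∈ points n :=
  mem_points.2 fun i hi => by simp [spike]; omega

section

open scoped Classical

/-- All inversions of β take place on the branch 0ᵏ, k ≥ 1. As far as these are concerned, the
translate by δ lacks precisely an end in the ball of 0ⁿ⁻¹1. Restoring such an end creates one
inverted gap; the remaining differences between the samples lie in vertices on which β inverts
nothing. -/
theorem des_delta {n : ℕ} (hn : 2 ≤ n) :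
    des (points n) lexOrder betaOrder + des ((points n).image deltaPerm) lexOrder betaOrder = 1 := by
  obtain ⟨e, -, he⟩ := (baseStratum.mem_orders lex_mem_base).1 betaOrder_mem
  have hp := baseStratum.isPlanarOrder lex_mem_base
  set P := points n with hP
  set Q := P.image deltaPerm with hQ
  set z : Ends := fun _ => false with hz
  have hfam : ∀ j, ball (pre (j + 1) (spike j)) ∈ baseStratum.fam := fun j =>
    deep_one_subset_base (ball_mem_deep (by simp))
  have hzP : z ∈ P := mem_points.2 fun _ _ => rfl
  have hzQ : z ∈ Q := Finset.mem_image.2 ⟨z, hzP, by rw [delta_eq_tail rfl rfl]; rfl⟩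
  have hQtail : ∀ x ∈ Q, x 0 = false → ∀ i, n - 1 ≤ i → x i = false := by
    intro x hx h0 i hi
    obtain ⟨p, hp, rfl⟩ := Finset.mem_image.1 hx
    rw [eq_tail_of_delta h0]
    exact mem_points.1 hp (i + 1) (by omega)
  -- An end of `Q` beginning with `0` is the tail of a sampled end, hence vanishes already from `n -
  -- 1` on.
  have hspQ : ∀ x ∈ Q, x ∉ ball (pre n (spike (n - 1))) := by
    intro x hx hb
    rw [mem_ball_pre_iff] at hb
    have h0 : x 0 = false := by rw [hb 0 (by omega)]; simp [spike]; omega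
    have := hb (n - 1) (by omega)
    rw [hQtail x hx h0 _ le_rfl] at this
    simp [spike] at this
  have hspP : spike (n - 1) ∈ P := spike_mem_points (by omega)
  have hsp : spike (n - 1) ∉ Q := fun h => hspQ _ h (mem_ball_pre _ _)
  have hnear : IsNearest baseStratum.fam (spike (n - 1)) Q z := by
    refine ⟨hzQ, ?_⟩
    rintro x hx _ ⟨⟨w, hw, rfl⟩, h1, h2⟩
    refine ⟨⟨w, hw, rfl⟩, h1, ?_⟩
    rw [mem_ball_iff] at h1
    rcases lt_or_ge w.length n with hl | hl
    · rw [mem_ball_iff, ← h1, length_pre, pre_eq_iff]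
      intro i hi
      simp [spike, hz]; omega
    · refine absurd ?_ (hspQ x hx)
      rw [mem_ball_pre_iff]
      intro i hi
      rw [mem_ball_iff] at h2
      exact pre_eq_iff.1 (h2.trans h1.symm) i (by omega)
  -- The two ends branch at 0ⁿ⁻¹, whose sons β exchanges. The bound 2 ≤ n makes this vertex
  -- different from the root.
  have hdis : ¬ (lexOrder (spike (n - 1)) z ↔ betaOrder (spike (n - 1)) z) := by
    have hpre : pre (n - 1) (spike (n - 1)) = pre (n - 1) z :=
      pre_eq_iff.2 fun i hi => by simp [spike, hz]; omega
    have hd : spike (n - 1) (n - 1) ≠ z (n - 1) := by simp [spike, hz]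
    have e1 : (beta : Equiv.Perm Ends) (spike (n - 1)) (n - 1) = false := by
      rw [beta_apply, flipWhere, if_pos]
      · simp [spike]
      · exact ⟨by omega, fun i hi => by simp [spike]; omega⟩
    have e2 : (beta : Equiv.Perm Ends) z (n - 1) = true := by
      rw [beta_apply, flipWhere, if_pos]
      · simp [hz]
      · exact ⟨by omega, fun i hi => rfl⟩
    rw [betaOrder_iff, lex_iff_of_split hpre hd, lex_iff_of_split
      (pre_eq_iff.2 ((beta_isTreeIso _ _ _).1 (pre_eq_iff.1 hpre))) (by rw [e1, e2]; simp), e1]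
    simp [spike]
  have h1 := des_insert baseStratum.nested hp he hsp hnear
  rw [if_neg hdis] at h1
  have h2 : des (P.erase z ∪ insert (spike (n - 1)) Q) lexOrder betaOrder =
      des (insert (spike (n - 1)) Q) lexOrder betaOrder := by
    refine baseStratum.des_union_of_agree lex_mem_base betaOrder_mem fun x hx => ?_
    obtain ⟨hxz, hxP⟩ := Finset.mem_erase.1 hx
    obtain ⟨j, hj, hxj⟩ := exists_spike hxz
    have hjn : j < n := by
      by_contra h
      rw [mem_points.1 hxP j (not_lt.1 h)] at hj
      exact Bool.noConfusion hj
    refine ⟨_, hfam j, hxj, ?_, fun a ha b hb => betaOrder_agree j ha hb⟩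
    rcases Nat.eq_zero_or_pos j with rfl | hj0
    · refine ⟨deltaPerm (spike 0), Finset.mem_insert_of_mem (Finset.mem_image_of_mem _
        (spike_mem_points (by omega))), ?_⟩
      rw [mem_ball_pre_iff]
      intro i hi
      obtain rfl : i = 0 := by omega
      rw [delta_of_head_true] <;> simp [spike]
    · rcases Nat.lt_or_ge (j + 1) n with h | h
      · refine ⟨spike j, Finset.mem_insert_of_mem (Finset.mem_image.2 ⟨spike (j + 1),
          spike_mem_points h, ?_⟩), mem_ball_pre _ _⟩
        rw [delta_eq_tail (by simp [spike]) (by simp [spike]; omega)]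
        funext i
        simp [tail, spike]
      · obtain rfl : j = n - 1 := by omega
        exact ⟨_, Finset.mem_insert_self _ _, mem_ball_pre _ _⟩
  have h3 : des (Q.erase z ∪ P) lexOrder betaOrder = des P lexOrder betaOrder := by
    refine baseStratum.des_union_of_agree lex_mem_base betaOrder_mem fun x hx => ?_
    obtain ⟨hxz, hxQ⟩ := Finset.mem_erase.1 hx
    obtain ⟨j, hj, hxj⟩ := exists_spike hxz
    have hjn : j < n := by
      by_contra h
      have h0 : x 0 = false := by
        rw [mem_ball_pre_iff.1 hxj 0 (by omega)]; simp [spike]; omega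
      rw [hQtail x hxQ h0 j (by omega)] at hj
      exact Bool.noConfusion hj
    exact ⟨_, hfam j, hxj, ⟨spike j, spike_mem_points hjn, mem_ball_pre _ _⟩,
      fun a ha b hb => betaOrder_agree j ha hb⟩
  -- Both enlargements give the union of the samples; only `z` had to be kept apart, as it lies in
  -- no ball of a spike.
  have h4 : P.erase z ∪ insert (spike (n - 1)) Q = Q.erase z ∪ P := by
    ext x
    simp only [Finset.mem_union, Finset.mem_erase, Finset.mem_insert]
    by_cases hx : x = z
    · subst hx; tauto
    · by_cases hx' : x = spike (n - 1)
      · subst hx'; tauto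
      · tauto
  rw [← h3, ← h4, h2, h1]
  linear_combination zmod_add_self (des Q lexOrder betaOrder)

end

/-! ## The value of the stable length on the relation -/

theorem tauOne_isLevel : IsLevel (tauOne : Equiv.Perm Ends) := by
  have key : ∀ n, 3 ≤ n → ∀ x y, pre n x = pre n y → pre n (tauOnePerm x) = pre n (tauOnePerm y) := by
    intro n hn x y h
    rw [pre_eq_iff] at h ⊢
    intro i hi
    simp only [tauOnePerm, Function.Involutive.coe_toPerm, flipWhere, h i hi, h 0 (by omega),
      h 2 (by omega)]
  refine ⟨3, fun n hn x y => ⟨key n hn x y, fun h => ?_⟩⟩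
  have := key n hn _ _ h
  have inv : ∀ x, tauOnePerm ((tauOne : Equiv.Perm Ends) x) = x := fun x =>
    tauOnePerm.left_inv x
  rwa [inv, inv] at this

theorem sigma_isLevel : IsLevel (sigma : Equiv.Perm Ends) := by
  have key : ∀ n, 3 ≤ n → ∀ x y, pre n x = pre n y → pre n (sigmaPerm x) = pre n (sigmaPerm y) := by
    intro n hn x y h
    rw [pre_eq_iff] at h ⊢
    intro i hi
    simp only [sigmaPerm, Function.Involutive.coe_toPerm, flipWhere, h i hi, h 0 (by omega)]
  refine ⟨3, fun n hn x y => ⟨key n hn x y, fun h => ?_⟩⟩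
  have := key n hn _ _ h
  have inv : ∀ x, sigmaPerm ((sigma : Equiv.Perm Ends) x) = x := fun x =>
    sigmaPerm.left_inv x
  rwa [inv, inv] at this

theorem liftShift_inv_of_level (f : LiftGroup) (h : IsLevel (proj f : Equiv.Perm Ends)) :
    liftShift f⁻¹ = liftShift f := by
  have h1 := liftShift_mul_of_level f⁻¹ f h
  have h2 := liftShift_ker_mul 1 1 (map_one _)
  rw [one_mul, left_eq_add] at h2
  rw [inv_mul_cancel, h2] at h1
  linear_combination -h1 - zmod_add_self (liftShift f)

/-- The evaluation takes place at the preimage of the root under `d`: then `d` leads to the base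
stratum, which β fixes, and the two counts are those of `des_delta`. -/
theorem liftShift_beta_delta (f d : LiftGroup) (hf : proj f = beta) (hd : proj d = delta) :
    liftShift (f * d) = liftShift f + liftShift d + 1 := by
  have hb : (d⁻¹.1.2 Cover.root).base = delta⁻¹ • baseStratum := by
    rw [LiftGroup.base_eq, map_inv, hd]; rfl
  obtain ⟨n, h1, h2⟩ := ((eventually_liftShift_mul f d (d⁻¹.1.2 Cover.root)).and
    (eventually_ge 2)).exists
  have e1 : proj d • (d⁻¹.1.2 Cover.root).base = baseStratum := by
    rw [hb, hd, smul_inv_smul]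
  have e2 : proj (f * d) • (d⁻¹.1.2 Cover.root).base = baseStratum := by
    rw [map_mul, mul_smul, e1, hf, beta_isTreeIso.smul_base beta_zero]
  rw [h1, e1, e2, order_base, hd, hf]
  congr 1
  exact des_delta h2

/-- Multiplied by `d * a` on the right, the relation becomes `t * s * t⁻¹ * s⁻¹ * a * d`, in which
every factor but `d` preserves levels. The shifts of `t` and `s` occur twice, those of `a` and `d`
cancel between the two sides, and the 1 of `liftShift_beta_delta` is left. -/
theorem liftShift_relation (t s a d : LiftGroup) (ht : proj t = tauOne) (hs : proj s = sigma)
    (ha : proj a = alpha) (hd : proj d = delta) : liftShift (⁅t, s⁆ * ⁅a, d⁆) = 1 := by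
  have hτ : IsLevel (proj t : Equiv.Perm Ends) := ht ▸ tauOne_isLevel
  have hσ : IsLevel (proj s : Equiv.Perm Ends) := hs ▸ sigma_isLevel
  have hα : IsLevel (proj a : Equiv.Perm Ends) := ha ▸ alphaPerm_isTreeIso.isLevel
  have hτ' : IsLevel (proj t⁻¹ : Equiv.Perm Ends) := by rw [map_inv]; exact hτ.inv
  have hσ' : IsLevel (proj s⁻¹ : Equiv.Perm Ends) := by rw [map_inv]; exact hσ.inv
  have hker : proj (⁅t, s⁆ * ⁅a, d⁆) = 1 := by
    rw [map_mul, map_commutatorElement, map_commutatorElement, ht, hs, ha, hd, relation]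
  have hbeta : proj (t * s * t⁻¹ * s⁻¹ * a) = beta := by
    have h := relation
    rw [commutatorElement_def, commutatorElement_def, mul_eq_one_iff_eq_inv] at h
    simp only [map_mul, map_inv, ht, hs, ha]
    rw [h, beta]
    group
  have h1 := liftShift_beta_delta _ d hbeta hd
  rw [liftShift_mul_of_level _ a hα, liftShift_mul_of_level _ _ hσ', liftShift_mul_of_level _ _ hτ',
    liftShift_mul_of_level _ _ hσ, liftShift_inv_of_level t hτ, liftShift_inv_of_level s hσ] at h1
  have h2 := liftShift_ker_mul _ (d * a) hker
  have h3 : ⁅t, s⁆ * ⁅a, d⁆ * (d * a) = t * s * t⁻¹ * s⁻¹ * a * d := by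
    rw [commutatorElement_def, commutatorElement_def]; group
  rw [h3, h1, liftShift_mul_of_level d a hα] at h2
  linear_combination -h2 + zmod_add_self (liftShift t) + zmod_add_self (liftShift s)

/-! ## The orders of the chambers -/

variable {n : ℕ}

/-- The initial segment of length `n` as a vector. -/
def preVector (n : ℕ) (x : Ends) : List.Vector Bool n := ⟨pre n x, length_pre n x⟩

/-- The position of the ball of depth `n` which contains `x`. -/
def pos (σ : Fin (2 ^ n) ≃ List.Vector Bool n) (x : Ends) : Fin (2 ^ n) := σ.symm (preVector n x)

theorem pos_eq_pos {σ : Fin (2 ^ n) ≃ List.Vector Bool n} {x y : Ends} :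
    pos σ x = pos σ y ↔ pre n x = pre n y :=
  σ.symm.injective.eq_iff.trans ⟨fun h => congrArg Subtype.val h, fun h => Subtype.ext h⟩

theorem mem_ball_iff_pos {σ : Fin (2 ^ n) ≃ List.Vector Bool n} {k : Fin (2 ^ n)} {x : Ends} :
    x ∈ ball (σ k).1 ↔ pos σ x = k := by
  rw [pos, Equiv.symm_apply_eq, mem_ball_iff, (σ k).2]
  exact ⟨fun h => Subtype.ext h, fun h => congrArg Subtype.val h⟩

theorem pos_eq_of_mem_ball {σ : Fin (2 ^ n) ≃ List.Vector Bool n} {w : List Bool}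
    (hw : n ≤ w.length) {x y : Ends} (hx : x ∈ ball w) (hy : y ∈ ball w) : pos σ x = pos σ y :=
  pos_eq_pos.2 (pre_eq_iff.2 fun i hi => agree_of_mem_ball hx hy i (hi.trans_le hw))

/-- The order of the ends in which the balls of depth `n` are ordered by `σ`, and each of them is
ordered lexicographically. -/
def chamberOrder (σ : Fin (2 ^ n) ≃ List.Vector Bool n) (x y : Ends) : Prop :=
  pos σ x < pos σ y ∨ (pos σ x = pos σ y ∧ lexOrder x y)

theorem lex_trichotomous {x y : Ends} (h : ¬ lexOrder x y) (h' : ¬ lexOrder y x) : x = y :=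
  isPlanarOrder_lex.1.trichotomous _ _ h h'

theorem isStrictTotalOrder_chamberOrder (σ : Fin (2 ^ n) ≃ List.Vector Bool n) :
    IsStrictTotalOrder Ends (chamberOrder σ) where
  trichotomous x y h h' := by
    unfold chamberOrder at h h'
    push Not at h h'
    have hp := le_antisymm h'.1 h.1
    exact lex_trichotomous (h.2 hp) (h'.2 hp.symm)
  irrefl x h := by
    rcases h with h | h
    · exact lt_irrefl _ h
    · exact isPlanarOrder_lex.1.irrefl x h.2
  trans x y z h h' := by
    rcases h with h | ⟨h1, h2⟩ <;> rcases h' with h' | ⟨h1', h2'⟩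
    · exact Or.inl (h.trans h')
    · exact Or.inl (h1' ▸ h)
    · exact Or.inl (h1 ▸ h')
    · exact Or.inr ⟨h1.trans h1', isPlanarOrder_lex.1.trans _ _ _ h2 h2'⟩

theorem chamberOrder.pos_le {σ : Fin (2 ^ n) ≃ List.Vector Bool n} {x y : Ends}
    (h : chamberOrder σ x y) : pos σ x ≤ pos σ y := by
  rcases h with h | h
  · exact h.le
  · exact h.1.le

theorem chamberOrder_convex (σ : Fin (2 ^ n) ≃ List.Vector Bool n) {F : Set Ends} (hF : F ∈ deep n) :
    ∀ x ∈ F, ∀ y ∈ F, ∀ z, chamberOrder σ x z → chamberOrder σ z y → z ∈ F := by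
  obtain ⟨w, hw, rfl⟩ := hF
  intro x hx y hy z hxz hzy
  have h1 := pos_eq_of_mem_ball (σ := σ) hw hx hy
  have h2 : pos σ x = pos σ z := le_antisymm hxz.pos_le (h1 ▸ hzy.pos_le)
  have h3 : pos σ z = pos σ y := h2.symm.trans h1
  have l1 : lexOrder x z := by
    rcases hxz with h | h
    · exact absurd h2 h.ne
    · exact h.2
  have l2 : lexOrder z y := by
    rcases hzy with h | h
    · exact absurd h3 h.ne
    · exact h.2
  rcases eq_or_ne w [] with rfl | hne
  · exact ⟨z, rfl⟩
  · exact isPlanarOrder_lex.2 _ ⟨w, hne, rfl⟩ x hx y hy z l1 l2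

theorem isPlanarOrder_chamberOrder (σ : Fin (2 ^ n) ≃ List.Vector Bool n) :
    IsPlanarOrder (deep n) (chamberOrder σ) :=
  ⟨isStrictTotalOrder_chamberOrder σ, fun _ hF => chamberOrder_convex σ hF⟩

theorem deep_subset_base (hn : 1 ≤ n) : deep n ⊆ baseStratum.fam :=
  (deep_mono hn).trans deep_one_subset_base

theorem nested_deep (hn : 1 ≤ n) : Nested (deep n) := fun F hF G hG =>
  baseStratum.nested F (deep_subset_base hn hF) G (deep_subset_base hn hG)

theorem range_ball_diff_deep (n : ℕ) : (Set.range ball \ deep n).Finite := by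
  refine ((finite_words n).image ball).subset ?_
  rintro _ ⟨⟨w, rfl⟩, h⟩
  exact ⟨w, by by_contra hw; exact h (ball_mem_deep (not_lt.1 hw)), rfl⟩

theorem deep_subset_range (n : ℕ) : deep n ⊆ Set.range ball := by
  rintro _ ⟨w, -, rfl⟩; exact ⟨w, rfl⟩

/-- The chamber indexed by `σ`. -/
def chamber (hn : 1 ≤ n) (σ : Fin (2 ^ n) ≃ List.Vector Bool n) : Stratum :=
  Stratum.ofOrder (deep n) (chamberOrder σ) (fun F hF => baseStratum.proper F (deep_subset_base hn hF))
    (nested_deep hn) ((range_ball_diff_deep n).subset (by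
      rintro F (⟨h1, h2⟩ | h)
      · exact absurd (deep_subset_range n h1) h2
      · exact h)) (isPlanarOrder_chamberOrder σ)

theorem chamberOrder_mem (hn : 1 ≤ n) (σ : Fin (2 ^ n) ≃ List.Vector Bool n) :
    chamberOrder σ ∈ (chamber hn σ).orders := Stratum.mem_orders_ofOrder _ _ _ _

theorem isChamber_chamber (hn : 1 ≤ n) (σ : Fin (2 ^ n) ≃ List.Vector Bool n) :
    IsChamber σ (chamber hn σ) := by
  refine ⟨rfl, fun r hr i j hij x hx y hy => ?_⟩
  obtain ⟨e, e0, he⟩ := ((chamber hn σ).mem_orders (chamberOrder_mem hn σ)).1 hr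
  rw [mem_ball_iff_pos] at hx hy
  subst hx hy
  -- Ends of different balls of depth `n` branch at the root of a chamber, so no twist can invert
  -- them.
  have hc : common (chamber hn σ).fam x y = ∅ := by
    rw [Set.eq_empty_iff_forall_notMem]
    rintro F ⟨⟨w, hw, rfl⟩, h1, h2⟩
    exact hij.ne (pos_eq_of_mem_ball hw h1 h2)
  have := he x y
  rw [hc] at this
  exact this.2 (Or.inr ⟨e0, Or.inl hij⟩)

theorem IsNormal.eq_chamberOrder {s : Stratum} {r : Ends → Ends → Prop} (h : IsNormal s r)
    (hs : deep n ⊆ s.fam) {σ : Fin (2 ^ n) ≃ List.Vector Bool n}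
    (hr : ∀ x y, pos σ x < pos σ y → r x y) : r = chamberOrder σ := by
  have hp := s.isPlanarOrder h.1
  funext x y
  rw [eq_iff_iff]
  rcases lt_trichotomy (pos σ x) (pos σ y) with hlt | heq | hlt
  · exact iff_of_true (hr x y hlt) (Or.inl hlt)
  · rw [h.iff_lex hs (pre_eq_iff.1 (pos_eq_pos.1 heq)), chamberOrder]
    simp [heq]
  · refine iff_of_false (hp.not_symm (hr y x hlt)) fun h => ?_
    exact absurd h.pos_le (not_le.2 hlt)

/-- On a chamber nothing is left to choice: the order between balls is prescribed by `σ`, and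
normality makes it lexicographic inside them. -/
theorem IsChamber.order_eq {σ : Fin (2 ^ n) ≃ List.Vector Bool n} {s : Stratum}
    (h : IsChamber σ s) : s.order = chamberOrder σ :=
  s.isNormal_order.eq_chamberOrder h.1.ge fun x y hxy =>
    h.2 _ s.order_mem _ _ hxy x (mem_ball_iff_pos.2 rfl) y (mem_ball_iff_pos.2 rfl)

/-! ## Walls -/

/-- The set of ends below the vertex of the wall of the chamber `σ` which corresponds to `T`. -/
def wallSet (σ : Fin (2 ^ n) ≃ List.Vector Bool n) (T : QInterval (2 ^ n)) : Set Ends :=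
  {x | T.lo ≤ pos σ x ∧ pos σ x ≤ T.hi}

theorem wallSet_eq (σ : Fin (2 ^ n) ≃ List.Vector Bool n) (T : QInterval (2 ^ n)) :
    wallSet σ T = ⋃ k : {k : Fin (2 ^ n) // T.lo ≤ k ∧ k ≤ T.hi}, ball (σ k).1 := by
  ext x
  simp only [wallSet, Set.mem_ofPred_eq, Set.mem_iUnion, mem_ball_iff_pos]
  exact ⟨fun h => ⟨⟨_, h⟩, rfl⟩, fun ⟨k, hk⟩ => hk ▸ k.2⟩

theorem isClopen_wallSet (σ : Fin (2 ^ n) ≃ List.Vector Bool n) (T : QInterval (2 ^ n)) :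
    IsClopen (wallSet σ T) := by
  rw [wallSet_eq]
  exact isClopen_iUnion_of_finite fun k => isClopen_ball _

theorem exists_pos (σ : Fin (2 ^ n) ≃ List.Vector Bool n) (k : Fin (2 ^ n)) : ∃ x, pos σ x = k := by
  obtain ⟨x, hx⟩ := ball_nonempty (σ k).1
  exact ⟨x, mem_ball_iff_pos.1 hx⟩

theorem wallSet_ne_univ (σ : Fin (2 ^ n) ≃ List.Vector Bool n) (T : QInterval (2 ^ n)) :
    wallSet σ T ≠ Set.univ := by
  intro h
  have h1 : ∀ k : Fin (2 ^ n), T.lo ≤ k ∧ k ≤ T.hi := by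
    intro k
    obtain ⟨x, rfl⟩ := exists_pos σ k
    have : x ∈ wallSet σ T := h ▸ Set.mem_univ x
    exact this
  have h2 := T.hi_lt
  have h3 := T.lo_lt_hi
  have h4 := h1 ⟨0, by omega⟩
  have h5 := h1 ⟨2 ^ n - 1, by omega⟩
  dsimp only at h4 h5
  exact T.proper ⟨by omega, by omega⟩

theorem wallSet_nonempty (σ : Fin (2 ^ n) ≃ List.Vector Bool n) (T : QInterval (2 ^ n)) :
    (wallSet σ T).Nonempty := by
  have h2 := T.hi_lt
  have h3 := T.lo_lt_hi
  obtain ⟨x, hx⟩ := exists_pos σ ⟨T.lo, by omega⟩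
  exact ⟨x, by rw [wallSet, Set.mem_ofPred_eq, hx]; exact ⟨le_rfl, h3.le⟩⟩

theorem wallSet_ball (σ : Fin (2 ^ n) ≃ List.Vector Bool n) (T : QInterval (2 ^ n)) {F : Set Ends}
    (hF : F ∈ deep n) : F ⊆ wallSet σ T ∨ Disjoint F (wallSet σ T) := by
  obtain ⟨w, hw, rfl⟩ := hF
  by_cases h : Disjoint (ball w) (wallSet σ T)
  · exact Or.inr h
  · obtain ⟨x, hx, hx'⟩ := Set.not_disjoint_iff.1 h
    refine Or.inl fun y hy => ?_
    rw [wallSet, Set.mem_ofPred_eq, ← pos_eq_of_mem_ball hw hx hy]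
    exact hx'

theorem nested_wall (hn : 1 ≤ n) (σ : Fin (2 ^ n) ≃ List.Vector Bool n) (T : QInterval (2 ^ n)) :
    Nested (deep n ∪ {wallSet σ T}) := by
  rintro F (hF | rfl) G (hG | rfl)
  · exact nested_deep hn F hF G hG
  · rcases wallSet_ball σ T hF with h | h
    · exact Or.inl h
    · exact Or.inr (Or.inr h)
  · rcases wallSet_ball σ T hG with h | h
    · exact Or.inr (Or.inl h)
    · exact Or.inr (Or.inr h.symm)
  · exact Or.inl subset_rfl

theorem isPlanarOrder_wall (σ : Fin (2 ^ n) ≃ List.Vector Bool n) (T : QInterval (2 ^ n)) :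
    IsPlanarOrder (deep n ∪ {wallSet σ T}) (chamberOrder σ) := by
  refine ⟨isStrictTotalOrder_chamberOrder σ, ?_⟩
  rintro F (hF | rfl)
  · exact chamberOrder_convex σ hF
  · intro x hx y hy z hxz hzy
    have h1 := hxz.pos_le
    have h2 := hzy.pos_le
    exact ⟨hx.1.trans h1, le_trans (Fin.le_def.1 h2) hy.2⟩

/-- The wall of the chamber `σ` which corresponds to `T`. -/
def wall (hn : 1 ≤ n) (σ : Fin (2 ^ n) ≃ List.Vector Bool n) (T : QInterval (2 ^ n)) : Stratum :=
  Stratum.ofOrder (deep n ∪ {wallSet σ T}) (chamberOrder σ) (by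
      rintro F (hF | rfl)
      · exact baseStratum.proper F (deep_subset_base hn hF)
      · exact ⟨isClopen_wallSet σ T, wallSet_nonempty σ T, wallSet_ne_univ σ T⟩)
    (nested_wall hn σ T) (((range_ball_diff_deep n).union (Set.finite_singleton (wallSet σ T))).subset
      (by
        rintro F (⟨h1 | h1, h2⟩ | ⟨h1, h2⟩)
        · exact absurd (deep_subset_range n h1) h2
        · exact Or.inr h1
        · exact Or.inl ⟨h1, fun h => h2 (Or.inl h)⟩)) (isPlanarOrder_wall σ T)

theorem isWall_wall (hn : 1 ≤ n) (σ : Fin (2 ^ n) ≃ List.Vector Bool n) (T : QInterval (2 ^ n)) :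
    IsWall σ T (wall hn σ T) := by
  rw [IsWall, ← wallSet_eq]; rfl

theorem chamberOrder_mem_wall (hn : 1 ≤ n) (σ : Fin (2 ^ n) ≃ List.Vector Bool n)
    (T : QInterval (2 ^ n)) : chamberOrder σ ∈ (wall hn σ T).orders :=
  Stratum.mem_orders_ofOrder _ _ _ _

theorem pos_reversal (σ : Fin (2 ^ n) ≃ List.Vector Bool n) (T : QInterval (2 ^ n)) (x : Ends) :
    pos ((reversal T).trans σ) x = reversal T (pos σ x) := rfl

theorem val_reversal {m : ℕ} (T : QInterval m) (k : Fin m) :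
    (reversal T k : ℕ) = if T.lo ≤ k ∧ k ≤ T.hi then T.lo + T.hi - k else k := by
  change ((if h : T.lo ≤ (k : ℕ) ∧ (k : ℕ) ≤ T.hi then
    (⟨T.lo + T.hi - k, by have := T.hi_lt; omega⟩ : Fin m) else k : Fin m) : ℕ) = _
  split_ifs <;> rfl

theorem reversal_lt_iff {m : ℕ} (T : QInterval m) {i j : Fin m} (h : i ≠ j) :
    reversal T i < reversal T j ↔
      ((T.lo ≤ i ∧ i ≤ T.hi) ∧ (T.lo ≤ j ∧ j ≤ T.hi) ∧ j < i) ∨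
      (¬ ((T.lo ≤ i ∧ i ≤ T.hi) ∧ (T.lo ≤ j ∧ j ≤ T.hi)) ∧ i < j) := by
  have h' : (i : ℕ) ≠ j := fun h' => h (Fin.ext h')
  rw [Fin.lt_def, Fin.lt_def, Fin.lt_def, val_reversal, val_reversal]
  split_ifs <;> omega

/-- Crossing the wall inverts the pairs of ends below its vertex which do not lie in the same ball. -/
theorem twistBy_reversal (σ : Fin (2 ^ n) ≃ List.Vector Bool n) (T : QInterval (2 ^ n))
    {fam : Set (Set Ends)} (hd : deep n ⊆ fam) (hT : wallSet σ T ∈ fam) :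
    TwistBy fam (fun A => wallSet σ T ∈ A ∧ ∀ G ∈ A, G ∉ deep n) (chamberOrder σ)
      (chamberOrder ((reversal T).trans σ)) := by
  intro x y
  -- The clause about deep balls is needed because both chamber orders stay lexicographic inside
  -- each ball of depth `n`.
  have he : (wallSet σ T ∈ common fam x y ∧ ∀ G ∈ common fam x y, G ∉ deep n) ↔
      x ∈ wallSet σ T ∧ y ∈ wallSet σ T ∧ pos σ x ≠ pos σ y := by
    constructor
    · rintro ⟨⟨-, h1, h2⟩, h3⟩
      refine ⟨h1, h2, fun h => h3 (ball (pre n x)) ⟨hd (ball_mem_deep (by simp)), mem_ball_pre n x,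
        by rw [pos_eq_pos.1 h]; exact mem_ball_pre n y⟩ (ball_mem_deep (by simp))⟩
    · rintro ⟨h1, h2, h3⟩
      refine ⟨⟨hT, h1, h2⟩, ?_⟩
      rintro _ ⟨-, h4, h5⟩ ⟨w, hw, rfl⟩
      exact h3 (pos_eq_of_mem_ball hw h4 h5)
  beta_reduce
  rw [he, chamberOrder, chamberOrder, chamberOrder, pos_reversal, pos_reversal,
    (reversal T).injective.eq_iff]
  by_cases hp : pos σ x = pos σ y
  · simp [hp]
  · rw [reversal_lt_iff T hp]
    have hp' : pos σ y ≠ pos σ x := Ne.symm hp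
    simp only [hp, hp', wallSet, Set.mem_ofPred_eq, false_and, or_false]
    tauto

theorem chamberOrder_reversal_mem {s : Stratum} (hd : deep n ⊆ s.fam)
    {σ : Fin (2 ^ n) ≃ List.Vector Bool n} (h : chamberOrder σ ∈ s.orders) {T : QInterval (2 ^ n)}
    (hT : wallSet σ T ∈ s.fam) : chamberOrder ((reversal T).trans σ) ∈ s.orders :=
  (s.mem_orders h).2 ⟨_, by simp, twistBy_reversal σ T hd hT⟩

/-! ## The cocycle on a pair of adjacent chambers -/

theorem gapSum_range (e : ℕ → ℕ → ZMod 2) (m : ℕ) :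
    gapSum e (List.range m) = ∑ i ∈ Finset.range (m - 1), e i (i + 1) := by
  induction m with
  | zero => simp
  | succ m ih =>
    cases m with
    | zero => simp [List.range_succ]
    | succ m =>
      have h1 : List.range (m + 2) = List.range m ++ m :: [m + 1] := by
        rw [List.range_succ, List.range_succ]; simp
      rw [h1, gapSum_append, ← List.range_succ, ih]
      simp [Finset.sum_range_succ]

/-- The point of `points n` at a given position. -/
def pointAt (σ : Fin (2 ^ n) ≃ List.Vector Bool n) (k : ℕ) : Ends :=
  if h : k < 2 ^ n then app (σ ⟨k, h⟩).1 fun _ => false else fun _ => false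

theorem app_pre_zero (n : ℕ) (x : Ends) : app (pre n x) (fun _ => false) = trunc n x := by
  induction n generalizing x with
  | zero => rfl
  | succ n ih =>
    rw [pre_succ', app_cons, ih]
    funext i
    cases i <;> simp [trunc, tail]

theorem pos_pointAt (σ : Fin (2 ^ n) ≃ List.Vector Bool n) {k : ℕ} (h : k < 2 ^ n) :
    pos σ (pointAt σ k) = ⟨k, h⟩ := by
  rw [← mem_ball_iff_pos, pointAt, dif_pos h]
  exact ⟨_, rfl⟩

theorem pointAt_pos (σ : Fin (2 ^ n) ≃ List.Vector Bool n) (x : Ends) :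
    pointAt σ (pos σ x) = trunc n x := by
  rw [pointAt, dif_pos (pos σ x).2, ← app_pre_zero, Fin.eta, pos, Equiv.apply_symm_apply]
  rfl

theorem mem_map_pointAt (σ : Fin (2 ^ n) ≃ List.Vector Bool n) (x : Ends) :
    x ∈ (List.range (2 ^ n)).map (pointAt σ) ↔ x ∈ points n := by
  rw [List.mem_map]
  constructor
  · rintro ⟨k, hk, rfl⟩
    rw [List.mem_range] at hk
    obtain ⟨x, hx⟩ := exists_pos σ ⟨k, hk⟩
    have : pointAt σ k = trunc n x := by rw [← pointAt_pos σ, hx]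
    rw [this]
    exact trunc_mem_points n x
  · intro hx
    exact ⟨pos σ x, List.mem_range.2 (pos σ x).2, by rw [pointAt_pos, trunc_of_mem_points hx]⟩

/-- The neighbours at positions `i` and `i + 1` are inverted exactly when both positions belong to
`T`, which happens |T| - 1 times. -/
theorem des_reversal {s : Stratum} (hd : deep n ⊆ s.fam) {σ : Fin (2 ^ n) ≃ List.Vector Bool n}
    (h : chamberOrder σ ∈ s.orders) {T : QInterval (2 ^ n)} (hT : wallSet σ T ∈ s.fam) :
    des (points n) (chamberOrder σ) (chamberOrder ((reversal T).trans σ)) = 1 + T.size := by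
  classical
  have hl : ((List.range (2 ^ n)).map (pointAt σ)).Pairwise (chamberOrder σ) := by
    rw [List.pairwise_map]
    refine List.pairwise_lt_range.imp_of_mem fun ha hb hab => Or.inl ?_
    rw [List.mem_range] at ha hb
    rw [pos_pointAt σ ha, pos_pointAt σ hb]
    exact hab
  rw [des_eq_gapSum s.nested (s.isPlanarOrder h) (twistBy_reversal σ T hd hT) hl
    (mem_map_pointAt σ), gapSum_map]
  have key : gapSum (fun i j => if chamberOrder ((reversal T).trans σ) (pointAt σ j) (pointAt σ i)
      then 1 else 0) (List.range (2 ^ n)) =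
      gapSum (fun i j => if T.lo ≤ i ∧ j ≤ T.hi then 1 else 0) (List.range (2 ^ n)) := by
    refine gapSum_congr List.pairwise_lt_range fun i hi j hj hij => ?_
    rw [List.mem_range] at hi hj
    have hne : (⟨j, hj⟩ : Fin (2 ^ n)) ≠ ⟨i, hi⟩ := by
      rw [Ne, Fin.mk.injEq]; omega
    have : chamberOrder ((reversal T).trans σ) (pointAt σ j) (pointAt σ i) ↔
        T.lo ≤ i ∧ j ≤ T.hi := by
      rw [chamberOrder, pos_reversal, pos_reversal, pos_pointAt σ hi, pos_pointAt σ hj,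
        (reversal T).injective.eq_iff, reversal_lt_iff T hne, Fin.lt_def, Fin.lt_def]
      simp only [hne, false_and, or_false]
      omega
    simp only [this]
  rw [key, gapSum_range, Finset.sum_boole]
  have h1 := T.hi_lt
  have h2 := T.lo_lt_hi
  have : (Finset.range (2 ^ n - 1)).filter (fun i => T.lo ≤ i ∧ i + 1 ≤ T.hi) =
      Finset.Ico T.lo T.hi := by
    ext i
    simp only [Finset.mem_filter, Finset.mem_range, Finset.mem_Ico]
    omega
  rw [this, Nat.card_Ico]
  have h3 : T.size = (T.hi - T.lo) + 1 := by unfold QInterval.size; omega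
  rw [h3, Nat.cast_add, Nat.cast_one]
  linear_combination -zmod_add_self (1 : ZMod 2)

/-- The unknown chosen order of the wall drops out by additivity. The limit can be read off at depth
`n`, since the two chamber orders agree inside the balls of that depth. -/
theorem cocycle_wall {σ : Fin (2 ^ n) ≃ List.Vector Bool n} {T : QInterval (2 ^ n)}
    {w u u' : Stratum} (hw : IsWall σ T w) (h : w ≤ u) (h' : w ≤ u') (hu : IsChamber σ u)
    (hu' : IsChamber ((reversal T).trans σ) u') : cocycle w u + cocycle w u' = 1 + T.size := by
  rw [IsWall, ← wallSet_eq] at hw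
  have hd : deep n ⊆ w.fam := hw ▸ Set.subset_union_left
  have hT : wallSet σ T ∈ w.fam := hw ▸ Or.inr rfl
  have m1 : chamberOrder σ ∈ w.orders := h.2 (hu.order_eq ▸ u.order_mem)
  have m2 : chamberOrder ((reversal T).trans σ) ∈ w.orders := h'.2 (hu'.order_eq ▸ u'.order_mem)
  obtain ⟨N, e1, e2, hN⟩ := ((eventually_eq_ulim _).and ((eventually_eq_ulim _).and
    (eventually_ge n))).exists (f := (Filter.hyperfilter ℕ : Filter ℕ))
  rw [cocycle, cocycle, ← e1, ← e2, hu.order_eq, hu'.order_eq, des_swap w w.order_mem m1,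
    w.des_add m1 w.order_mem m2, ← des_reversal hd m1 hT]
  refine w.des_eq_of_agree m1 m2 fun x => ⟨ball (pre n x), hd (ball_mem_deep (by simp)),
    mem_ball_pre n x, exists_points_mem_ball (by simpa using hN), exists_points_mem_ball (by simp),
    fun a ha b hb => ?_⟩
  have : pos σ a = pos σ b := pos_eq_of_mem_ball (by simp) ha hb
  simp [chamberOrder, pos_reversal, this]

/-! ## The stable length of a gallery -/

theorem quasiLength_mul_gen {m : ℕ} (a : QuasiBraid m) (T : QInterval m) :
    quasiLength m (a * quasiGen T) = quasiLength m a * Multiplicative.ofAdd (1 + T.size : ZMod 2) := by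
  rw [map_mul]
  congr 1
  exact PresentedGroup.toGroup.of _

theorem Gallery.isChamber {u₀ u : Cover} {σ₀ σ : Fin (2 ^ n) ≃ List.Vector Bool n}
    {a : QuasiBraid (2 ^ n)} (h : Gallery u₀ σ₀ u σ a) : IsChamber σ u.base := by
  cases h with
  | nil h => exact h
  | step T hg hw hu hu' h => exact h

theorem Gallery.potential {u₀ u : Cover} {σ₀ σ : Fin (2 ^ n) ≃ List.Vector Bool n}
    {a : QuasiBraid (2 ^ n)} (h : Gallery u₀ σ₀ u σ a) :
    Multiplicative.ofAdd (potential u + Spheromorphism.potential u₀) = quasiLength (2 ^ n) a := by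
  induction h with
  | nil h => rw [zmod_add_self, map_one]; rfl
  | step T hg hw hu hu' h ih =>
    rw [quasiLength_mul_gen, ← ih, ← ofAdd_add]
    congr 1
    rw [potential_of_le hu, potential_of_le hu', ← cocycle_wall hw hu.1 hu'.1 hg.isChamber h]
    rename_i u u' w _ _
    linear_combination -zmod_add_self (cocycle w.base u.base)

theorem isStableLength_stableLength : IsStableLength stableLength := by
  rintro n u _ σ σ' a h p rfl
  rw [stableLength_apply p u, h.potential]

theorem Gallery.trans {u₀ u v : Cover} {σ₀ σ τ : Fin (2 ^ n) ≃ List.Vector Bool n}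
    {a b : QuasiBraid (2 ^ n)} (h : Gallery u₀ σ₀ u σ a) (h' : Gallery u σ v τ b) :
    Gallery u₀ σ₀ v τ (a * b) := by
  induction h' with
  | nil _ => rwa [mul_one]
  | step T hg hw hu hu' hc ih => rw [← mul_assoc]; exact ih.step T hw hu hu' hc

/-! ## Vertices of a stratum at a given level -/

theorem Stratum.exists_ne_mem (s : Stratum) {F : Set Ends} (hF : F ∈ s.fam) {x : Ends} (hx : x ∈ F) :
    ∃ y ∈ F, y ≠ x := by
  obtain ⟨m, hm⟩ := exists_ball_subset (s.proper F hF).1.isOpen hx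
  refine ⟨Function.update x m (!x m), hm ?_, fun h => ?_⟩
  · rw [mem_ball_pre_iff]
    exact fun i hi => Function.update_of_ne hi.ne _ _
  · have := congrFun h m
    simp at this

/-- A vertex inside a deep ball is a deep ball. -/
theorem Stratum.mem_deep_of_subset (s : Stratum) (hd : deep n ⊆ s.fam) {F : Set Ends}
    (hF : F ∈ s.fam) {x : Ends} (hx : x ∈ F) (h : F ⊆ ball (pre n x)) : F ∈ deep n := by
  -- Take the longest initial segment of `x`, of length at least `n`, whose ball contains `F`. Then
  -- `F` meets both sons of this ball without lying inside either, so by nestedness it contains both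
  -- and is the whole ball.
  classical
  have hex : ∃ k, ¬ F ⊆ ball (pre (n + k) x) := by
    obtain ⟨y, hy, hne⟩ := s.exists_ne_mem hF hx
    obtain ⟨m, hm⟩ := Function.ne_iff.1 hne
    exact ⟨m + 1, fun h => hm (mem_ball_pre_iff.1 (h hy) m (by omega))⟩
  obtain ⟨k, hk⟩ : ∃ k, Nat.find hex = k + 1 :=
    Nat.exists_eq_succ_of_ne_zero fun h0 => Nat.find_spec hex (by rw [h0]; exact h)
  have h1 : F ⊆ ball (pre (n + k) x) := not_not.1 (Nat.find_min hex (m := k) (by omega))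
  have h2 : ¬ F ⊆ ball (pre (n + k) x ++ [x (n + k)]) := by
    have := Nat.find_spec hex
    rwa [hk, ← add_assoc, pre_succ] at this
  obtain ⟨z, hz, hz'⟩ := Set.not_subset.1 h2
  have hl : n ≤ (pre (n + k) x).length := by simp
  have hxz : pre (n + k) z = pre (n + k) x := by simpa [mem_ball_iff] using h1 hz
  have hd' : z (n + k) ≠ x (n + k) := by
    intro h
    apply hz'
    rw [← h, ← hxz]
    exact mem_snoc_pre _ z
  have hmz : z ∈ ball (pre (n + k) x ++ [z (n + k)]) := by rw [← hxz]; exact mem_snoc_pre _ z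
  have hmx : x ∈ ball (pre (n + k) x ++ [x (n + k)]) := mem_snoc_pre _ x
  have hdis : Disjoint (ball (pre (n + k) x ++ [x (n + k)])) (ball (pre (n + k) x ++ [z (n + k)])) := by
    have := ball_snoc_disjoint (pre (n + k) x)
    rcases hxb : x (n + k) with _ | _ <;> rcases hzb : z (n + k) with _ | _
    · exact absurd (hzb.trans hxb.symm) hd'
    · exact this
    · exact this.symm
    · exact absurd (hzb.trans hxb.symm) hd'
  have c1 := Nested.chain s.nested hF (hd (snoc_mem_deep hl (x (n + k)))) hx hmx
  have c2 := Nested.chain s.nested hF (hd (snoc_mem_deep hl (z (n + k)))) hz hmz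
  have s1 : ball (pre (n + k) x ++ [x (n + k)]) ⊆ F := by
    rcases c1 with h | h
    · exact absurd h h2
    · exact h
  have s2 : ball (pre (n + k) x ++ [z (n + k)]) ⊆ F := by
    rcases c2 with h | h
    · exact absurd (h hx) (Set.disjoint_left.1 hdis hmx)
    · exact h
  have s3 : ball (pre (n + k) x) ⊆ F := by
    rw [← ball_snoc_union]
    rcases hxb : x (n + k) with _ | _ <;> rcases hzb : z (n + k) with _ | _ <;> rw [hxb] at s1 <;>
      rw [hzb] at s2
    · exact absurd (hzb.trans hxb.symm) hd'
    · exact Set.union_subset s1 s2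
    · exact Set.union_subset s2 s1
    · exact absurd (hzb.trans hxb.symm) hd'
  rw [h1.antisymm s3]
  exact ball_mem_deep hl

theorem Stratum.ball_subset (s : Stratum) (hd : deep n ⊆ s.fam) {F : Set Ends} (hF : F ∈ s.fam)
    (hF' : F ∉ deep n) {x : Ends} (hx : x ∈ F) : ball (pre n x) ⊆ F := by
  rcases Nested.chain s.nested hF (hd (ball_mem_deep (w := pre n x) (by simp))) hx
    (mem_ball_pre n x) with h | h
  · exact absurd (s.mem_deep_of_subset hd hF hx h) hF'
  · exact h

theorem Stratum.not_mem_deep (s : Stratum) (hd : deep n ⊆ s.fam) {F G : Set Ends} (hF : F ∈ s.fam)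
    (hF' : F ∉ deep n) (h : F ⊆ G) : G ∉ deep n := by
  rintro ⟨w, hw, rfl⟩
  obtain ⟨x, hx⟩ := (s.proper F hF).2.1
  refine hF' (s.mem_deep_of_subset hd hF hx fun y hy => ?_)
  rw [mem_ball_pre_iff]
  exact fun i hi => agree_of_mem_ball (h hy) (h hx) i (hi.trans_le hw)

theorem Stratum.finite_not_deep (s : Stratum) (n : ℕ) : (s.fam \ deep n).Finite := by
  refine (s.cofinite.union (range_ball_diff_deep n)).subset ?_
  rintro F ⟨h1, h2⟩
  by_cases h : F ∈ Set.range ball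
  · exact Or.inr ⟨h, h2⟩
  · exact Or.inl (Or.inl ⟨h1, h⟩)

/-- A vertex which is not a deep ball consists of consecutive balls of depth `n`. -/
theorem Stratum.exists_wallSet (s : Stratum) (hd : deep n ⊆ s.fam) {F : Set Ends} (hF : F ∈ s.fam)
    (hF' : F ∉ deep n) {σ : Fin (2 ^ n) ≃ List.Vector Bool n} (hσ : chamberOrder σ ∈ s.orders) :
    ∃ T, wallSet σ T = F := by
  classical
  have hp := s.isPlanarOrder hσ
  have sat : ∀ x ∈ F, ∀ y, pos σ y = pos σ x → y ∈ F := fun x hx y hy =>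
    s.ball_subset hd hF hF' hx (by rw [mem_ball_iff, length_pre]; exact pos_eq_pos.1 hy)
  obtain ⟨x₀, hx₀⟩ := (s.proper F hF).2.1
  let I : Finset (Fin (2 ^ n)) := Finset.univ.filter fun k => ∃ x ∈ F, pos σ x = k
  have mI : ∀ x ∈ F, pos σ x ∈ I := fun x hx =>
    Finset.mem_filter.2 ⟨Finset.mem_univ _, x, hx, rfl⟩
  have hI : I.Nonempty := ⟨_, mI x₀ hx₀⟩
  -- The extreme positions occupied by `F` bound the interval; convexity fills in the positions
  -- between them.
  obtain ⟨a, ha, hamin⟩ : ∃ a ∈ F, ∀ x ∈ F, pos σ a ≤ pos σ x := by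
    obtain ⟨a, ha, h⟩ := (Finset.mem_filter.1 (I.min'_mem hI)).2
    exact ⟨a, ha, fun x hx => h ▸ I.min'_le _ (mI x hx)⟩
  obtain ⟨b, hb, hbmax⟩ : ∃ b ∈ F, ∀ x ∈ F, pos σ x ≤ pos σ b := by
    obtain ⟨b, hb, h⟩ := (Finset.mem_filter.1 (I.max'_mem hI)).2
    exact ⟨b, hb, fun x hx => h ▸ I.le_max' _ (mI x hx)⟩
  have conv : ∀ z, pos σ a ≤ pos σ z → pos σ z ≤ pos σ b → z ∈ F := by
    intro z h1 h2
    rcases h1.eq_or_lt with h1 | h1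
    · exact sat a ha z h1.symm
    rcases h2.eq_or_lt with h2 | h2
    · exact sat b hb z h2
    · exact hp.2 F hF a ha b hb z (Or.inl h1) (Or.inl h2)
  have hab : (pos σ a : ℕ) < pos σ b := by
    rw [← Fin.lt_def]
    by_contra hle
    have heq : ∀ x ∈ F, pos σ x = pos σ a := fun x hx =>
      le_antisymm ((hbmax x hx).trans (not_lt.1 hle)) (hamin x hx)
    refine hF' (s.mem_deep_of_subset hd hF ha fun x hx => ?_)
    rw [mem_ball_iff, length_pre]
    exact pos_eq_pos.1 (heq x hx)
  refine ⟨⟨pos σ a, pos σ b, hab, (pos σ b).2, ?_⟩, ?_⟩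
  · rintro ⟨h1, h2⟩
    refine (s.proper F hF).2.2 (Set.eq_univ_of_forall fun z => conv z ?_ ?_)
    · rw [Fin.le_def, h1]; exact Nat.zero_le _
    · rw [Fin.le_def]
      have := (pos σ z).2
      omega
  · ext z
    exact ⟨fun h => conv z h.1 h.2, fun h => ⟨hamin z h, hbmax z h⟩⟩

theorem exists_equiv_fin {ι : Type} [Fintype ι] (r : ι → ι → Prop) [IsStrictTotalOrder ι r] {k : ℕ}
    (h : Fintype.card ι = k) : ∃ e : Fin k ≃ ι, ∀ i j, i < j → r (e i) (e j) := by
  classical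
  let := linearOrderOfSTO r
  exact ⟨(Fintype.orderIsoFinOfCardEq ι h).toEquiv, fun i j hij =>
    (Fintype.orderIsoFinOfCardEq ι h).lt_iff_lt.2 hij⟩

/-- The words of length `n` are ranked by the chosen order of representative ends. Convexity makes
the representatives irrelevant, and normality settles the order inside the balls. -/
theorem Stratum.exists_chamberOrder (s : Stratum) (hd : deep n ⊆ s.fam) :
    ∃ σ : Fin (2 ^ n) ≃ List.Vector Bool n, s.order = chamberOrder σ := by
  have hp := s.isPlanarOrder s.order_mem
  have inj : Function.Injective fun v : List.Vector Bool n => app v.1 fun _ => false := by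
    intro v w h
    have h1 := pre_app v.1 fun _ => false
    have h2 := pre_app w.1 fun _ => false
    dsimp only at h
    rw [v.2] at h1
    rw [w.2, ← h, h1] at h2
    exact Subtype.ext h2
  have : IsStrictTotalOrder (List.Vector Bool n)
      fun v w => s.order (app v.1 fun _ => false) (app w.1 fun _ => false) :=
    { trichotomous := fun v w h h' => inj (hp.1.trichotomous _ _ h h')
      irrefl := fun v => hp.1.irrefl _
      trans := fun u v w => hp.1.trans _ _ _ }
  have hc : Fintype.card (List.Vector Bool n) = 2 ^ n := by rw [card_vector, Fintype.card_bool]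
  obtain ⟨σ, hσ⟩ := exists_equiv_fin
    (fun v w : List.Vector Bool n => s.order (app v.1 fun _ => false) (app w.1 fun _ => false)) hc
  refine ⟨σ, s.isNormal_order.eq_chamberOrder hd fun x y hxy => ?_⟩
  have h := hσ _ _ hxy
  have e : ∀ x, app (σ (pos σ x)).1 (fun _ => false) = trunc n x := fun x => by
    rw [pos, Equiv.apply_symm_apply]
    exact app_pre_zero n x
  rw [e, e] at h
  exact (hp.trunc hd fun h => hxy.ne (pos_eq_pos.2 h)).2 h

/-! ## Galleries above a stratum -/

theorem Cover.up_le_up (u : Cover) {s t : Stratum} (h : u.base ≤ s) (h' : s ≤ t) :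
    u.up s h ≤ u.up t (h.trans h') :=
  ⟨h', by
    change (u.path ≫ FreeGroupoid.homMk (homOfLE h)) ≫ FreeGroupoid.homMk (homOfLE h') =
      u.path ≫ FreeGroupoid.homMk (homOfLE (h.trans h'))
    rw [Category.assoc, ← Functor.map_comp]
    rfl⟩

theorem Stratum.le_chamber (hn : 1 ≤ n) {s : Stratum} (hd : deep n ⊆ s.fam)
    {σ : Fin (2 ^ n) ≃ List.Vector Bool n} (h : chamberOrder σ ∈ s.orders) : s ≤ chamber hn σ :=
  Stratum.le_of_mem hd h (chamberOrder_mem hn σ)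

theorem chamberOrder_mem_of_le (hn : 1 ≤ n) {s : Stratum} {σ : Fin (2 ^ n) ≃ List.Vector Bool n}
    (h : s ≤ chamber hn σ) : chamberOrder σ ∈ s.orders := h.2 (chamberOrder_mem hn σ)

/-- The change of positions is an increasing bijection of a finite ordinal, hence the identity. -/
theorem chamberOrder_injective {σ τ : Fin (2 ^ n) ≃ List.Vector Bool n}
    (h : chamberOrder σ = chamberOrder τ) : σ = τ := by
  have hmono : StrictMono fun k => τ.symm (σ k) := by
    intro i j hij
    obtain ⟨x, hx⟩ := exists_pos σ i
    obtain ⟨y, hy⟩ := exists_pos σ j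
    have h1 : chamberOrder σ x y := Or.inl (by rwa [hx, hy])
    rw [h] at h1
    have e : ∀ z, τ.symm (σ (pos σ z)) = pos τ z := fun z => by
      rw [pos, Equiv.apply_symm_apply]; rfl
    have h2 := h1.pos_le
    rw [← e, ← e, hx, hy] at h2
    exact lt_of_le_of_ne h2 fun h3 => hij.ne (σ.injective (τ.symm.injective h3))
  have := (hmono.range_inj strictMono_id).1 (by
    rw [Set.range_id]
    exact Set.range_eq_univ.2 (τ.symm.surjective.comp σ.surjective))
  refine Equiv.ext fun k => ?_
  have := congrFun this k
  exact (Equiv.symm_apply_eq τ).1 this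

theorem Gallery.step_up (hn : 1 ≤ n) {v u : Cover} {τ σ : Fin (2 ^ n) ≃ List.Vector Bool n}
    {a : QuasiBraid (2 ^ n)} {T : QInterval (2 ^ n)} (hσ : u.base ≤ chamber hn σ)
    (hw : u.base ≤ wall hn σ T) (hσ' : u.base ≤ chamber hn ((reversal T).trans σ))
    (h : Gallery v τ (u.up _ hσ) σ a) :
    Gallery v τ (u.up _ hσ') ((reversal T).trans σ) (a * quasiGen T) := by
  have hd : deep n ⊆ (wall hn σ T).fam := Set.subset_union_left
  have hT : wallSet σ T ∈ (wall hn σ T).fam := Or.inr rfl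
  have m := chamberOrder_mem_wall hn σ T
  exact h.step T (w := u.up _ hw) (isWall_wall hn σ T) (u.up_le_up hw (Stratum.le_chamber hn hd m))
    (u.up_le_up hw (Stratum.le_chamber hn hd (chamberOrder_reversal_mem hd m hT)))
    (isChamber_chamber hn _)

theorem Stratum.le_wall (hn : 1 ≤ n) {s : Stratum} (hd : deep n ⊆ s.fam)
    {σ : Fin (2 ^ n) ≃ List.Vector Bool n} (h : chamberOrder σ ∈ s.orders) {T : QInterval (2 ^ n)}
    (hT : wallSet σ T ∈ s.fam) : s ≤ wall hn σ T := by
  refine Stratum.le_of_mem ?_ h (chamberOrder_mem_wall hn σ T)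
  rintro F (hF | rfl)
  · exact hd hF
  · exact hT

/-- The vertex `F` is the one at which `x` and `y` branch. -/
def BranchAt (fam : Set (Set Ends)) (F : Set Ends) (x y : Ends) : Prop :=
  F ∈ common fam x y ∧ ∀ G ∈ common fam x y, F ⊆ G

theorem BranchAt.common_eq {fam : Set (Set Ends)} {F : Set Ends} {x y x' y' : Ends}
    (h : BranchAt fam F x y) (h' : BranchAt fam F x' y') : common fam x y = common fam x' y' := by
  rw [common_eq_of_meet h.1 h.2, common_eq_of_meet h'.1 h'.2]

theorem TwistBy.of_pos {fam : Set (Set Ends)} {e : Set (Set Ends) → Prop} {r r' : Ends → Ends → Prop}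
    (h : TwistBy fam e r r') {x y : Ends} (he : e (common fam x y)) : r' x y ↔ r y x := by
  simpa [he] using h x y

theorem TwistBy.of_neg {fam : Set (Set Ends)} {e : Set (Set Ends) → Prop} {r r' : Ends → Ends → Prop}
    (h : TwistBy fam e r r') {x y : Ends} (he : ¬ e (common fam x y)) : r' x y ↔ r x y := by
  simpa [he] using h x y

open scoped Classical in
/-- Any two chambers above a stratum are joined by a gallery of chambers above it. -/
theorem exists_gallery_above (hn : 1 ≤ n) (u : Cover) (hd : deep n ⊆ u.base.fam)
    {σ τ : Fin (2 ^ n) ≃ List.Vector Bool n} (hσ : u.base ≤ chamber hn σ)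
    (hτ : u.base ≤ chamber hn τ) : ∃ a, Gallery (u.up _ hσ) σ (u.up _ hτ) τ a := by
  have mτ := chamberOrder_mem_of_le hn hτ
  let V := (u.base.finite_not_deep n).toFinset
  have hV : ∀ F, F ∈ V ↔ F ∈ u.base.fam ∧ F ∉ deep n := fun F => by simp [V]
  -- Because of the dual order the induction treats large vertices first. A reversal at a vertex
  -- also inverts pairs branching at its descendants, and these are corrected later.
  let f : Set Ends → ℕᵒᵈ := fun F => OrderDual.toDual ((points n).filter (· ∈ F)).card
  have hf : ∀ F G, F ∈ u.base.fam → F ∉ deep n → G ∈ u.base.fam → G ∉ deep n → G ⊆ F →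
      f G ≤ f F → G = F := by
    intro F G hF hF' hG hG' hGF hle
    have hle' : ((points n).filter (· ∈ F)).card ≤ ((points n).filter (· ∈ G)).card := hle
    have heq := Finset.eq_of_subset_of_card_le
      (Finset.monotone_filter_right (points n) fun x _ hx => hGF hx) hle'
    refine hGF.antisymm fun x hx => ?_
    have h1 : trunc n x ∈ F := u.base.ball_subset hd hF hF' hx
      (by rw [mem_ball_iff, length_pre, pre_trunc le_rfl])
    have h2 : trunc n x ∈ (points n).filter (· ∈ G) := by
      rw [heq]; exact Finset.mem_filter.2 ⟨trunc_mem_points n x, h1⟩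
    refine u.base.ball_subset hd hG hG' (Finset.mem_filter.1 h2).2 ?_
    rw [mem_ball_iff, length_pre, pre_trunc le_rfl]
  have key : ∀ U : Finset (Set Ends), U ⊆ V → ∃ (σ₁ : Fin (2 ^ n) ≃ List.Vector Bool n)
      (h₁ : u.base ≤ chamber hn σ₁), (∃ a, Gallery (u.up _ hσ) σ (u.up _ h₁) σ₁ a) ∧
      ∀ F ∈ U, ∀ x y, BranchAt u.base.fam F x y → (chamberOrder σ₁ x y ↔ chamberOrder τ x y) := by
    intro U
    induction U using Finset.induction_on_max_value f with
    | empty => exact fun _ => ⟨σ, hσ, ⟨1, Gallery.nil (isChamber_chamber hn σ)⟩, by simp⟩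
    | insert A U hA hmax ih =>
      intro hU
      obtain ⟨σ₁, h₁, ⟨a, ha⟩, hag⟩ := ih fun F hF => hU (Finset.mem_insert_of_mem hF)
      by_cases hAag : ∀ x y, BranchAt u.base.fam A x y → (chamberOrder σ₁ x y ↔ chamberOrder τ x y)
      · refine ⟨σ₁, h₁, ⟨a, ha⟩, fun F hF => ?_⟩
        rcases Finset.mem_insert.1 hF with rfl | hF
        · exact hAag
        · exact hag F hF
      -- One wrong pair branching at `A` means that all such pairs are wrong, since twists depend on
      -- the branch set only; a single reversal at `A` corrects them all.
      simp only [not_forall] at hAag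
      obtain ⟨x₀, y₀, hb₀, hdis⟩ := hAag
      have m₁ := chamberOrder_mem_of_le hn h₁
      obtain ⟨hAf, hAd⟩ := (hV A).1 (hU (Finset.mem_insert_self _ _))
      obtain ⟨T, rfl⟩ := u.base.exists_wallSet hd hAf hAd m₁
      have m₂ := chamberOrder_reversal_mem hd m₁ hAf
      have h₂ := Stratum.le_chamber hn hd m₂
      refine ⟨(reversal T).trans σ₁, h₂, ⟨_, Gallery.step_up hn h₁ (Stratum.le_wall hn hd m₁ hAf) h₂ ha⟩,
        fun F hF x y hb => ?_⟩
      have ht := twistBy_reversal σ₁ T hd hAf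
      obtain ⟨e, -, he⟩ := (u.base.mem_orders m₁).1 mτ
      rcases Finset.mem_insert.1 hF with rfl | hF
      · have h3 : e (common u.base.fam x₀ y₀) := not_not.1 fun h => hdis (he.of_neg h).symm
        rw [hb₀.common_eq hb] at h3
        exact (ht.of_pos ⟨hb.1, fun G hG => u.base.not_mem_deep hd hAf hAd (hb.2 G hG)⟩).trans
          (he.of_pos h3).symm
      -- The reversal could disturb `F` only if `F` were contained in `A`, and then the sizes would
      -- force `F = A`.
      · refine (ht.of_neg fun h3 => ?_).trans (hag F hF x y hb)
        obtain ⟨hFf, hFd⟩ := (hV F).1 (hU (Finset.mem_insert_of_mem hF))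
        exact hA (hf _ F hAf hAd hFf hFd (hb.2 _ h3.1) (hmax F hF) ▸ hF)
  obtain ⟨σ₁, h₁, ⟨a, ha⟩, hag⟩ := key V subset_rfl
  have : σ₁ = τ := by
    refine chamberOrder_injective (funext fun x => funext fun y => eq_iff_iff.2 ?_)
    by_cases hxy : x = y
    · subst hxy
      exact iff_of_false ((isStrictTotalOrder_chamberOrder σ₁).irrefl x)
        ((isStrictTotalOrder_chamberOrder τ).irrefl x)
    obtain ⟨e, e0, he⟩ := (u.base.mem_orders (chamberOrder_mem_of_le hn h₁)).1 mτ
    rcases (common u.base.fam x y).eq_empty_or_nonempty with h0 | hne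
    · have := he x y
      simpa [h0, e0] using this.symm
    · obtain ⟨F, hF⟩ := u.base.exists_meet hxy hne
      by_cases hFd : F ∈ deep n
      · obtain ⟨w, hw, rfl⟩ := hFd
        have e1 : pos σ₁ x = pos σ₁ y := pos_eq_of_mem_ball hw hF.1.2.1 hF.1.2.2
        have e2 : pos τ x = pos τ y := pos_eq_of_mem_ball hw hF.1.2.1 hF.1.2.2
        simp [chamberOrder, e1, e2]
      · exact hag F ((hV F).2 ⟨hF.1.1, hFd⟩) x y hF
  subst this
  exact ⟨a, ha⟩

theorem Stratum.exists_le_chamber (hn : 1 ≤ n) (s : Stratum) (hd : deep n ⊆ s.fam) :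
    ∃ σ : Fin (2 ^ n) ≃ List.Vector Bool n, s ≤ chamber hn σ := by
  obtain ⟨σ, hσ⟩ := s.exists_chamberOrder hd
  exact ⟨σ, Stratum.le_chamber hn hd (hσ ▸ s.order_mem)⟩

/-- Any two strata of the universal cover are joined by galleries, at every sufficiently large
level. -/
theorem exists_gallery_root (v : Cover) : ∃ N, ∀ n, N ≤ n → ∀ hn : 1 ≤ n,
    (deep n ⊆ Cover.root.base.fam ∧ deep n ⊆ v.base.fam) ∧
    ∀ (σ τ : Fin (2 ^ n) ≃ List.Vector Bool n) (hσ : Cover.root.base ≤ chamber hn σ)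
      (hτ : v.base ≤ chamber hn τ), ∃ a, Gallery (Cover.root.up _ hσ) σ (v.up _ hτ) τ a := by
  refine Cover.induction (Q := fun v => ∃ N, ∀ n, N ≤ n → ∀ hn : 1 ≤ n,
    (deep n ⊆ Cover.root.base.fam ∧ deep n ⊆ v.base.fam) ∧
    ∀ (σ τ : Fin (2 ^ n) ≃ List.Vector Bool n) (hσ : Cover.root.base ≤ chamber hn σ)
      (hτ : v.base ≤ chamber hn τ), ∃ a, Gallery (Cover.root.up _ hσ) σ (v.up _ hτ) τ a)
    ?_ ?_ ?_ v
  · exact ⟨1, fun n _ hn => ⟨⟨deep_subset_base hn, deep_subset_base hn⟩, fun σ τ hσ hτ =>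
      exists_gallery_above hn _ (deep_subset_base hn) hσ hτ⟩⟩
  · rintro u v huv ⟨N, hN⟩
    obtain ⟨M, hM⟩ := v.base.exists_deep
    refine ⟨max N M, fun n hn hn1 => ?_⟩
    obtain ⟨⟨h1, h2⟩, h3⟩ := hN n ((le_max_left _ _).trans hn) hn1
    refine ⟨⟨h1, (deep_mono ((le_max_right _ _).trans hn)).trans hM⟩, fun σ τ hσ hτ => ?_⟩
    obtain ⟨a, ha⟩ := h3 σ τ hσ (huv.1.trans hτ)
    -- Passing to a larger stratum only shrinks the set of chambers above it.
    have : u.up _ (huv.1.trans hτ) = v.up _ hτ :=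
      Cover.eq_of_base (u.le_up _ _) (huv.trans (v.le_up _ hτ)) rfl
    exact ⟨a, this ▸ ha⟩
  · rintro u v hvu ⟨N, hN⟩
    refine ⟨N, fun n hn hn1 => ?_⟩
    obtain ⟨⟨h1, h2⟩, h3⟩ := hN n hn hn1
    have h4 := h2.trans hvu.1.1
    refine ⟨⟨h1, h4⟩, fun σ τ hσ hτ => ?_⟩
    -- Passing to a smaller stratum `v`, go first to some chamber above `u`, which is also above
    -- `v`, and from there to the required one.
    obtain ⟨ρ, hρ⟩ := u.base.exists_le_chamber hn1 h2
    obtain ⟨a, ha⟩ := h3 σ ρ hσ hρ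
    have : v.up _ (hvu.1.trans hρ) = u.up _ hρ :=
      Cover.eq_of_base (v.le_up _ _) (hvu.trans (u.le_up _ hρ)) rfl
    rw [← this] at ha
    obtain ⟨b, hb⟩ := exists_gallery_above hn1 v h4 (hvu.1.trans hρ) hτ
    exact ⟨_, ha.trans hb⟩

/-- Every element of the fundamental group of the tower is the class of a pure quasi-braid. -/
theorem exists_gallery_of_ker (p : proj.ker) :
    ∃ (n : ℕ) (u : Cover) (σ : Fin (2 ^ n) ≃ List.Vector Bool n) (a : QuasiBraid (2 ^ n)),
      Gallery u σ (p.1.1.2 u) σ a := by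
  obtain ⟨N, hN⟩ := exists_gallery_root (p.1.1.2 Cover.root)
  obtain ⟨⟨h1, h2⟩, h3⟩ := hN (max N 1) (le_max_left _ _) (le_max_right _ _)
  have hp : proj p.1 = 1 := p.2
  have hbase : ∀ u, (p.1.1.2 u).base = u.base := fun u => by
    rw [LiftGroup.base_eq, hp, one_smul]
  obtain ⟨σ, hσ⟩ := Cover.root.base.exists_le_chamber (le_max_right N 1) h1
  obtain ⟨a, ha⟩ := h3 σ σ hσ (by rw [hbase]; exact hσ)
  refine ⟨_, Cover.root.up _ hσ, σ, a, ?_⟩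
  -- The deck transformation maps the chamber above the root to a chamber above the image of the
  -- root with the same base, and there is only one.
  convert ha using 1
  exact Cover.eq_of_base (u := p.1.1.2 Cover.root) (p.1.1.2.monotone (Cover.le_up _ _ _))
    (Cover.le_up _ _ _) (hbase _)

theorem IsStableLength.unique {ℓ ℓ' : proj.ker →* Multiplicative (ZMod 2)} (h : IsStableLength ℓ)
    (h' : IsStableLength ℓ') : ℓ' = ℓ := by
  ext1 p
  obtain ⟨n, u, σ, a, ha⟩ := exists_gallery_of_ker p
  rw [h n u _ σ σ a ha p rfl, h' n u _ σ σ a ha p rfl]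

/-! ## The tower is connected -/

theorem exists_cover_wall (hn : 1 ≤ n) {σ : Fin (2 ^ n) ≃ List.Vector Bool n} (T : QInterval (2 ^ n))
    (h : ∃ u : Cover, u.base = chamber hn σ) :
    ∃ u : Cover, u.base = chamber hn ((reversal T).trans σ) := by
  obtain ⟨u, hu⟩ := h
  have hd : deep n ⊆ (wall hn σ T).fam := Set.subset_union_left
  have hT : wallSet σ T ∈ (wall hn σ T).fam := Or.inr rfl
  have m := chamberOrder_mem_wall hn σ T
  let w := u.down (wall hn σ T) (hu ▸ Stratum.le_chamber hn hd m)
  exact ⟨w.up _ (Stratum.le_chamber hn hd (chamberOrder_reversal_mem hd m hT)), rfl⟩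

theorem submonoid_eq_top_of_adjacent_swap {k : ℕ} (S : Submonoid (Equiv.Perm (Fin k)))
    (h : ∀ i j : Fin k, (i : ℕ) + 1 = j → Equiv.swap i j ∈ S) : S = ⊤ := by
  cases k with
  | zero => exact top_unique fun x _ => by rw [Subsingleton.elim x 1]; exact S.one_mem
  | succ k =>
    rw [← top_le_iff, ← Equiv.Perm.mclosure_swap_castSucc_succ, Submonoid.closure_le]
    rintro _ ⟨i, rfl⟩
    exact h _ _ (by simp)

/-- Adjacent transpositions generate the symmetric group and are reversals of two-letter intervals.
The bound 2 ≤ n makes these intervals proper; for n = 1 the only one is everything. -/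
theorem exists_cover_perm (hn : 2 ≤ n) (π : Equiv.Perm (Fin (2 ^ n)))
    (σ : Fin (2 ^ n) ≃ List.Vector Bool n)
    (h : ∃ u : Cover, u.base = chamber (one_le_two.trans hn) σ) :
    ∃ u : Cover, u.base = chamber (one_le_two.trans hn) (π.trans σ) := by
  let S : Submonoid (Equiv.Perm (Fin (2 ^ n))) :=
    { carrier := {π | ∀ σ : Fin (2 ^ n) ≃ List.Vector Bool n,
        (∃ u : Cover, u.base = chamber (one_le_two.trans hn) σ) →
        ∃ u : Cover, u.base = chamber (one_le_two.trans hn) (π.trans σ)}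
      one_mem' := fun _ h => h
      mul_mem' := fun {π ρ} hπ hρ σ h => hρ _ (hπ σ h) }
  have hS : S = ⊤ := by
    refine submonoid_eq_top_of_adjacent_swap S fun i j hij σ h => ?_
    have h4 : 2 ^ 2 ≤ 2 ^ n := Nat.pow_le_pow_right two_pos hn
    let T : QInterval (2 ^ n) := ⟨i, j, by omega, j.2, by omega⟩
    have : reversal T = Equiv.swap i j := by
      ext k
      rw [val_reversal, Equiv.swap_apply_def]
      change (if (i : ℕ) ≤ k ∧ (k : ℕ) ≤ j then (i : ℕ) + j - k else k) = _
      by_cases h1 : k = i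
      · subst h1; rw [if_pos (by omega), if_pos rfl]; omega
      · rw [if_neg h1]
        by_cases h2 : k = j
        · subst h2; rw [if_pos (by omega), if_pos rfl]; omega
        · rw [if_neg h2, if_neg]
          rw [Fin.ext_iff] at h1 h2
          omega
    rw [← this]
    exact exists_cover_wall _ T h
  have : π ∈ S := hS ▸ Submonoid.mem_top π
  exact this σ h

/-- This is connectedness of the tower: descend from a chamber above the root to a chamber above `s`
by permutations, then pass down to `s`. -/
theorem exists_cover (s : Stratum) : ∃ u : Cover, u.base = s := by
  obtain ⟨N, hN⟩ := s.exists_deep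
  have hn : 2 ≤ max N 2 := le_max_right _ _
  have hn1 := one_le_two.trans hn
  obtain ⟨σ, hσ⟩ := s.exists_le_chamber hn1 ((deep_mono (le_max_left _ _)).trans hN)
  obtain ⟨τ, hτ⟩ := Cover.root.base.exists_le_chamber hn1 (deep_subset_base hn1)
  obtain ⟨u, hu⟩ := exists_cover_perm hn (σ.trans τ.symm) τ ⟨Cover.root.up _ hτ, rfl⟩
  have : (σ.trans τ.symm).trans τ = σ := by ext1 k; simp
  rw [this] at hu
  exact ⟨u.down s (hu ▸ hσ), rfl⟩

/-! ## Every element of `N` has a lift -/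

/-- The action of an element of `N` on the poset of strata, as a functor. -/
def smulFunctor (g : Neretin) : Stratum ⥤ Stratum :=
  Monotone.functor (f := fun s : Stratum => g • s) fun _ _ h => smul_le_smul_stratum g h

theorem smulFunctor_faithful (g : Neretin) : (FreeGroupoid.map (smulFunctor g)).Faithful := by
  have h : smulFunctor g ⋙ smulFunctor g⁻¹ = 𝟭 Stratum :=
    CategoryTheory.Functor.ext (fun s => show g⁻¹ • g • s = s from inv_smul_smul g s) fun _ _ _ => Subsingleton.elim _ _
  refine Functor.Faithful.of_comp_eq (G := FreeGroupoid.map (smulFunctor g⁻¹))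
    (H := 𝟭 (FreeGroupoid Stratum)) ?_
  rw [← FreeGroupoid.map_comp, h, FreeGroupoid.map_id]

theorem smul_le_smul_stratum_iff (g : Neretin) {s t : Stratum} : g • s ≤ g • t ↔ s ≤ t :=
  ⟨fun h => by simpa using smul_le_smul_stratum g⁻¹ h, smul_le_smul_stratum g⟩

/-- The lift of the transformation given by `g` which maps the base point to the end point of a given
path. -/
def liftMap (g : Neretin) (γ : FreeGroupoid.mk baseStratum ⟶ FreeGroupoid.mk (g • baseStratum))
    (u : Cover) : Cover :=
  ⟨g • u.base, γ ≫ (FreeGroupoid.map (smulFunctor g)).map u.path⟩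

theorem liftMap_le_iff (g : Neretin)
    (γ : FreeGroupoid.mk baseStratum ⟶ FreeGroupoid.mk (g • baseStratum)) (u v : Cover) :
    liftMap g γ u ≤ liftMap g γ v ↔ u ≤ v := by
  have hm : ∀ h : u.base ≤ v.base, (liftMap g γ u).path ≫
      FreeGroupoid.homMk (homOfLE (smul_le_smul_stratum g h)) =
      γ ≫ (FreeGroupoid.map (smulFunctor g)).map (u.path ≫ FreeGroupoid.homMk (homOfLE h)) := by
    intro h
    change (γ ≫ (FreeGroupoid.map (smulFunctor g)).map u.path) ≫
      FreeGroupoid.homMk (homOfLE (smul_le_smul_stratum g h)) = _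
    rw [Functor.map_comp, FreeGroupoid.map_map_homMk]
    exact Category.assoc _ _ _
  constructor
  · rintro ⟨h, e⟩
    have h' := (smul_le_smul_stratum_iff g).1 h
    refine ⟨h', ?_⟩
    have e' := (hm h').symm.trans e
    have := smulFunctor_faithful g
    refine (FreeGroupoid.map (smulFunctor g)).map_injective ?_
    exact (cancel_epi γ).1 e'
  · rintro ⟨h, e⟩
    exact ⟨smul_le_smul_stratum g h, (hm h).trans (by rw [e]; rfl)⟩

/-- Membership in the image propagates along face relations in both directions, so it holds
everywhere by connectedness. -/
theorem liftMap_surjective (g : Neretin)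
    (γ : FreeGroupoid.mk baseStratum ⟶ FreeGroupoid.mk (g • baseStratum)) :
    Function.Surjective (liftMap g γ) := by
  intro v
  have key := Cover.const (X := Prop) (f := fun v => ∃ u, liftMap g γ u = v) (fun v v' h => by
    rw [eq_iff_iff]
    constructor
    · rintro ⟨u, rfl⟩
      have hu : u.base ≤ g⁻¹ • v'.base := by
        rw [← smul_le_smul_stratum_iff g, smul_inv_smul]; exact h.1
      refine ⟨u.up _ hu, Cover.eq_of_base ((liftMap_le_iff g γ _ _).2 (u.le_up _ hu)) h ?_⟩
      exact smul_inv_smul _ _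
    · rintro ⟨u, rfl⟩
      have hu : g⁻¹ • v.base ≤ u.base := by
        rw [← smul_le_smul_stratum_iff g, smul_inv_smul]; exact h.1
      have h1 := (liftMap_le_iff g γ _ _).2 (u.down_le _ hu)
      refine ⟨u.down _ hu, ?_⟩
      obtain ⟨h2, e2⟩ := h1
      obtain ⟨h3, e3⟩ := h
      have hb : (liftMap g γ (u.down _ hu)).base = v.base := smul_inv_smul _ _
      generalize liftMap g γ (u.down _ hu) = w at *
      obtain ⟨t, p⟩ := w
      obtain ⟨t', p'⟩ := v
      obtain rfl : t = t' := hb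
      have : p = p' := (cancel_mono (FreeGroupoid.homMk (homOfLE h2))).1 (e2.trans e3.symm)
      rw [this]) (liftMap g γ Cover.root) v
  exact (eq_iff_iff.1 key).1 ⟨_, rfl⟩

theorem proj_surjective : Function.Surjective proj := by
  intro g
  -- A path from the base point to its translate is what determines a lift.
  obtain ⟨⟨s, γ⟩, hs⟩ := exists_cover (g • baseStratum)
  obtain rfl : s = g • baseStratum := hs
  let φ : Cover ≃o Cover := RelIso.ofSurjective
    (OrderEmbedding.ofMapLEIff (liftMap g γ) (liftMap_le_iff g γ)) (liftMap_surjective g γ)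
  exact ⟨⟨(g, φ), fun u => rfl⟩, rfl⟩

/-! ### The obstruction to lifting a relation through a central extension. -/

section CentralExtension

variable {G A E : Type} [Group G] [AddCommGroup A] [Group E]

/-- The section used in `factorSet`. -/
noncomputable def extensionSection (S : GroupExtension (Multiplicative A) E G) : G → E :=
  Function.surjInv S.rightHom_surjective

theorem rightHom_extensionSection (S : GroupExtension (Multiplicative A) E G) (g : G) :
    S.rightHom (extensionSection S g) = g :=
  Function.surjInv_eq _ g

theorem factorSet_spec (S : GroupExtension (Multiplicative A) E G) (g h : G) :
    S.inl (Multiplicative.ofAdd (factorSet S (g, h))) * extensionSection S (g * h) =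
      extensionSection S g * extensionSection S h :=
  (factorSet_exists S (g, h)).choose_spec

theorem inl_mul_comm {S : GroupExtension (Multiplicative A) E G}
    (hS : S.inl.range ≤ Subgroup.center E) (a : Multiplicative A) (e : E) :
    e * S.inl a = S.inl a * e :=
  Subgroup.mem_center_iff.1 (hS ⟨a, rfl⟩) e

/-- The section is not normalised, and its value at the identity accounts for the degenerate term of
the cycle. -/
theorem extensionSection_one (S : GroupExtension (Multiplicative A) E G) :
    extensionSection S 1 = S.inl (Multiplicative.ofAdd (factorSet S (1, 1))) := by
  have h := factorSet_spec S 1 1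
  rw [mul_one] at h
  exact (mul_right_cancel h).symm

/-- Here `u`, `v`, `w`, `k` stand for the chosen lifts of `f * g`, `g * f`, `(g * f)⁻¹` and the
commutator, and `e` for the value of the factor set at `(1, 1)`. What remains is to write ⁅x, y⁆ as
`x * y * (y * x)⁻¹` and to move central factors. -/
theorem commutator_eq_of_central {M : Type} [CommGroup M] {i : M →* E}
    (cen : ∀ (a : M) (e : E), e * i a = i a * e) {x y u v w k : E} {a b c d e : M}
    (h₁ : i a * u = x * y) (h₂ : i b * v = y * x) (h₃ : i (c * e) = v * w) (h₄ : i d * k = u * w) :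
    ⁅x, y⁆ = i (a / b / c * d / e) * k := by
  have hw : w * v = i (c * e) := by
    apply mul_left_cancel (a := v)
    rw [← mul_assoc, ← h₃, cen]
  have hk : i d * (k * v) = i (c * e) * u := by rw [← mul_assoc, h₄, mul_assoc, hw, cen]
  rw [commutatorElement_def, mul_assoc, ← mul_inv_rev, mul_inv_eq_iff_eq_mul, ← h₁, ← h₂]
  calc i a * u = i (a / (c * e)) * (i (c * e) * u) := by
        rw [← mul_assoc, ← map_mul, div_mul_cancel]
    _ = i (a / b / c * d / e * b) * (k * v) := by
        rw [← hk, ← mul_assoc, ← map_mul]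
        congr 2
        apply Additive.ofMul.injective
        simp only [ofMul_mul, ofMul_div]
        abel
    _ = i (a / b / c * d / e) * k * (i b * v) := by
        rw [map_mul, mul_assoc, mul_assoc, ← mul_assoc k, cen, mul_assoc]

/-- The commutator of the lifts of two elements, compared with the lift of their commutator. -/
theorem commutator_extensionSection {S : GroupExtension (Multiplicative A) E G}
    (hS : S.inl.range ≤ Subgroup.center E) (f g : G) :
    ⁅extensionSection S f, extensionSection S g⁆ = S.inl (Multiplicative.ofAdd
      (factorSet S (f, g) - factorSet S (g, f) - factorSet S (g * f, (g * f)⁻¹) +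
        factorSet S (f * g, (g * f)⁻¹) - factorSet S (1, 1))) * extensionSection S ⁅f, g⁆ := by
  have h3 := factorSet_spec S (g * f) (g * f)⁻¹
  have h4 := factorSet_spec S (f * g) (g * f)⁻¹
  rw [mul_inv_cancel, extensionSection_one, ← map_mul] at h3
  rw [show f * g * (g * f)⁻¹ = ⁅f, g⁆ by rw [commutatorElement_def]; group] at h4
  exact commutator_eq_of_central (inl_mul_comm hS) (factorSet_spec S f g) (factorSet_spec S g f) h3 h4

/-- The class of a central extension of `G` detects the element by which a relation of the form
`[f₁, g₁][f₂, g₂] = 1` fails to lift. -/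
theorem evalChain_factorSet_relationCycle {S : GroupExtension (Multiplicative A) E G}
    (hS : S.inl.range ≤ Subgroup.center E) {f₁ g₁ f₂ g₂ : G} (h : ⁅f₁, g₁⁆ * ⁅f₂, g₂⁆ = 1) :
    S.inl (Multiplicative.ofAdd
      (evalChain (A := A) (factorSet S) (relationCycle f₁ g₁ f₂ g₂ h).1)) =
      ⁅extensionSection S f₁, extensionSection S g₁⁆ *
        ⁅extensionSection S f₂, extensionSection S g₂⁆ := by
  have h1 := factorSet_spec S ⁅f₁, g₁⁆ ⁅f₂, g₂⁆
  rw [h, extensionSection_one] at h1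
  have h2 : ∀ (a b : Multiplicative A) (x y : E), S.inl a * x * (S.inl b * y) =
      S.inl (a * b) * (x * y) := fun a b x y => by
    rw [map_mul, mul_assoc, ← mul_assoc x, inl_mul_comm hS, mul_assoc, mul_assoc]
  -- Each commutator brings the value of the factor set at `(1, 1)` with a minus sign, and the lift
  -- of the identity in `h1` gives it back once: this is the single term `- (1, 1)`.
  rw [commutator_extensionSection hS, commutator_extensionSection hS, h2, ← h1, ← map_mul S.inl,
    ← map_mul S.inl, ← ofAdd_add, ← ofAdd_add, ← ofAdd_add]
  congr 2
  simp only [relationCycle, evalChain, map_sub, map_add, Finsupp.linearCombination_single, one_smul]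
  abel

theorem pairing_zero (e : groupCohomology.H2 (Rep.trivial ℤ G A)) : pairing e 0 = 0 := by
  obtain ⟨c, rfl⟩ := exists_cocycle e
  rw [← map_zero (groupHomology.H2π (Rep.trivial ℤ G ℤ)).hom]
  exact (pairing_mk c 0).trans (map_zero _)

end CentralExtension

/-! ## The Euler extension -/

section Euler

attribute [local instance] lengthKernel_normal

theorem mk_eq_mk_iff {f g : LiftGroup} (hf : proj f = 1) (hg : proj g = 1) :
    (f : LiftGroup ⧸ lengthKernel stableLength) = g ↔ liftShift f = liftShift g := by
  have h1 : liftShift g = liftShift f + liftShift (f⁻¹ * g) := by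
    rw [← liftShift_ker_mul f _ hf, mul_inv_cancel_left]
  rw [QuotientGroup.eq, mem_lengthKernel, h1, left_eq_add]
  exact and_iff_right (by simp [hf, hg])

/-- The lifted relation itself shows that the stable length is onto. -/
theorem exists_liftShift_eq (z : ZMod 2) : ∃ p : LiftGroup, proj p = 1 ∧ liftShift p = z := by
  obtain ⟨t, ht⟩ := proj_surjective tauOne
  obtain ⟨s, hs⟩ := proj_surjective sigma
  obtain ⟨a, ha⟩ := proj_surjective alpha
  obtain ⟨d, hd⟩ := proj_surjective delta
  have h1 := liftShift_relation t s a d ht hs ha hd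
  have h2 : proj (⁅t, s⁆ * ⁅a, d⁆) = 1 := by
    rw [map_mul, map_commutatorElement, map_commutatorElement, ht, hs, ha, hd, relation]
  have hz : z = 0 ∨ z = 1 := by revert z; decide
  rcases hz with rfl | rfl
  · exact ⟨1, map_one _, Multiplicative.ofAdd.injective (map_one stableLength)⟩
  · exact ⟨_, h2, h1⟩

/-- The central extension of `N` by `ℤ/2` defined by the stable length. -/
noncomputable def eulerExtension :
    GroupExtension (Multiplicative (ZMod 2)) (LiftGroup ⧸ lengthKernel stableLength) Neretin where
  -- An element `z` goes to the class of any deck transformation of stable length `z`; by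
  -- `mk_eq_mk_iff` the choice does not matter.
  inl :=
    { toFun := fun z => ((exists_liftShift_eq z.toAdd).choose : LiftGroup)
      map_one' := by
        obtain ⟨h1, h2⟩ := (exists_liftShift_eq (1 : Multiplicative (ZMod 2)).toAdd).choose_spec
        exact (mk_eq_mk_iff h1 (map_one _)).2
          (h2.trans (Multiplicative.ofAdd.injective (map_one stableLength)).symm)
      map_mul' := fun y z => by
        obtain ⟨h1, h2⟩ := (exists_liftShift_eq (y * z).toAdd).choose_spec
        obtain ⟨h3, h4⟩ := (exists_liftShift_eq y.toAdd).choose_spec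
        obtain ⟨h5, h6⟩ := (exists_liftShift_eq z.toAdd).choose_spec
        rw [← QuotientGroup.mk_mul]
        refine (mk_eq_mk_iff h1 (by rw [map_mul, h3, h5, one_mul])).2 ?_
        rw [liftShift_ker_mul _ _ h3, h2, h4, h6, toAdd_mul] }
  rightHom := QuotientGroup.lift _ proj fun _ h => (mem_lengthKernel.1 h).1
  inl_injective := fun y z h => by
    obtain ⟨h3, h4⟩ := (exists_liftShift_eq y.toAdd).choose_spec
    obtain ⟨h5, h6⟩ := (exists_liftShift_eq z.toAdd).choose_spec
    have h' := (mk_eq_mk_iff h3 h5).1 h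
    rw [h4, h6] at h'
    exact Multiplicative.toAdd.injective h'
  range_inl_eq_ker_rightHom := by
    ext e
    constructor
    · rintro ⟨z, rfl⟩
      exact (exists_liftShift_eq z.toAdd).choose_spec.1
    · obtain ⟨f, rfl⟩ := QuotientGroup.mk_surjective e
      intro (h : proj f = 1)
      obtain ⟨h1, h2⟩ := (exists_liftShift_eq (liftShift f)).choose_spec
      exact ⟨Multiplicative.ofAdd (liftShift f), (mk_eq_mk_iff h1 h).2 h2⟩
  rightHom_surjective := fun g => by
    obtain ⟨f, hf⟩ := proj_surjective g
    exact ⟨f, hf⟩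

theorem eulerExtension_inl {f : LiftGroup} (h : proj f = 1) :
    eulerExtension.inl (Multiplicative.ofAdd (liftShift f)) = f := by
  obtain ⟨h1, h2⟩ := (exists_liftShift_eq (liftShift f)).choose_spec
  exact (mk_eq_mk_iff h1 h).2 h2

theorem isEulerExtension_eulerExtension : IsEulerExtension stableLength eulerExtension :=
  ⟨fun p => eulerExtension_inl p.2, fun _ => rfl⟩

theorem eulerExtension_central :
    eulerExtension.inl.range ≤ Subgroup.center (LiftGroup ⧸ lengthKernel stableLength) := by
  rintro _ ⟨z, rfl⟩
  rw [Subgroup.mem_center_iff]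
  intro e
  obtain ⟨f, rfl⟩ := QuotientGroup.mk_surjective e
  obtain ⟨p, hp, hz⟩ := exists_liftShift_eq z.toAdd
  obtain rfl : Multiplicative.ofAdd (liftShift p) = z := by rw [hz, ofAdd_toAdd]
  have h := (mk_eq_mk_iff (f := f * p * f⁻¹) (by simp [hp]) hp).2 (liftShift_conj p f hp)
  rw [eulerExtension_inl hp, ← mul_inv_eq_iff_eq_mul, ← QuotientGroup.mk_mul, ← QuotientGroup.mk_inv,
    ← QuotientGroup.mk_mul, h]

/-- The values of the section are represented by lifts. The obstruction is then the class of the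
lifted relation, whose shift is 1 whatever lifts are taken. -/
theorem pairing_eulerExtension :
    pairing (extensionClass eulerExtension eulerExtension_central) omegaClass = 1 := by
  refine (pairing_mk _ _).trans ?_
  have hlift : ∀ g, ∃ f : LiftGroup, (f : LiftGroup ⧸ lengthKernel stableLength) =
      extensionSection eulerExtension g ∧ proj f = g := fun g => by
    obtain ⟨f, hf⟩ := QuotientGroup.mk_surjective (extensionSection eulerExtension g)
    refine ⟨f, hf, ?_⟩
    rw [← isEulerExtension_eulerExtension.2 f, hf, rightHom_extensionSection]
  obtain ⟨t, ht, ht'⟩ := hlift tauOne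
  obtain ⟨s, hs, hs'⟩ := hlift sigma
  obtain ⟨a, ha, ha'⟩ := hlift alpha
  obtain ⟨d, hd, hd'⟩ := hlift delta
  have h1 := liftShift_relation t s a d ht' hs' ha' hd'
  have h2 : proj (⁅t, s⁆ * ⁅a, d⁆) = 1 := by
    rw [map_mul, map_commutatorElement, map_commutatorElement, ht', hs', ha', hd', relation]
  have h3 := eulerExtension_inl h2
  rw [h1] at h3
  have h4 := evalChain_factorSet_relationCycle eulerExtension_central relation
  rw [← ht, ← hs, ← ha, ← hd] at h4
  exact Multiplicative.ofAdd.injective (eulerExtension.inl_injective (h4.trans h3.symm))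

end Euler

end Spheromorphism

theorem corollary1 :
    ∃ ℓ : proj.ker →* Multiplicative (ZMod 2),
      IsStableLength ℓ ∧ (∀ ℓ', IsStableLength ℓ' → ℓ' = ℓ) ∧
      ∃ (_ : (lengthKernel ℓ).Normal)
        (S : GroupExtension (Multiplicative (ZMod 2)) (LiftGroup ⧸ lengthKernel ℓ) Neretin),
        IsEulerExtension ℓ S ∧
        ∃ hS : S.inl.range ≤ Subgroup.center (LiftGroup ⧸ lengthKernel ℓ),
          pairing (extensionClass S hS) omegaClass = 1 ∧ omegaClass ≠ 0 :=
  ⟨stableLength, isStableLength_stableLength, fun _ h => isStableLength_stableLength.unique h,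
    lengthKernel_normal, eulerExtension, isEulerExtension_eulerExtension, eulerExtension_central,
    pairing_eulerExtension, fun h => by
      have := pairing_eulerExtension
      rw [h, pairing_zero] at this
      exact zero_ne_one this⟩
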